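/- Let $k$ be a field and let $A$ be a connected cochain DG algebra over $k$: a graded $k$-algebra $A=\bigoplus_{i\ge 0}A^i$ with $A^0=k$, with a $k$-linear differential $\partial$ of degree $1$ such that $\partial^2=0$ and $\partial(ab)=\partial(a)b+(-1)^{|a|}a\,\partial(b)$. Let $D(A)$ be the derived category of (left) DG $A$-modules, with suspension $\Sigma$, and let $D^c(A)$ be the full subcategory of compact objects, i.e. of those $M$ for which $\mathrm{Hom}_{D(A)}(M,-)$ preserves all coproducts. A morphism $f$ of $D(A)$ is a ghost if $H(f)=0$. The ghost length $\mathrm{gh.len}_A M$ is $-1$ if $M$ is a zero object of $D(A)$; otherwise it is the number $n\ge 0$ such that every composite $M\to I_1\to\cdots\to I_{n+1}$ of $n+1$ ghosts is zero and some composite of $n$ ghosts starting at $M$ is non-zero (the empty composite being $\mathrm{id}_M$), and $+\infty$ if there is no such $n$. The left ghost dimension of $A$ is $l.\mathrm{gh.dim}\,A=\sup\{\mathrm{gh.len}_A M \mid M\in D^c(A)\}$. Let $\langle A\rangle_0$ be the class of zero objects of $D(A)$; let $\langle A\rangle_1$ be the closure under isomorphisms and direct summands of the class of finite direct sums of suspensions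 $\Sigma^iA$, $i\in\mathbb Z$; and for $n\ge 2$ let $\langle A\rangle_n$ be the closure under isomorphisms and direct summands of the class of all $M$ for which there is an exact triangle $L\to M\to N\to\Sigma L$ with $L\in\langle A\rangle_{n-1}$ and $N\in\langle A\rangle_1$. The level of $M$ is $\mathrm{level}^A_{D(A)}(M)=\inf\{n\ge 0\mid M\in\langle A\rangle_n\}$, and the Rouquier dimension is $\mathrm{Rouq.dim}\,A=\inf\{n\ge 0\mid \langle A\rangle_n=D^c(A)\}$, with $\inf\emptyset=+\infty$ in both cases. Then for every $M\in D^c(A)$ $$\mathrm{gh.len}_A M=\mathrm{level}^A_{D(A)}(M)-1,$$ and $$\mathrm{Rouq.dim}\,A=l.\mathrm{gh.dim}\,A+1,$$ as equalities in $\mathbb Z\cup\{+\infty\}$. -/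

import Mathlib

open CategoryTheory CategoryTheory.Limits

universe u

noncomputable section

/-! ### DG algebras -/

/-- A (cohomologically graded) DG algebra over `k`: a `ℤ`-graded `k`-algebra with a `k`-linear
differential of degree `1` that squares to zero and satisfies the graded Leibniz rule. -/
structure DGAlg (k : Type u) [Field k] where
  carrier : Type u
  [ring : Ring carrier]
  [algebra : Algebra k carrier]
  gr : ℤ → Submodule k carrier
  [graded : GradedAlgebra gr]
  d : carrier →ₗ[k] carrier
  d_mem : ∀ {p : ℤ} {a : carrier}, a ∈ gr p → d a ∈ gr (p + 1)
  d_d : ∀ a : carrier, d (d a) = 0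
  leibniz : ∀ {p : ℤ} {a : carrier} (b : carrier), a ∈ gr p →
    d (a * b) = d a * b + p.negOnePow • (a * d b)

namespace DGAlg

attribute [instance] DGAlg.ring DGAlg.algebra DGAlg.graded

variable {k : Type u} [Field k]

/-- A connected cochain DG algebra: it is concentrated in non-negative degrees, and its component
of degree `0` is `k` (through the structure map, which is injective). -/
structure IsConnectedCochain (A : DGAlg k) : Prop where
  gr_neg : ∀ p : ℤ, p < 0 → A.gr p = ⊥
  injective : Function.Injective (algebraMap k A.carrier)
  gr_zero : A.gr 0 = LinearMap.range (Algebra.linearMap k A.carrier)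

variable (A : DGAlg k)

/-- The unit, as an element of degree `0`. -/
def oneGr : A.gr 0 := ⟨1, SetLike.one_mem_graded A.gr⟩

/-- The product of homogeneous elements. -/
def mulGr {p p' s : ℤ} (h : p + p' = s) (a : A.gr p) (b : A.gr p') : A.gr s :=
  ⟨a.1 * b.1, h ▸ SetLike.mul_mem_graded a.2 b.2⟩

/-- The differential of a homogeneous element. -/
def dGr {p p' : ℤ} (h : p + 1 = p') (a : A.gr p) : A.gr p' :=
  ⟨A.d a.1, h ▸ A.d_mem a.2⟩

end DGAlg

variable {k : Type u} [Field k]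

/-! ### DG modules -/

/-- A left DG module over `A`, given by its homogeneous components. Degrees that have to add up
do so through an explicit equation. The `k`-vector space structure is the one obtained by
restricting the action along `k → A`; as `d 1 = 0` in `A`, the differential is `k`-linear by the
Leibniz rule. -/
structure DGMod (A : DGAlg k) where
  X : ℤ → Type u
  [grp : ∀ q, AddCommGroup (X q)]
  d : ∀ {q q' : ℤ}, q + 1 = q' → (X q →+ X q')
  d_d : ∀ {q q' q'' : ℤ} (h : q + 1 = q') (h' : q' + 1 = q'') (x : X q), d h' (d h x) = 0
  smul : ∀ {p q n : ℤ}, p + q = n → (A.gr p →+ X q →+ X n)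
  one_smul : ∀ {q : ℤ} (h : 0 + q = q) (x : X q), smul h A.oneGr x = x
  mul_smul : ∀ {p p' s q r n : ℤ} (hs : p + p' = s) (hsn : s + q = n) (hr : p' + q = r)
    (hn : p + r = n) (a : A.gr p) (b : A.gr p') (x : X q),
    smul hsn (A.mulGr hs a b) x = smul hn a (smul hr b x)
  leibniz : ∀ {p p' q q' n n' : ℤ} (hp : p + 1 = p') (hq : q + 1 = q') (hn : n + 1 = n')
    (h : p + q = n) (h₁ : p' + q = n') (h₂ : p + q' = n') (a : A.gr p) (x : X q),
    d hn (smul h a x) = smul h₁ (A.dGr hp a) x + p.negOnePow • smul h₂ a (d hq x)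

namespace DGMod

attribute [instance] DGMod.grp

variable {A : DGAlg k}

/-- DG morphisms: `A`-linear maps of degree `0` that commute with the differentials. -/
@[ext]
structure Hom (M N : DGMod A) where
  f : ∀ q : ℤ, M.X q →+ N.X q
  comm : ∀ {q q' : ℤ} (h : q + 1 = q') (x : M.X q), f q' (M.d h x) = N.d h (f q x)
  map_smul : ∀ {p q n : ℤ} (h : p + q = n) (a : A.gr p) (x : M.X q),
    f n (M.smul h a x) = N.smul h a (f q x)

/-- The category of DG modules over `A`. -/
instance : Category (DGMod A) where
  Hom M N := Hom M N
  id M := ⟨fun _ => AddMonoidHom.id _, fun _ _ => rfl, fun _ _ _ => rfl⟩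
  comp φ ψ := ⟨fun q => (ψ.f q).comp (φ.f q), fun h x => by simp [φ.comm, ψ.comm],
    fun h a x => by simp [φ.map_smul, ψ.map_smul]⟩

@[ext]
lemma hom_ext {M N : DGMod A} {φ ψ : M ⟶ N} (h : ∀ q x, Hom.f φ q x = Hom.f ψ q x) : φ = ψ :=
  Hom.ext (funext fun q => AddMonoidHom.ext (h q))

@[simp] lemma id_f (M : DGMod A) (q : ℤ) (x : M.X q) : Hom.f (𝟙 M) q x = x := rfl
@[simp] lemma comp_f {M N P : DGMod A} (φ : M ⟶ N) (ψ : N ⟶ P) (q : ℤ) (x : M.X q) :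
    Hom.f (φ ≫ ψ) q x = Hom.f ψ q (Hom.f φ q x) := rfl

lemma map_units_smul {G H : Type*} [AddCommGroup G] [AddCommGroup H] (f : G →+ H) (e : ℤˣ)
    (x : G) : f (e • x) = e • f x := by
  simp [Units.smul_def]

instance (M N : DGMod A) : Zero (M ⟶ N) := ⟨⟨fun _ => 0, by simp, by simp⟩⟩
instance (M N : DGMod A) : Add (M ⟶ N) :=
  ⟨fun φ ψ => ⟨fun q => Hom.f φ q + Hom.f ψ q,
    fun h x => by simp [Hom.comm φ h, Hom.comm ψ h],
    fun h a x => by simp [Hom.map_smul φ h, Hom.map_smul ψ h]⟩⟩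
instance (M N : DGMod A) : Neg (M ⟶ N) :=
  ⟨fun φ => ⟨fun q => -Hom.f φ q,
    fun h x => by simp [Hom.comm φ h],
    fun h a x => by simp [Hom.map_smul φ h]⟩⟩

@[simp] lemma zero_f (M N : DGMod A) (q : ℤ) (x : M.X q) : Hom.f (0 : M ⟶ N) q x = 0 := rfl
@[simp] lemma add_f {M N : DGMod A} (φ ψ : M ⟶ N) (q : ℤ) (x : M.X q) :
    Hom.f (φ + ψ) q x = Hom.f φ q x + Hom.f ψ q x := rfl
@[simp] lemma neg_f {M N : DGMod A} (φ : M ⟶ N) (q : ℤ) (x : M.X q) :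
    Hom.f (-φ) q x = -Hom.f φ q x := rfl

instance (M N : DGMod A) : AddCommGroup (M ⟶ N) where
  add_assoc _ _ _ := by ext; simp [add_assoc]
  zero_add _ := by ext; simp
  add_zero _ := by ext; simp
  add_comm _ _ := by ext; simp [add_comm]
  neg_add_cancel _ := by ext; simp
  nsmul := nsmulRec
  zsmul := zsmulRec

instance : Preadditive (DGMod A) where
  add_comp _ _ _ _ _ _ := by ext; simp
  comp_add _ _ _ _ _ _ := by ext; simp

/-- The DG module `A`. -/
def self (A : DGAlg k) : DGMod A where
  X q := A.gr q
  d h := { toFun := A.dGr h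
           map_zero' := by ext; simp [DGAlg.dGr]
           map_add' := fun _ _ => by ext; simp [DGAlg.dGr] }
  d_d h h' x := by ext; simp [DGAlg.dGr, A.d_d]
  smul h := AddMonoidHom.mk' (fun a => AddMonoidHom.mk' (fun b => A.mulGr h a b)
      (fun _ _ => by ext; simp [DGAlg.mulGr, mul_add]))
    (fun _ _ => by ext; simp [DGAlg.mulGr, add_mul])
  one_smul h x := by ext; simp [DGAlg.mulGr, DGAlg.oneGr]
  mul_smul hs hsn hr hn a b x := by ext; simp [DGAlg.mulGr, mul_assoc]
  leibniz hp hq hn h h₁ h₂ a x := by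
    ext; simp [DGAlg.mulGr, DGAlg.dGr, A.leibniz _ a.2, Units.smul_def]

/-- Transport of an element along an equality of degrees. -/
def cast (M : DGMod A) {q q' : ℤ} (h : q = q') : M.X q →+ M.X q' :=
  h ▸ AddMonoidHom.id (M.X q)

@[simp] lemma cast_rfl (M : DGMod A) {q : ℤ} (x : M.X q) : M.cast rfl x = x := rfl

lemma cast_smul (M : DGMod A) {p q n n' : ℤ} (h : p + q = n) (e : n = n') (a : A.gr p)
    (x : M.X q) : M.cast e (M.smul h a x) = M.smul (h.trans e) a x := by
  subst e; rfl

lemma smul_cast (M : DGMod A) {p q q' n : ℤ} (e : q = q') (h : p + q' = n) (a : A.gr p)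
    (x : M.X q) : M.smul h a (M.cast e x) = M.smul (e.symm ▸ h) a x := by
  subst e; rfl

lemma cast_d (M : DGMod A) {q n n' : ℤ} (h : q + 1 = n) (e : n = n') (x : M.X q) :
    M.cast e (M.d h x) = M.d (h.trans e) x := by
  subst e; rfl

lemma d_cast (M : DGMod A) {q q' n : ℤ} (e : q = q') (h : q' + 1 = n) (x : M.X q) :
    M.d h (M.cast e x) = M.d (e.symm ▸ h) x := by
  subst e; rfl

lemma Hom.f_cast {M N : DGMod A} (φ : Hom M N) {q q' : ℤ} (e : q = q') (x : M.X q) :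
    φ.f q' (M.cast e x) = N.cast e (φ.f q x) := by
  subst e; rfl

/-- The suspension `Σ^i M`, with `(Σ^i M)^q = M^{q+i}`, action `a (Σ^i m) = (-1)^{|a| i} Σ^i (a m)`
and differential `d (Σ^i m) = (-1)^i Σ^i (d m)`. -/
def shift (i : ℤ) (M : DGMod A) : DGMod A where
  X q := M.X (q + i)
  d {q q'} h := i.negOnePow • M.d (show (q + i) + 1 = q' + i by lia)
  d_d h h' x := by simp [M.d_d]
  smul {p q n} h := (p * i).negOnePow • M.smul (show p + (q + i) = n + i by lia)
  one_smul {q} h x := by simpa using M.one_smul (zero_add _) x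
  mul_smul {p p' s q r n} hs hsn hr hn a b x := by
    subst hs
    simp [M.mul_smul rfl (show (p + p') + (q + i) = n + i by lia)
      (show p' + (q + i) = r + i by lia) (show p + (r + i) = n + i by lia), smul_smul, add_mul,
      Int.negOnePow_add]
    rw [mul_comm]
  leibniz {p p' q q' n n'} hp hq hn h h₁ h₂ a x := by
    subst hp
    simp [M.leibniz rfl (show (q + i) + 1 = q' + i by lia)
      (show (n + i) + 1 = n' + i by lia) (show p + (q + i) = n + i by lia)
      (show (p + 1) + (q + i) = n' + i by lia) (show p + (q' + i) = n' + i by lia), smul_smul,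
      add_mul, Int.negOnePow_add]
    rw [mul_comm i.negOnePow (p * i).negOnePow, mul_left_comm p.negOnePow, mul_comm p.negOnePow]

lemma shift_d (i : ℤ) (M : DGMod A) {q q' : ℤ} (h : q + 1 = q') (x : M.X (q + i)) :
    (M.shift i).d h x = i.negOnePow • M.d (show (q + i) + 1 = q' + i by lia) x := rfl

lemma shift_smul (i : ℤ) (M : DGMod A) {p q n : ℤ} (h : p + q = n) (a : A.gr p)
    (x : M.X (q + i)) : (M.shift i).smul h a x =
      (p * i).negOnePow • M.smul (show p + (q + i) = n + i by lia) a x := rfl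

/-- The suspension functor `Σ^i` on DG modules. -/
def shiftFun (A : DGAlg k) (i : ℤ) : DGMod A ⥤ DGMod A where
  obj M := M.shift i
  map {M N} φ :=
    { f := fun q => Hom.f φ (q + i)
      comm := fun {q q'} h x =>
        (map_units_smul (Hom.f φ (q' + i)) _ _).trans (congrArg (i.negOnePow • ·)
          (Hom.comm φ (show (q + i) + 1 = q' + i by lia) x))
      map_smul := fun {p q n} h a x =>
        (map_units_smul (Hom.f φ (n + i)) _ _).trans (congrArg ((p * i).negOnePow • ·)
          (Hom.map_smul φ (show p + (q + i) = n + i by lia) a x)) }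

/-- The mapping cone `Cone φ = N ⊕ Σ M` of `φ : M ⟶ N`, with differential
`d (n, Σ m) = (d n + φ m, - Σ (d m))` and action `a (n, Σ m) = (a n, (-1)^{|a|} Σ (a m))`. -/
def cone {M N : DGMod A} (φ : M ⟶ N) : DGMod A where
  X q := N.X q × M.X (q + 1)
  d {q q'} h := AddMonoidHom.mk'
    (fun z => (N.d h z.1 + Hom.f φ q' (M.cast h z.2),
      -M.d (show (q + 1) + 1 = q' + 1 by lia) z.2))
    (fun z w => by ext <;> simp <;> abel)
  d_d h h' z := by
    subst h h'
    ext <;> simp [N.d_d, M.d_d, Hom.comm φ rfl]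
  smul {p q n} h := AddMonoidHom.mk'
    (fun a => AddMonoidHom.mk'
      (fun z => (N.smul h a z.1,
        p.negOnePow • M.smul (show p + (q + 1) = n + 1 by lia) a z.2))
      (fun z w => by ext <;> simp))
    (fun a b => by ext <;> simp)
  one_smul {q} h z := by
    ext
    · simpa using N.one_smul h z.1
    · simpa using M.one_smul (zero_add _) z.2
  mul_smul {p p' s q r n} hs hsn hr hn a b z := by
    ext
    · simpa using N.mul_smul hs hsn hr hn a b z.1
    · subst hs
      simp [M.mul_smul rfl (show (p + p') + (q + 1) = n + 1 by lia)
        (show p' + (q + 1) = r + 1 by lia) (show p + (r + 1) = n + 1 by lia), smul_smul,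
        Int.negOnePow_add]
  leibniz {p p' q q' n n'} hp hq hn h h₁ h₂ a z := by
    subst hp
    ext
    · simp [N.leibniz rfl hq hn h h₁ h₂, cast_smul, smul_cast, Hom.f_cast,
        Hom.map_smul φ (show p + (q + 1) = n + 1 by lia)]
      abel
    · simp [M.leibniz rfl (show (q + 1) + 1 = q' + 1 by lia)
        (show (n + 1) + 1 = n' + 1 by lia) (show p + (q + 1) = n + 1 by lia)
        (show (p + 1) + (q + 1) = n' + 1 by lia) (show p + (q' + 1) = n' + 1 by lia), smul_smul,
        Int.negOnePow_add]
      abel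

/-- The inclusion `N ⟶ Cone φ`. -/
def coneInl {M N : DGMod A} (φ : M ⟶ N) : N ⟶ cone φ where
  f q := AddMonoidHom.inl _ _
  comm {q q'} h x := by
    change ((N.d h x, 0) : N.X q' × M.X (q' + 1)) = (N.d h x + Hom.f φ q' (M.cast h 0), -M.d _ 0)
    simp
  map_smul {p q n} h a x := by
    change ((N.smul h a x, 0) : N.X n × M.X (n + 1)) = (N.smul h a x, p.negOnePow • M.smul _ a 0)
    simp

/-- The projection `Cone φ ⟶ Σ M`. -/
def coneSnd {M N : DGMod A} (φ : M ⟶ N) : cone φ ⟶ (shiftFun A 1).obj M where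
  f q := AddMonoidHom.snd _ _
  comm {q q'} h x := by
    change -M.d (show (q + 1) + 1 = q' + 1 by lia) x.2 =
      (1 : ℤ).negOnePow • M.d (show (q + 1) + 1 = q' + 1 by lia) x.2
    simp
  map_smul {p q n} h a x := by
    change p.negOnePow • M.smul (show p + (q + 1) = n + 1 by lia) a x.2 =
      (p * 1).negOnePow • M.smul (show p + (q + 1) = n + 1 by lia) a x.2
    simp

/-! ### Finite direct sums of DG modules -/

/-- The zero DG module. -/
def zero (A : DGAlg k) : DGMod A where
  X _ := PUnit
  d _ := 0
  d_d _ _ _ := rfl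
  smul _ := 0
  one_smul _ _ := rfl
  mul_smul _ _ _ _ _ _ _ := rfl
  leibniz _ _ _ _ _ _ _ _ := rfl

lemma isZero_zero (A : DGAlg k) : IsZero (zero A) :=
  (IsZero.iff_id_eq_zero _).2 (by ext; rfl)

instance : HasZeroObject (DGMod A) := ⟨⟨zero A, isZero_zero A⟩⟩

/-- The direct sum of two DG modules. -/
def prod (M N : DGMod A) : DGMod A where
  X q := M.X q × N.X q
  d h := (M.d h).prodMap (N.d h)
  d_d h h' z := by ext <;> simp [M.d_d, N.d_d]
  smul h := AddMonoidHom.mk' (fun a => (M.smul h a).prodMap (N.smul h a))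
    (fun a b => by ext <;> simp)
  one_smul h z := by ext <;> simp [M.one_smul, N.one_smul]
  mul_smul hs hsn hr hn a b z := by
    ext
    · simpa using M.mul_smul hs hsn hr hn a b z.1
    · simpa using N.mul_smul hs hsn hr hn a b z.2
  leibniz hp hq hn h h₁ h₂ a z := by
    ext
    · simpa using M.leibniz hp hq hn h h₁ h₂ a z.1
    · simpa using N.leibniz hp hq hn h h₁ h₂ a z.2

/-- The biproduct bicone on the direct sum of two DG modules. -/
def prodBicone (M N : DGMod A) : BinaryBicone M N where
  pt := prod M N
  fst := ⟨fun _ => AddMonoidHom.fst _ _, fun _ _ => rfl, fun _ _ _ => rfl⟩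
  snd := ⟨fun _ => AddMonoidHom.snd _ _, fun _ _ => rfl, fun _ _ _ => rfl⟩
  inl := ⟨fun _ => AddMonoidHom.inl _ _,
    fun h _ => Prod.ext rfl (map_zero (N.d h)).symm,
    fun h a _ => Prod.ext rfl (map_zero (N.smul h a)).symm⟩
  inr := ⟨fun _ => AddMonoidHom.inr _ _,
    fun h _ => Prod.ext (map_zero (M.d h)).symm rfl,
    fun h a _ => Prod.ext (map_zero (M.smul h a)).symm rfl⟩

instance : HasBinaryBiproducts (DGMod A) where
  has_binary_biproduct M N := HasBinaryBiproduct.mk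
    ⟨prodBicone M N, isBinaryBilimitOfTotal _ (by
      ext q x
      exact Prod.fst_add_snd x)⟩

instance : HasFiniteProducts (DGMod A) := hasFiniteProducts_of_has_binary_and_terminal

/-! ### Cohomology and quasi-isomorphisms -/

/-- The cocycles of degree `q`. -/
def cocycles (M : DGMod A) (q : ℤ) : AddSubgroup (M.X q) := (M.d (rfl : q + 1 = q + 1)).ker

/-- The coboundaries of degree `q`. -/
def coboundaries (M : DGMod A) (q : ℤ) : AddSubgroup (M.X q) :=
  (M.d (show (q - 1) + 1 = q by lia)).range

/-- The cohomology group `H^q(M)`. -/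
abbrev H (M : DGMod A) (q : ℤ) : Type u :=
  M.cocycles q ⧸ (M.coboundaries q).addSubgroupOf (M.cocycles q)

/-- The map induced by a DG morphism on cocycles. -/
def cocyclesMap {M N : DGMod A} (φ : M ⟶ N) (q : ℤ) : M.cocycles q →+ N.cocycles q :=
  ((Hom.f φ q).comp (M.cocycles q).subtype).codRestrict _ (fun x => by
    have hx : M.d (rfl : q + 1 = q + 1) x.1 = 0 := x.2
    change N.d (rfl : q + 1 = q + 1) (Hom.f φ q x.1) = 0
    rw [← Hom.comm φ, hx, map_zero])

/-- The map `H^q(φ)`. -/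
def HMap {M N : DGMod A} (φ : M ⟶ N) (q : ℤ) : M.H q →+ N.H q :=
  QuotientAddGroup.map _ _ (cocyclesMap φ q) (by
    rintro x ⟨y, hy⟩
    exact ⟨Hom.f φ _ y, by rw [← Hom.comm φ, hy]; rfl⟩)

/-- The cohomology functor `H^q`. -/
def cohomology (A : DGAlg k) (q : ℤ) : DGMod A ⥤ AddCommGrpCat.{u} where
  obj M := AddCommGrpCat.of (M.H q)
  map φ := AddCommGrpCat.ofHom (HMap φ q)
  map_id M := by
    ext x; rfl
  map_comp φ ψ := by
    ext x; rfl

instance (q : ℤ) : (cohomology A q).Additive where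
  map_add {M N φ ψ} := by
    ext x; obtain ⟨x, rfl⟩ := QuotientAddGroup.mk_surjective x; rfl

/-- The quasi-isomorphisms. -/
def quasiIso (A : DGAlg k) : MorphismProperty (DGMod A) :=
  fun _ _ φ => ∀ q : ℤ, IsIso ((cohomology A q).map φ)

instance : (quasiIso A).ContainsIdentities := ⟨fun M q => by
  rw [CategoryTheory.Functor.map_id]; infer_instance⟩

instance : (quasiIso A).RespectsIso :=
  MorphismProperty.RespectsIso.of_respects_arrow_iso _ (fun _ _ e hφ q =>
    ((MorphismProperty.isomorphisms _).arrow_mk_iso_iff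
      ((cohomology A q).mapArrow.mapIso e)).1 (hφ q))

instance : (quasiIso A).IsStableUnderFiniteProducts where
  isStableUnderProductsOfShape J _ :=
    { condition := fun X₁ X₂ c₁ c₂ hc₁ hc₂ f hf α hα q => by
        have : HasFiniteBiproducts (DGMod A) := HasFiniteBiproducts.of_hasFiniteProducts
        have : PreservesFiniteProducts (cohomology A q) :=
          ⟨fun _ => preservesProductsOfShape_of_preservesBiproductsOfShape _⟩
        have : PreservesLimitsOfShape (Discrete J) (cohomology A q) := inferInstance
        have (j : Discrete J) : IsIso ((Functor.whiskerRight f (cohomology A q)).app j) := hf j q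
        have := NatIso.isIso_of_isIso_app (Functor.whiskerRight f (cohomology A q))
        let e := (isLimitOfPreserves (cohomology A q) hc₁).conePointsIsoOfNatIso
          (isLimitOfPreserves (cohomology A q) hc₂)
          (asIso (Functor.whiskerRight f (cohomology A q)))
        have he : (cohomology A q).map α = e.hom := by
          refine (isLimitOfPreserves (cohomology A q) hc₂).hom_ext (fun j => ?_)
          have h₁ := (isLimitOfPreserves (cohomology A q) hc₁).conePointsIsoOfNatIso_hom_comp
            (isLimitOfPreserves (cohomology A q) hc₂)
            (asIso (Functor.whiskerRight f (cohomology A q))) j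
          refine Eq.trans ?_ h₁.symm
          have h₂ := congrArg (cohomology A q).map (hα j)
          simpa using h₂
        rw [he]
        infer_instance }

lemma isIso_cohomology_map_iff {M N : DGMod A} (φ : M ⟶ N) (q : ℤ) :
    IsIso ((cohomology A q).map φ) ↔
      (∀ x : M.X q, M.d rfl x = 0 → Hom.f φ q x ∈ N.coboundaries q → x ∈ M.coboundaries q) ∧
      (∀ y : N.X q, N.d rfl y = 0 → ∃ x : M.X q, M.d rfl x = 0 ∧
        Hom.f φ q x - y ∈ N.coboundaries q) := by
  rw [ConcreteCategory.isIso_iff_bijective]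
  change Function.Bijective (HMap φ q) ↔ _
  refine and_congr ?_ ?_
  · rw [injective_iff_map_eq_zero]
    constructor
    · intro h x hx hb
      have := h (QuotientAddGroup.mk ⟨x, hx⟩) ((QuotientAddGroup.eq_zero_iff _).2 hb)
      exact (QuotientAddGroup.eq_zero_iff (⟨x, hx⟩ : M.cocycles q)).1 this
    · intro h x hx
      obtain ⟨x, rfl⟩ := QuotientAddGroup.mk_surjective x
      exact (QuotientAddGroup.eq_zero_iff _).2 (h x.1 x.2 
        ((QuotientAddGroup.eq_zero_iff (cocyclesMap φ q x)).1 hx))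
  · constructor
    · intro h y hy
      obtain ⟨x, hx⟩ := h (QuotientAddGroup.mk ⟨y, hy⟩)
      obtain ⟨x, rfl⟩ := QuotientAddGroup.mk_surjective x
      refine ⟨x.1, x.2, ?_⟩
      have := (QuotientAddGroup.eq_iff_sub_mem).1 hx
      exact this
    · intro h y
      obtain ⟨y, rfl⟩ := QuotientAddGroup.mk_surjective y
      obtain ⟨x, hx, hxy⟩ := h y.1 y.2
      exact ⟨QuotientAddGroup.mk ⟨x, hx⟩, (QuotientAddGroup.eq_iff_sub_mem).2 hxy⟩

lemma quasiIso_shiftFun (i : ℤ) {M N : DGMod A} (φ : M ⟶ N) (hφ : quasiIso A φ) :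
    quasiIso A ((shiftFun A i).map φ) := by
  have hb (P : DGMod A) (q : ℤ) (x : P.X (q + i)) :
      x ∈ (P.shift i).coboundaries q ↔ x ∈ P.coboundaries (q + i) := by
    constructor
    · rintro ⟨y, hy⟩
      have hy' : i.negOnePow • P.d (show q - 1 + i + 1 = q + i by lia) y = x := hy
      refine ⟨i.negOnePow • P.cast (by lia) (show P.X (q - 1 + i) from y), ?_⟩
      rw [map_units_smul, d_cast, hy']
    · rintro ⟨y, hy⟩
      refine ⟨i.negOnePow • P.cast (show q + i - 1 = q - 1 + i by lia) y, ?_⟩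
      refine (map_units_smul ((P.shift i).d (show q - 1 + 1 = q by lia)) _ _).trans ?_
      change i.negOnePow • i.negOnePow • P.d (show q - 1 + i + 1 = q + i by lia) _ = x
      rw [smul_smul, d_cast, hy]
      simp
  have hz (P : DGMod A) (q : ℤ) (x : P.X (q + i)) :
      (P.shift i).d (rfl : q + 1 = q + 1) x = 0 ↔ P.d (rfl : q + i + 1 = q + i + 1) x = 0 := by
    change i.negOnePow • P.d (show q + i + 1 = q + 1 + i by lia) x = 0 ↔ _
    rw [smul_eq_zero_iff_eq, ← cast_d P rfl (show q + i + 1 = q + 1 + i by lia) x]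
    generalize P.d (rfl : q + i + 1 = q + i + 1) x = z
    generalize_proofs e
    revert z e
    generalize q + 1 + i = t
    rintro z rfl
    rfl
  intro q
  obtain ⟨h₁, h₂⟩ := (isIso_cohomology_map_iff φ (q + i)).1 (hφ (q + i))
  refine (isIso_cohomology_map_iff _ q).2 ⟨fun x hx hxb => ?_, fun y hy => ?_⟩
  · exact (hb M q x).2 (h₁ x ((hz M q x).1 hx) ((hb N q _).1 hxb))
  · obtain ⟨x, hx, hxy⟩ := h₂ y ((hz N q y).1 hy)
    exact ⟨x, (hz M q x).2 hx, (hb N q _).2 hxy⟩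

end DGMod

/-! ### The derived category -/

/-- The derived category `D(A)`: DG modules, with the quasi-isomorphisms inverted. -/
abbrev DerivedCat (A : DGAlg k) := (DGMod.quasiIso A).Localization

namespace DerivedCat

open DGMod

variable {A : DGAlg k}

/-- The localization functor from DG modules to the derived category. -/
abbrev Q (A : DGAlg k) : DGMod A ⥤ DerivedCat A := (quasiIso A).Q

/-- The binary product property of `M ⊞ N` in the derived category. -/
def isLimitQ (M N : DGMod A) : IsLimit (BinaryFan.mk
    ((Q A).map (biprod.fst : M ⊞ N ⟶ M)) ((Q A).map (biprod.snd : M ⊞ N ⟶ N))) :=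
  mapIsLimitOfPreservesOfIsLimit (Q A) _ _ (BinaryBiproduct.isLimit M N)

/-- The morphism to `M ⊞ N` in the derived category with given components. -/
def liftQ {X : DerivedCat A} {M N : DGMod A} (f : X ⟶ (Q A).obj M) (g : X ⟶ (Q A).obj N) :
    X ⟶ (Q A).obj (M ⊞ N) :=
  (isLimitQ M N).lift (BinaryFan.mk f g)

lemma liftQ_fst {X : DerivedCat A} {M N : DGMod A} (f : X ⟶ (Q A).obj M)
    (g : X ⟶ (Q A).obj N) : liftQ f g ≫ (Q A).map biprod.fst = f :=
  (isLimitQ M N).fac (BinaryFan.mk f g) ⟨WalkingPair.left⟩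

lemma liftQ_snd {X : DerivedCat A} {M N : DGMod A} (f : X ⟶ (Q A).obj M)
    (g : X ⟶ (Q A).obj N) : liftQ f g ≫ (Q A).map biprod.snd = g :=
  (isLimitQ M N).fac (BinaryFan.mk f g) ⟨WalkingPair.right⟩

/-- The sum of two morphisms in the derived category. -/
def addQ {X : DerivedCat A} {M : DGMod A} (f g : X ⟶ (Q A).obj M) : X ⟶ (Q A).obj M :=
  liftQ f g ≫ (Q A).map (biprod.fst + biprod.snd)

lemma addQ_map {X : DerivedCat A} {L M : DGMod A} (s : X ⟶ (Q A).obj L) (u v : L ⟶ M) :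
    addQ (s ≫ (Q A).map u) (s ≫ (Q A).map v) = s ≫ (Q A).map (u + v) := by
  have : liftQ (s ≫ (Q A).map u) (s ≫ (Q A).map v) = s ≫ (Q A).map (biprod.lift u v) := by
    refine BinaryFan.IsLimit.hom_ext (isLimitQ M M) ?_ ?_
    · refine (liftQ_fst _ _).trans ?_
      simp [← Functor.map_comp]
    · refine (liftQ_snd _ _).trans ?_
      simp [← Functor.map_comp]
  rw [addQ, this, Category.assoc, ← Functor.map_comp]
  simp [biprod.lift_eq]

lemma comp_addQ {X Y : DerivedCat A} {M : DGMod A} (h : Y ⟶ X) (f g : X ⟶ (Q A).obj M) :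
    h ≫ addQ f g = addQ (h ≫ f) (h ≫ g) := by
  have := addQ_map (h ≫ liftQ f g) (biprod.fst : M ⊞ M ⟶ M) biprod.snd
  rw [Category.assoc, Category.assoc, liftQ_fst, liftQ_snd] at this
  rw [this, addQ, Category.assoc]

/-- The sum of two morphisms in the derived category, for an arbitrary target. -/
def addD {X Y : DerivedCat A} (f g : X ⟶ Y) : X ⟶ Y :=
  addQ (M := (Localization.Construction.objEquiv _).symm Y) f g

lemma addD_comp {X Y Z : DerivedCat A} (f g : X ⟶ Y) (h : Y ⟶ Z) :
    addD f g ≫ h = addD (f ≫ h) (g ≫ h) := by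
  let P : MorphismProperty (DerivedCat A) := fun Y Z h =>
    ∀ (X : DerivedCat A) (f g : X ⟶ Y), addD f g ≫ h = addD (f ≫ h) (g ≫ h)
  have : P.IsStableUnderComposition := ⟨fun u v hu hv X f g => by
    rw [← Category.assoc, hu, hv, Category.assoc, Category.assoc]⟩
  have hP : P = ⊤ := by
    refine Localization.Construction.morphismProperty_eq_top' P (fun M N u X f g => ?_)
      (fun Y Z e he X f g => ?_)
    · obtain ⟨L, s, v, w, rfl, rfl⟩ : ∃ (L : DGMod A) (s : X ⟶ (Q A).obj L) (v w : L ⟶ M),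
          f = s ≫ (Q A).map v ∧ g = s ≫ (Q A).map w :=
        ⟨_, liftQ f g, biprod.fst, biprod.snd, (liftQ_fst f g).symm, (liftQ_snd f g).symm⟩
      refine (congrArg (· ≫ (Q A).map u) (addQ_map s v w)).trans ?_
      have h := addQ_map s (v ≫ u) (w ≫ u)
      rw [← Preadditive.add_comp, Functor.map_comp, Functor.map_comp, Functor.map_comp] at h
      simp only [← Category.assoc] at h
      exact h.symm
    · have := he X (f ≫ e.inv) (g ≫ e.inv)
      simp only [Category.assoc, Iso.inv_hom_id, Category.comp_id] at this
      rw [← this, Category.assoc, Iso.hom_inv_id, Category.comp_id]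
  have : P h := by rw [hP]; trivial
  exact this X f g

/-- The zero morphism in the derived category. -/
def zeroQ (X : DerivedCat A) (M : DGMod A) : X ⟶ (Q A).obj M :=
  ((isZero_zero A).isTerminal.isTerminalObj (Q A)).from X ≫ (Q A).map 0

lemma comp_map_zero {X : DerivedCat A} {L M : DGMod A} (s : X ⟶ (Q A).obj L) :
    s ≫ (Q A).map (0 : L ⟶ M) = zeroQ X M := by
  have : (0 : L ⟶ M) = (0 : L ⟶ zero A) ≫ (0 : zero A ⟶ M) := by simp
  rw [this, Functor.map_comp, ← Category.assoc, zeroQ]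
  congr 1
  exact ((isZero_zero A).isTerminal.isTerminalObj (Q A)).hom_ext _ _

lemma exists_rep₂ {X : DerivedCat A} {M : DGMod A} (f g : X ⟶ (Q A).obj M) :
    ∃ (L : DGMod A) (s : X ⟶ (Q A).obj L) (u v : L ⟶ M),
      f = s ≫ (Q A).map u ∧ g = s ≫ (Q A).map v :=
  ⟨_, liftQ f g, biprod.fst, biprod.snd, (liftQ_fst f g).symm, (liftQ_snd f g).symm⟩

lemma exists_rep₃ {X : DerivedCat A} {M : DGMod A} (f g h : X ⟶ (Q A).obj M) :
    ∃ (L : DGMod A) (s : X ⟶ (Q A).obj L) (u v w : L ⟶ M),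
      f = s ≫ (Q A).map u ∧ g = s ≫ (Q A).map v ∧ h = s ≫ (Q A).map w := by
  refine ⟨_, liftQ (liftQ f g) h, biprod.fst ≫ biprod.fst, biprod.fst ≫ biprod.snd, biprod.snd,
    ?_, ?_, (liftQ_snd _ _).symm⟩
  · rw [Functor.map_comp, ← Category.assoc, liftQ_fst, liftQ_fst]
  · rw [Functor.map_comp, ← Category.assoc, liftQ_fst, liftQ_snd]

/-- The abelian group of morphisms `X ⟶ M` in the derived category. -/
@[reducible]
def homGroupQ (X : DerivedCat A) (M : DGMod A) : AddCommGroup (X ⟶ (Q A).obj M) where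
  add := addQ
  zero := zeroQ X M
  neg f := f ≫ (Q A).map (-𝟙 M)
  add_assoc f g h := by
    obtain ⟨L, s, u, v, w, rfl, rfl, rfl⟩ := exists_rep₃ f g h
    change addQ (addQ _ _) _ = addQ _ (addQ _ _)
    simp only [addQ_map, add_assoc]
  zero_add f := by
    change addQ (zeroQ X M) f = f
    have := addQ_map f 0 (𝟙 M)
    simpa [comp_map_zero] using this
  add_zero f := by
    change addQ f (zeroQ X M) = f
    have := addQ_map f (𝟙 M) 0
    simpa [comp_map_zero] using this
  add_comm f g := by
    obtain ⟨L, s, u, v, rfl, rfl⟩ := exists_rep₂ f g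
    change addQ _ _ = addQ _ _
    simp only [addQ_map, add_comm]
  neg_add_cancel f := by
    change addQ (f ≫ (Q A).map (-𝟙 M)) f = zeroQ X M
    have := addQ_map f (-𝟙 M) (𝟙 M)
    simpa [comp_map_zero] using this
  nsmul := @nsmulRec _ ⟨zeroQ X M⟩ ⟨addQ⟩
  zsmul := @zsmulRec _ ⟨zeroQ X M⟩ ⟨addQ⟩ ⟨fun f => f ≫ (Q A).map (-𝟙 M)⟩
    (@nsmulRec _ ⟨zeroQ X M⟩ ⟨addQ⟩)

/-- The additive structure on the derived category for which `Q` is additive. -/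
instance : Preadditive (DerivedCat A) where
  homGroup X Y := homGroupQ X ((Localization.Construction.objEquiv _).symm Y)
  add_comp _ _ _ f g h := addD_comp f g h
  comp_add _ _ Z h f g := comp_addQ (M := (Localization.Construction.objEquiv _).symm Z) h f g

instance : (Q A).Additive where
  map_add {M N u v} := by
    have := addQ_map (𝟙 ((Q A).obj M)) u v
    simp only [Category.id_comp] at this
    exact this.symm

/-- The suspension functor `Σ^i` on the derived category. -/
def shift (A : DGAlg k) (i : ℤ) : DerivedCat A ⥤ DerivedCat A :=
  Localization.lift (shiftFun A i ⋙ Q A)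
    (fun _ _ φ hφ => Localization.inverts (Q A) (quasiIso A) _ (quasiIso_shiftFun i φ hφ)) (Q A)

/-- The suspension functors on DG modules and on the derived category are compatible. -/
def shiftIso (A : DGAlg k) (i : ℤ) : Q A ⋙ shift A i ≅ shiftFun A i ⋙ Q A :=
  Localization.fac _ _ _

/-- The cohomology functor `H^q` on the derived category. -/
def cohomology (A : DGAlg k) (q : ℤ) : DerivedCat A ⥤ AddCommGrpCat.{u} :=
  Localization.lift (DGMod.cohomology A q) (fun _ _ φ (hφ : quasiIso A φ) => hφ q) (Q A)

/-- The exact triangles `L ⟶ M ⟶ N ⟶ Σ L` of the derived category: those isomorphic to the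
triangle `X ⟶ Y ⟶ Cone φ ⟶ Σ X` of some DG morphism `φ : X ⟶ Y`. -/
def IsExactTriangle {L M N : DerivedCat A} (f : L ⟶ M) (g : M ⟶ N)
    (h : N ⟶ (shift A 1).obj L) : Prop :=
  ∃ (X Y : DGMod A) (φ : X ⟶ Y) (a : L ≅ (Q A).obj X) (b : M ≅ (Q A).obj Y)
    (c : N ≅ (Q A).obj (cone φ)),
    f ≫ b.hom = a.hom ≫ (Q A).map φ ∧
    g ≫ c.hom = b.hom ≫ (Q A).map (coneInl φ) ∧
    h ≫ (shift A 1).map a.hom ≫ (shiftIso A 1).hom.app X = c.hom ≫ (Q A).map (coneSnd φ)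

/-! ### Ghosts -/

/-- Ghost morphisms: those that vanish on cohomology. -/
def IsGhost {M N : DerivedCat A} (f : M ⟶ N) : Prop :=
  ∀ q : ℤ, (cohomology A q).map f = 0

/-- The composites of `n` ghosts. For `n = 0` these are the identities. -/
inductive IsGhostComposite : ℕ → ∀ {M N : DerivedCat A}, (M ⟶ N) → Prop
  | id (M : DerivedCat A) : IsGhostComposite 0 (𝟙 M)
  | comp {n : ℕ} {M N P : DerivedCat A} (f : M ⟶ N) (g : N ⟶ P) :
      IsGhostComposite n f → IsGhost g → IsGhostComposite (n + 1) (f ≫ g)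

/-- Every composite of `n + 1` ghosts from `M` is zero, and some composite of `n` ghosts from `M`
is not. -/
def HasGhostLength (M : DerivedCat A) (n : ℕ) : Prop :=
  (∀ (N : DerivedCat A) (f : M ⟶ N), IsGhostComposite (n + 1) f → f = 0) ∧
    ∃ (N : DerivedCat A) (f : M ⟶ N), IsGhostComposite n f ∧ f ≠ 0

open Classical in
/-- The ghost length: `-1` for a zero object, otherwise the `n` with `HasGhostLength M n`, and
`∞` if there is no such `n`. -/
def ghostLength (M : DerivedCat A) : EReal :=
  if IsZero M then -1 else ⨅ (n : ℕ) (_ : HasGhostLength M n), (n : EReal)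

/-! ### Compact objects, levels and dimensions -/

/-- Compact objects: `Hom(M, -)`, as a functor to abelian groups, preserves all coproducts. -/
def compact (A : DGAlg k) : ObjectProperty (DerivedCat A) := fun M =>
  ∀ J : Type u, PreservesColimitsOfShape (Discrete J) (preadditiveCoyoneda.obj (Opposite.op M))

/-- The closure of a class of objects under isomorphisms and direct summands. -/
inductive smd (S : ObjectProperty (DerivedCat A)) : ObjectProperty (DerivedCat A)
  | of (M : DerivedCat A) : S M → smd S M
  | iso (M N : DerivedCat A) : (M ≅ N) → smd S M → smd S N
  | summand (M N : DerivedCat A) (b : BinaryBicone M N) : b.IsBilimit → smd S b.pt → smd S M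

/-- The closure of a class of objects under isomorphisms, finite direct sums and all
suspensions. -/
inductive addCl (S : ObjectProperty (DerivedCat A)) : ObjectProperty (DerivedCat A)
  | of (M : DerivedCat A) : S M → addCl S M
  | iso (M N : DerivedCat A) : (M ≅ N) → addCl S M → addCl S N
  | zero (M : DerivedCat A) : IsZero M → addCl S M
  | sum (M N : DerivedCat A) (b : BinaryBicone M N) :
      b.IsBilimit → addCl S M → addCl S N → addCl S b.pt
  | shift (M : DerivedCat A) (i : ℤ) : addCl S M → addCl S ((DerivedCat.shift A i).obj M)

/-- `S ⋆ T`: the `M` in an exact triangle `L ⟶ M ⟶ N ⟶ Σ L` with `L` in `S` and `N` in `T`. -/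
def star (S T : ObjectProperty (DerivedCat A)) : ObjectProperty (DerivedCat A) := fun M =>
  ∃ (L N : DerivedCat A) (f : L ⟶ M) (g : M ⟶ N) (h : N ⟶ (shift A 1).obj L),
    S L ∧ T N ∧ IsExactTriangle f g h

/-- `⟨S⟩_n`: the zero objects for `n = 0`, then `⟨S⟩_1 = smd (addCl S)` and
`⟨S⟩_n = smd (⟨S⟩_{n-1} ⋆ ⟨S⟩_1)`. -/
def thick (S : ObjectProperty (DerivedCat A)) : ℕ → ObjectProperty (DerivedCat A)
  | 0 => fun M => IsZero M
  | 1 => smd (addCl S)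
  | n + 2 => smd (star (thick S (n + 1)) (smd (addCl S)))

/-- `⟨A⟩_n`. -/
def thickSelf (A : DGAlg k) (n : ℕ) : ObjectProperty (DerivedCat A) :=
  thick (fun M => M = (Q A).obj (DGMod.self A)) n

/-- The `A`-level of `M`: the least `n` with `M` in `⟨A⟩_n`, and `∞` if there is none. -/
def level (M : DerivedCat A) : ℕ∞ := ⨅ (n : ℕ) (_ : thickSelf A n M), (n : ℕ∞)

end DerivedCat

namespace DGAlg

/-- The left ghost dimension: the supremum of the ghost lengths of the compact objects. -/
def leftGhostDim (A : DGAlg k) : EReal :=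
  ⨆ (M : DerivedCat A) (_ : DerivedCat.compact A M), DerivedCat.ghostLength M

/-- The Rouquier dimension: the least `n` such that `⟨A⟩_n` is the class of all compact objects,
and `∞` if there is none. -/
def rouquierDim (A : DGAlg k) : ℕ∞ :=
  ⨅ (n : ℕ) (_ : DerivedCat.thickSelf A n = DerivedCat.compact A), (n : ℕ∞)

end DGAlg

end

/-! The heart of the matter is an equivalence for compact `M`: `M` lies in `⟨A⟩_n` if and only if
every composite of `n` ghosts out of `M` vanishes (`thickSelf_iff_killsGhosts`). Since the classes
`⟨A⟩_n` increase with `n` and consist of compact objects, both equalities then follow by arithmetic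
in the extended numbers.

One direction is the ghost lemma (`killsGhosts_of_thickSelf`). A morphism out of `Σ^i A` is a
cohomology class of its target, so a ghost vanishes on `⟨A⟩_1`. In a triangle `L → M → N`, a
composite of `n` ghosts out of `M` vanishes on `L`, hence factors through `N`, and one more ghost
kills it.

For the converse, start from `0 → M` and repeatedly attach free cells for all cocycles of the cone
of `p_n : F_n → M`. The induced map of cones is a ghost, so `M → Cone p_n` is a composite of `n`
ghosts (`exists_semifree`). If it vanishes, the identity of `M` factors through `F_n`, which has `n`
layers of possibly infinitely many cells. Compactness of `M` makes the map `M → F_n` factor through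
an object of `⟨A⟩_n`, layer by layer (`exists_factor_of_isSemifree`), so `M` is a retract of that
object.

These arguments need some triangulated structure on `D(A)`, which is given as a bare localization.
The Ore conditions hold up to homotopy, so morphisms are fractions over the homotopy category.
Contractions then correspond to maps into and out of cones, which gives weak kernels and cokernels,
fibres, homotopy pushouts and complements of split monomorphisms. Direct sums of DG modules give the
coproducts, and compactness becomes the elementary condition `IsSmall`. -/

noncomputable section

variable {k : Type u} [Field k]

namespace DGMod

variable {A : DGAlg k}

/-! ### Cocycles and coboundaries -/

lemma mem_coboundaries {M : DGMod A} {q : ℤ} {x : M.X q} :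
    x ∈ M.coboundaries q ↔ ∃ (p : ℤ) (h : p + 1 = q) (y : M.X p), M.d h y = x := by
  constructor
  · rintro ⟨y, hy⟩
    exact ⟨_, _, y, hy⟩
  · rintro ⟨p, h, y, hy⟩
    obtain rfl : p = q - 1 := by lia
    exact ⟨y, hy⟩

lemma exists_of_mem_coboundaries {M : DGMod A} {p q : ℤ} (h : p + 1 = q) {x : M.X q}
    (hx : x ∈ M.coboundaries q) : ∃ y : M.X p, M.d h y = x := by
  obtain ⟨p', h', y, rfl⟩ := mem_coboundaries.1 hx
  obtain rfl : p = p' := by lia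
  exact ⟨y, rfl⟩

lemma HMap_eq_zero_iff {M N : DGMod A} (φ : M ⟶ N) (q : ℤ) :
    (cohomology A q).map φ = 0 ↔
      ∀ x : M.X q, M.d rfl x = 0 → Hom.f φ q x ∈ N.coboundaries q := by
  constructor
  · intro h x hx
    have := congrArg (fun f => f.hom (QuotientAddGroup.mk ⟨x, hx⟩)) h
    exact (QuotientAddGroup.eq_zero_iff (cocyclesMap φ q ⟨x, hx⟩)).1 this
  · intro h
    ext x
    obtain ⟨x, rfl⟩ := QuotientAddGroup.mk_surjective x
    exact (QuotientAddGroup.eq_zero_iff (cocyclesMap φ q x)).2 (h x.1 x.2)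

/-- A DG module without cohomology. -/
def Acyclic (M : DGMod A) : Prop :=
  ∀ (q : ℤ) (x : M.X q), M.d rfl x = 0 → x ∈ M.coboundaries q

lemma quasiIso_iff {M N : DGMod A} (φ : M ⟶ N) : quasiIso A φ ↔ ∀ q : ℤ,
    (∀ x : M.X q, M.d rfl x = 0 → Hom.f φ q x ∈ N.coboundaries q → x ∈ M.coboundaries q) ∧
      (∀ y : N.X q, N.d rfl y = 0 → ∃ x : M.X q, M.d rfl x = 0 ∧
        Hom.f φ q x - y ∈ N.coboundaries q) :=
  forall_congr' fun q => isIso_cohomology_map_iff φ q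

lemma quasiIso.mem_coboundaries {M N : DGMod A} {φ : M ⟶ N} (hφ : quasiIso A φ) {q : ℤ}
    {x : M.X q} (hx : M.d rfl x = 0) (h : Hom.f φ q x ∈ N.coboundaries q) :
    x ∈ M.coboundaries q :=
  ((quasiIso_iff φ).1 hφ q).1 x hx h

lemma quasiIso.exists_cocycle {M N : DGMod A} {φ : M ⟶ N} (hφ : quasiIso A φ) {q : ℤ}
    {y : N.X q} (hy : N.d rfl y = 0) : ∃ x : M.X q, M.d rfl x = 0 ∧
      Hom.f φ q x - y ∈ N.coboundaries q :=
  ((quasiIso_iff φ).1 hφ q).2 y hy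

instance : (quasiIso A).IsMultiplicative where
  comp_mem f g hf hg q := by
    have := hf q
    have := hg q
    rw [Functor.map_comp]
    infer_instance

/-! ### Null homotopies -/

/-- A null homotopy of a DG morphism: a contraction of degree `-1`, linear up to sign. -/
structure NullHomotopy {M N : DGMod A} (φ : M ⟶ N) where
  s : ∀ {q q' : ℤ}, q' + 1 = q → (M.X q →+ N.X q')
  comm : ∀ {q q' q'' : ℤ} (h : q' + 1 = q) (h' : q + 1 = q'') (x : M.X q),
    Hom.f φ q x = N.d h (s h x) + s h' (M.d h' x)
  map_smul : ∀ {p q q' n n' : ℤ} (hq : q' + 1 = q) (hn : n' + 1 = n) (h : p + q = n)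
    (h' : p + q' = n') (a : A.gr p) (x : M.X q),
    s hn (M.smul h a x) = p.negOnePow • N.smul h' a (s hq x)

namespace NullHomotopy

variable {M N P : DGMod A}

/-- The null homotopy of the zero morphism. -/
def zero (M N : DGMod A) : NullHomotopy (0 : M ⟶ N) where
  s _ := 0
  comm _ _ _ := by simp
  map_smul _ _ _ _ _ _ := by simp

/-- The sum of null homotopies. -/
def add {φ ψ : M ⟶ N} (s : NullHomotopy φ) (t : NullHomotopy ψ) : NullHomotopy (φ + ψ) where
  s h := s.s h + t.s h
  comm h h' x := by simp [s.comm h h', t.comm h h']; abel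
  map_smul hq hn h e a x := by simp [s.map_smul hq hn h e, t.map_smul hq hn h e]

/-- The negative of a null homotopy. -/
def neg {φ : M ⟶ N} (s : NullHomotopy φ) : NullHomotopy (-φ) where
  s h := -s.s h
  comm h h' x := by simp [s.comm h h']; abel
  map_smul hq hn h e a x := by simp [s.map_smul hq hn h e]

/-- Postcomposition of a null homotopy. -/
def compRight {φ : M ⟶ N} (s : NullHomotopy φ) (g : N ⟶ P) : NullHomotopy (φ ≫ g) where
  s {q q'} h := (Hom.f g q').comp (s.s h)
  comm h h' x := by simp [s.comm h h', Hom.comm g]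
  map_smul hq hn h h' a x := by
    simp [s.map_smul hq hn h h', Hom.map_smul g]

/-- Precomposition of a null homotopy. -/
def compLeft {φ : N ⟶ P} (s : NullHomotopy φ) (g : M ⟶ N) : NullHomotopy (g ≫ φ) where
  s {q q'} h := (s.s h).comp (Hom.f g q)
  comm h h' x := by simp [s.comm h h', Hom.comm g]
  map_smul hq hn h h' a x := by simp [s.map_smul hq hn h h', Hom.map_smul g]

/-- Transport of a null homotopy along an equality. -/
def ofEq {φ ψ : M ⟶ N} (s : NullHomotopy φ) (h : φ = ψ) : NullHomotopy ψ := h ▸ s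

end NullHomotopy

/-! ### Cones -/

section cone

variable {X Y Z : DGMod A}

lemma cone_d (φ : X ⟶ Y) {q q' : ℤ} (h : q + 1 = q') (z : (cone φ).X q) :
    (cone φ).d h z = (Y.d h z.1 + Hom.f φ q' (X.cast h z.2),
      -X.d (show (q + 1) + 1 = q' + 1 by lia) z.2) := rfl

/-- The morphism out of a cone given by a morphism and a null homotopy. -/
def coneDesc (φ : X ⟶ Y) (g : Y ⟶ Z) (s : NullHomotopy (φ ≫ g)) : cone φ ⟶ Z where
  f q := (Hom.f g q).coprod (s.s rfl)
  comm {q q'} h z := by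
    subst h
    have := s.comm (rfl : q + 1 = q + 1) rfl z.2
    rw [comp_f] at this
    change Hom.f g _ (Y.d rfl z.1 + Hom.f φ _ z.2) + s.s rfl (-X.d rfl z.2) =
      Z.d rfl (Hom.f g _ z.1 + s.s rfl z.2)
    simp [Hom.comm g, this]
    abel
  map_smul {p q n} h a z := by
    change Hom.f g _ (Y.smul h a z.1) + s.s rfl (p.negOnePow • X.smul _ a z.2) =
      Z.smul h a (Hom.f g _ z.1 + s.s rfl z.2)
    simp [Hom.map_smul g, s.map_smul rfl rfl _ h, smul_smul]

@[simp] lemma coneDesc_f (φ : X ⟶ Y) (g : Y ⟶ Z) (s : NullHomotopy (φ ≫ g)) (q : ℤ)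
    (z : (cone φ).X q) :
    Hom.f (coneDesc φ g s) q z = Hom.f g q z.1 + s.s (rfl : q + 1 = q + 1) z.2 := rfl

lemma coneInl_coneDesc (φ : X ⟶ Y) (g : Y ⟶ Z) (s : NullHomotopy (φ ≫ g)) :
    coneInl φ ≫ coneDesc φ g s = g := by
  ext q x
  change Hom.f g q x + s.s rfl 0 = Hom.f g q x
  simp

/-- The composite of a morphism with the inclusion into its cone is null homotopic. -/
def nullHomotopyConeInl (φ : X ⟶ Y) : NullHomotopy (φ ≫ coneInl φ) where
  s {q q'} h := (AddMonoidHom.inr (Y.X q') (X.X (q' + 1))).comp (X.cast h.symm)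
  comm {q q' q''} h h' x := by
    subst h h'
    refine Prod.ext ?_ ?_
    · change Hom.f φ _ x = Y.d rfl 0 + Hom.f φ _ x + 0
      simp
    · change (0 : X.X _) = -X.d rfl x + X.d rfl x
      simp
  map_smul {p q q' n n'} hq hn h h' a x := by
    subst hq hn
    refine Prod.ext ?_ ?_
    · change (0 : Y.X _) = p.negOnePow • Y.smul h' a 0
      simp
    · change X.smul h a x = p.negOnePow • p.negOnePow • X.smul h a x
      simp [smul_smul]

/-- The composite of the projection `Cone φ ⟶ Σ X` with `Σ φ` is null homotopic. -/
def nullHomotopyConeSnd (φ : X ⟶ Y) : NullHomotopy (coneSnd φ ≫ (shiftFun A 1).map φ) where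
  s {q q'} h := (Y.cast h.symm).comp (AddMonoidHom.fst (Y.X q) (X.X (q + 1)))
  comm {q q' q''} h h' x := by
    subst h h'
    change Hom.f φ _ x.2 = (1 : ℤ).negOnePow • Y.d _ x.1 +
      (Y.d _ x.1 + Hom.f φ _ (X.cast _ x.2))
    simp
  map_smul {p q q' n n'} hq hn h h' a x := by
    subst hq hn
    change Y.smul h a x.1 = p.negOnePow • (p * 1).negOnePow • Y.smul _ a x.1
    simp [smul_smul]

/-- The morphism of cones induced by a commutative square. -/
def coneMap {X' Y' : DGMod A} (φ : X ⟶ Y) (φ' : X' ⟶ Y') (a : X ⟶ X') (b : Y ⟶ Y')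
    (w : φ ≫ b = a ≫ φ') : cone φ ⟶ cone φ' where
  f q := (Hom.f b q).prodMap (Hom.f a (q + 1))
  comm {q q'} h z := by
    subst h
    have := congrArg (fun f => Hom.f f _ z.2) w
    simp only [comp_f] at this
    refine Prod.ext ?_ ?_
    · change Hom.f b _ (Y.d rfl z.1 + Hom.f φ _ z.2) = Y'.d rfl (Hom.f b _ z.1) +
        Hom.f φ' _ (Hom.f a _ z.2)
      rw [map_add, Hom.comm b, this]
    · change Hom.f a _ (-X.d rfl z.2) = -X'.d rfl (Hom.f a _ z.2)
      rw [map_neg, Hom.comm a]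
  map_smul {p q n} h c z := by
    refine Prod.ext (Hom.map_smul b h c z.1) ?_
    exact (map_units_smul _ _ _).trans (congrArg _ (Hom.map_smul a _ c z.2))

lemma coneInl_coneMap {X' Y' : DGMod A} (φ : X ⟶ Y) (φ' : X' ⟶ Y') (a : X ⟶ X') (b : Y ⟶ Y')
    (w : φ ≫ b = a ≫ φ') : coneInl φ ≫ coneMap φ φ' a b w = b ≫ coneInl φ' := by
  ext q x
  exact Prod.ext rfl (map_zero (Hom.f a (q + 1)))

lemma cone_d_eq_zero {φ : X ⟶ Y} {q : ℤ} {z : (cone φ).X q} :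
    (cone φ).d rfl z = 0 ↔ Y.d rfl z.1 + Hom.f φ (q + 1) z.2 = 0 ∧ X.d rfl z.2 = 0 := by
  rw [cone_d]
  exact Prod.ext_iff.trans (and_congr Iff.rfl neg_eq_zero)

lemma cone_mem_coboundaries {φ : X ⟶ Y} {q : ℤ} {z : (cone φ).X (q + 1)} :
    z ∈ (cone φ).coboundaries (q + 1) ↔ ∃ (y : Y.X q) (x : X.X (q + 1)),
      Y.d rfl y + Hom.f φ (q + 1) x = z.1 ∧ -X.d rfl x = z.2 := by
  constructor
  · intro h
    obtain ⟨w, hw⟩ := exists_of_mem_coboundaries (rfl : q + 1 = q + 1) h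
    rw [cone_d] at hw
    exact ⟨w.1, w.2, congrArg Prod.fst hw, congrArg Prod.snd hw⟩
  · rintro ⟨y, x, h₁, h₂⟩
    exact mem_coboundaries.2 ⟨q, rfl, (y, x), Prod.ext h₁ h₂⟩

/-- For a cocycle `(y, x)` of the cone, `φ x` is a coboundary, so injectivity of `H(φ)` bounds `x`.
This leaves a cocycle of `Y`, which surjectivity replaces by the image of a cocycle of `X` up to a
coboundary. -/
lemma acyclic_cone {φ : X ⟶ Y} (hφ : quasiIso A φ) : (cone φ).Acyclic := by
  intro q z hz
  obtain ⟨q, rfl⟩ : ∃ p, q = p + 1 := ⟨q - 1, by lia⟩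
  obtain ⟨h₁, h₂⟩ := cone_d_eq_zero.1 hz
  obtain ⟨x, hx⟩ := exists_of_mem_coboundaries rfl (hφ.mem_coboundaries h₂
    (mem_coboundaries.2 ⟨_, rfl, -z.1, by rw [map_neg]; exact neg_eq_of_add_eq_zero_right h₁⟩))
  have h₃ : Y.d rfl (z.1 + Hom.f φ _ x) = 0 := by
    rw [map_add, ← Hom.comm, hx]; exact h₁
  obtain ⟨x', hx', hb⟩ := hφ.exists_cocycle h₃
  obtain ⟨y, hy⟩ := exists_of_mem_coboundaries rfl hb
  refine cone_mem_coboundaries.2 ⟨-y, x' - x, ?_, ?_⟩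
  · rw [map_neg, hy, map_sub]; abel
  · rw [map_sub, hx', hx]; abel

/-- In the long exact sequence of the cone, `H(Y)` and `H(Cone φ)` differ only by `H(X)`. The chase
removes the `X`-component of a cocycle by bounding it. -/
lemma quasiIso_coneInl {φ : X ⟶ Y} (hX : X.Acyclic) : quasiIso A (coneInl φ) := by
  refine (quasiIso_iff _).2 fun q => ?_
  obtain ⟨q, rfl⟩ : ∃ p, q = p + 1 := ⟨q - 1, by lia⟩
  refine ⟨fun y hy h => ?_, fun z hz => ?_⟩
  · obtain ⟨y', x, h₁, h₂⟩ := cone_mem_coboundaries.1 h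
    obtain ⟨x', rfl⟩ := exists_of_mem_coboundaries rfl (hX _ x (neg_eq_zero.1 h₂))
    refine mem_coboundaries.2 ⟨_, rfl, y' + Hom.f φ _ x', ?_⟩
    rw [map_add, ← Hom.comm]
    exact h₁
  · obtain ⟨h₁, h₂⟩ := cone_d_eq_zero.1 hz
    obtain ⟨x, hx⟩ := exists_of_mem_coboundaries rfl (hX _ z.2 h₂)
    refine ⟨z.1 + Hom.f φ _ x, ?_, cone_mem_coboundaries.2 ⟨0, x, ?_, ?_⟩⟩
    · rw [map_add, ← Hom.comm, hx]; exact h₁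
    · change Y.d rfl 0 + Hom.f φ _ x = z.1 + Hom.f φ _ x - z.1
      simp
    · change -X.d rfl x = 0 - z.2
      simp [hx]

end cone

end DGMod

namespace DGMod

variable {A : DGAlg k}

/-! ### Isomorphisms between suspensions -/

/-- Transport of degrees, as an equivalence. -/
def castEquiv (M : DGMod A) {q q' : ℤ} (h : q = q') : M.X q ≃+ M.X q' where
  toFun := M.cast h
  invFun := M.cast h.symm
  left_inv x := by subst h; rfl
  right_inv x := by subst h; rfl
  map_add' := map_add _

/-- A DG isomorphism from degreewise isomorphisms. -/
def isoMk {M N : DGMod A} (e : ∀ q, M.X q ≃+ N.X q)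
    (comm : ∀ {q q' : ℤ} (h : q + 1 = q') (x : M.X q), e q' (M.d h x) = N.d h (e q x))
    (map_smul : ∀ {p q n : ℤ} (h : p + q = n) (a : A.gr p) (x : M.X q),
      e n (M.smul h a x) = N.smul h a (e q x)) : M ≅ N where
  hom := ⟨fun q => (e q : M.X q →+ N.X q), comm, map_smul⟩
  inv := ⟨fun q => ((e q).symm : N.X q →+ M.X q),
    fun {q q'} h x => (e q').injective (by simp [comm]),
    fun {p q n} h a x => (e n).injective (by simp [map_smul])⟩
  hom_inv_id := by ext q x; exact (e q).symm_apply_apply x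
  inv_hom_id := by ext q x; exact (e q).apply_symm_apply x

/-- `Σ^j Σ^i M` is `Σ^(i+j) M`. -/
def shiftShiftIso (M : DGMod A) (i j s : ℤ) (h : j + i = s) :
    (M.shift i).shift j ≅ M.shift s :=
  isoMk (fun q => M.castEquiv (show q + j + i = q + s by lia))
    (fun {q q'} e (x : M.X (q + j + i)) => by
      subst h
      change M.cast _ (j.negOnePow • i.negOnePow • M.d _ x) =
        (j + i).negOnePow • M.d _ (M.cast _ x)
      rw [map_units_smul, map_units_smul, cast_d, d_cast, smul_smul, Int.negOnePow_add])
    (fun {p q n} e a (x : M.X (q + j + i)) => by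
      subst h
      change M.cast _ ((p * j).negOnePow • (p * i).negOnePow • M.smul _ a x) =
        (p * (j + i)).negOnePow • M.smul _ a (M.cast _ x)
      rw [map_units_smul, map_units_smul, cast_smul, smul_cast, smul_smul, mul_add,
        Int.negOnePow_add])

/-- `Σ^0 M` is `M`. -/
def shiftZeroIso (M : DGMod A) : M.shift 0 ≅ M :=
  isoMk (fun q => M.castEquiv (add_zero q))
    (fun {q q'} e (x : M.X (q + 0)) => by
      change M.cast _ ((0 : ℤ).negOnePow • M.d _ x) = M.d _ (M.cast _ x)
      rw [map_units_smul, cast_d, d_cast, Int.negOnePow_zero, _root_.one_smul])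
    (fun {p q n} e a (x : M.X (q + 0)) => by
      change M.cast _ ((p * 0).negOnePow • M.smul _ a x) = M.smul _ a (M.cast _ x)
      rw [map_units_smul, cast_smul, smul_cast, mul_zero, Int.negOnePow_zero, _root_.one_smul])

/-- `Σ Σ⁻¹ M` is `M`. -/
def unshiftIso (M : DGMod A) :
    (shiftFun A 1).obj ((shiftFun A (-1)).obj M) ≅ M :=
  shiftShiftIso M (-1) 1 0 (by lia) ≪≫ shiftZeroIso M

lemma unshiftIso_hom_f (M : DGMod A) (q : ℤ) (x : M.X (q + 1 + -1)) :
    Hom.f (unshiftIso M).hom q x = M.cast (by lia) x := by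
  change M.cast _ (M.cast _ x) = _
  generalize_proofs h₁ h₂ h₃
  revert h₁ h₂ h₃
  generalize q + 0 = t
  rintro rfl h₂ h₃
  rfl

lemma unshiftIso_naturality {M N : DGMod A} (φ : M ⟶ N) :
    (shiftFun A 1).map ((shiftFun A (-1)).map φ) ≫ (unshiftIso N).hom =
      (unshiftIso M).hom ≫ φ := by
  ext q x
  refine (unshiftIso_hom_f N q _).trans ?_
  refine Eq.trans ?_ (congrArg (Hom.f φ q) (unshiftIso_hom_f M q x)).symm
  exact (Hom.f_cast φ _ _).symm

lemma shift_d_one (Y : DGMod A) {q q' : ℤ} (h : q + 1 = q') (x : Y.X (q + 1)) :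
    (Y.shift 1).d h x = -Y.d (show (q + 1) + 1 = q' + 1 by lia) x := by
  rw [shift_d, Int.negOnePow_one, Units.neg_smul, _root_.one_smul]

/-! ### Lifting and extending along homotopies -/

section lifting

variable {X Y Z : DGMod A}

/-- A null homotopy into `Σ Y`, as a family of maps of degree `0` into `Y`. -/
def NullHomotopy.unshift {φ : Z ⟶ (shiftFun A 1).obj Y} (s : NullHomotopy φ) (q : ℤ) :
    Z.X q →+ Y.X q :=
  (Y.cast (show q - 1 + 1 = q by lia)).comp (s.s (show q - 1 + 1 = q by lia))

lemma NullHomotopy.unshift_apply {φ : Z ⟶ (shiftFun A 1).obj Y} (s : NullHomotopy φ)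
    {q : ℤ} (z : Z.X (q + 1)) : s.unshift (q + 1) z = s.s (rfl : q + 1 = q + 1) z := by
  -- The degree `q + 1 - 1` equals `q` only propositionally; quantifying over it lets the cast be
  -- eliminated.
  have : ∀ (t : ℤ) (h : t + 1 = q + 1), Y.cast h (s.s h z) = s.s (rfl : q + 1 = q + 1) z := by
    intro t h
    obtain rfl : t = q := by lia
    rfl
  exact this _ _

/-- The sign `(-1)^p` of a map of degree `-1` cancels the sign in the action on `Σ Y`. -/
lemma NullHomotopy.unshift_smul {φ : Z ⟶ (shiftFun A 1).obj Y} (s : NullHomotopy φ) {p q n : ℤ}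
    (h : p + q = n) (a : A.gr p) (z : Z.X q) :
    s.unshift n (Z.smul h a z) = Y.smul h a (s.unshift q z) := by
  obtain ⟨q, rfl⟩ : ∃ r, q = r + 1 := ⟨q - 1, by lia⟩
  obtain ⟨n, rfl⟩ : ∃ r, n = r + 1 := ⟨n - 1, by lia⟩
  rw [unshift_apply, unshift_apply, s.map_smul rfl rfl h (show p + q = n by lia)]
  change p.negOnePow • (p * 1).negOnePow • Y.smul _ a _ = _
  simp [smul_smul]

lemma NullHomotopy.unshift_comm {φ : Z ⟶ (shiftFun A 1).obj Y} (s : NullHomotopy φ) {q : ℤ}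
    (z : Z.X q) : Hom.f φ q z =
      s.unshift (q + 1) (Z.d rfl z) - Y.d rfl (s.unshift q z) := by
  obtain ⟨q, rfl⟩ : ∃ r, q = r + 1 := ⟨q - 1, by lia⟩
  rw [unshift_apply, unshift_apply, s.comm rfl rfl]
  change (1 : ℤ).negOnePow • Y.d _ _ + _ = _
  rw [Int.negOnePow_one, Units.neg_smul, _root_.one_smul]
  exact neg_add_eq_sub _ _

/-- The morphism into a cone given by a morphism to `Σ X` and a null homotopy. -/
def coneLift (φ : X ⟶ Y) (g : Z ⟶ (shiftFun A 1).obj X)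
    (s : NullHomotopy (g ≫ (shiftFun A 1).map φ)) : Z ⟶ cone φ where
  f q := (s.unshift q).prod (Hom.f g q)
  comm {q q'} h z := by
    subst h
    refine Prod.ext ?_ ?_
    · have := s.unshift_comm z
      change s.unshift _ (Z.d rfl z) = Y.d rfl (s.unshift q z) + Hom.f φ _ (Hom.f g q z)
      rw [show Hom.f φ (q + 1) (Hom.f g q z) = _ from this]
      abel
    · refine (Hom.comm g rfl z).trans ?_
      change (1 : ℤ).negOnePow • X.d _ (Hom.f g q z) = -X.d _ (Hom.f g q z)
      simp
  map_smul {p q n} h a z := by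
    refine Prod.ext (s.unshift_smul h a z) ((Hom.map_smul g h a z).trans ?_)
    change (p * 1).negOnePow • X.smul _ a (Hom.f g q z) = p.negOnePow • X.smul _ a (Hom.f g q z)
    simp

lemma coneLift_coneSnd (φ : X ⟶ Y) (g : Z ⟶ (shiftFun A 1).obj X)
    (s : NullHomotopy (g ≫ (shiftFun A 1).map φ)) : coneLift φ g s ≫ coneSnd φ = g := rfl

/-- A morphism that becomes null homotopic in the cone of `φ` lifts along `φ` up to homotopy. -/
lemma exists_lift_of_nullHomotopy (φ : X ⟶ Y) (w : Z ⟶ Y) (s : NullHomotopy (w ≫ coneInl φ)) :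
    ∃ v : Z ⟶ X, Nonempty (NullHomotopy (w - v ≫ φ)) := by
  -- The `Σ X`-component of the contraction contracts zero, so after unshifting it commutes with the
  -- differentials and is the lift `v`. The `Y`-component is the homotopy between `w` and `v ≫ φ`.
  let t : NullHomotopy (0 : Z ⟶ (shiftFun A 1).obj X) :=
    (s.compRight (coneSnd φ)).ofEq (by ext q x; rfl)
  refine ⟨⟨fun q => t.unshift q, fun {q q'} h z => ?_, fun h a z => t.unshift_smul h a z⟩,
    ⟨⟨fun {q q'} h => (AddMonoidHom.fst (Y.X q') (X.X (q' + 1))).comp (s.s h), ?_, ?_⟩⟩⟩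
  · subst h
    exact sub_eq_zero.1 ((t.unshift_comm z).symm.trans rfl)
  · intro q q' q'' h h' z
    subst h h'
    have h₁ := congrArg Prod.fst (s.comm rfl rfl z)
    have h₂ : t.unshift (q' + 1) z = (s.s (rfl : q' + 1 = q' + 1) z).2 := t.unshift_apply z
    change Hom.f w _ z = Y.d rfl (s.s rfl z).1 + Hom.f φ _ (s.s rfl z).2 +
      (s.s rfl (Z.d rfl z)).1 at h₁
    change Hom.f w _ z + -(Hom.f φ _ (t.unshift _ z)) = Y.d rfl (s.s rfl z).1 +
      (s.s rfl (Z.d rfl z)).1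
    rw [h₁, h₂]
    abel
  · intro p q q' n n' hq hn h e a z
    exact congrArg Prod.fst (s.map_smul hq hn h e a z)

/-- A morphism from `Σ X` that becomes null homotopic on the cone of `φ` extends along `Σ φ`
up to homotopy. -/
lemma exists_extension_of_nullHomotopy (φ : X ⟶ Y) (f : (shiftFun A 1).obj X ⟶ Z)
    (s : NullHomotopy (coneSnd φ ≫ f)) :
    ∃ v : (shiftFun A 1).obj Y ⟶ Z, Nonempty (NullHomotopy (f - (shiftFun A 1).map φ ≫ v)) := by
  -- The contraction splits over the two summands of the cone. At `x = 0` its identity makes the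
  -- restriction to `Y` a DG morphism out of `Σ Y`; at `y = 0` it makes the restriction to `Σ X` the
  -- required homotopy.
  have hs (q : ℤ) (y : Y.X (q + 1)) (x : X.X (q + 1 + 1)) :
      Hom.f f (q + 1) x = Z.d rfl (s.s (rfl : q + 1 = q + 1) (y, x)) +
        s.s rfl (Y.d rfl y + Hom.f φ _ x, -X.d rfl x) := s.comm rfl rfl (y, x)
  have hsm {p q n : ℤ} (h : p + q = n) (a : A.gr p) (y : Y.X (q + 1)) (x : X.X (q + 1 + 1)) :
      s.s (rfl : n + 1 = n + 1) (Y.smul (show p + (q + 1) = n + 1 by lia) a y,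
        p.negOnePow • X.smul (show p + (q + 1 + 1) = n + 1 + 1 by lia) a x) =
      p.negOnePow • Z.smul h a (s.s rfl (y, x)) :=
    s.map_smul rfl rfl (show p + (q + 1) = n + 1 by lia) h a (y, x)
  refine ⟨⟨fun q => (s.s (rfl : q + 1 = q + 1)).comp (AddMonoidHom.inl _ _), ?_, ?_⟩,
    ⟨⟨fun {q q'} h => (s.s h).comp ((AddMonoidHom.inr _ _)), ?_, ?_⟩⟩⟩
  · intro q q' h (y : Y.X (q + 1))
    subst h
    have h₁ := (map_zero (Hom.f f (q + 1))).symm.trans (hs q y 0)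
    rw [map_zero, map_zero, add_zero, neg_zero] at h₁
    refine Eq.trans ?_ (eq_neg_of_add_eq_zero_left h₁.symm).symm
    refine Eq.trans (congrArg (s.s rfl) (Prod.ext ?_ ?_)) (map_neg (s.s rfl) _)
    · exact Y.shift_d_one rfl y
    · exact neg_zero.symm
  · intro p q n h a (y : Y.X (q + 1))
    have h₁ := hsm h a y 0
    rw [map_zero, smul_zero] at h₁
    have h₂ : (((p * 1).negOnePow • Y.smul (show p + (q + 1) = n + 1 by lia) a y, 0) :
        Y.X (n + 1) × X.X (n + 1 + 1)) =
        p.negOnePow • (Y.smul (show p + (q + 1) = n + 1 by lia) a y, 0) := by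
      ext <;> simp
    refine (congrArg (s.s rfl) h₂).trans ((map_units_smul (s.s rfl) _ _).trans ?_)
    refine (congrArg (p.negOnePow • ·) h₁).trans ?_
    refine (smul_smul _ _ _).trans ?_
    simp
    rfl
  · intro q q' q'' h h' (x : X.X (q + 1))
    subst h h'
    have h₁ := hs q' 0 x
    have h₂ : ((Y.d rfl (0 : Y.X (q' + 1)) + Hom.f φ _ x, -X.d rfl x) :
        Y.X (q' + 1 + 1) × X.X (q' + 1 + 1 + 1)) = (Hom.f φ _ x, 0) + (0, -X.d rfl x) := by
      ext <;> simp
    rw [h₂] at h₁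
    have h₃ := h₁.trans (congrArg _ (map_add (s.s rfl) _ _))
    refine (congrArg (· + _) h₃).trans ?_
    have h₄ : s.s (rfl : q' + 1 + 1 = _) (0, (X.shift 1).d rfl x) =
      s.s (rfl : q' + 1 + 1 = _) (0, -X.d rfl x) :=
        congrArg (fun t => s.s (rfl : q' + 1 + 1 = _) (0, t)) (X.shift_d_one rfl x)
    refine Eq.trans ?_ (congrArg _ h₄.symm)
    have (a b c : Z.X (q' + 1)) : a + (b + c) + -b = a + c := by abel
    exact this _ _ _
  · intro p q q' n n' hq hn h h' a (x : X.X (q + 1))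
    subst hq hn
    have h₁ := hsm h' a 0 x
    rw [map_zero] at h₁
    refine Eq.trans (b := s.s rfl (0, p.negOnePow • X.smul _ a x))
      (congrArg (s.s rfl) (Prod.ext rfl ?_)) h₁
    exact congrArg (fun t : ℤ => t.negOnePow • X.smul _ a x) (mul_one p)

end lifting

/-! ### Quasi-isomorphisms between cones -/

/-- Dual to `quasiIso_coneInl`: when `H(Y) = 0`, only `Σ X` contributes to the cohomology of the
cone. -/
lemma quasiIso_coneSnd {X Y : DGMod A} {φ : X ⟶ Y} (hY : Y.Acyclic) :
    quasiIso A (coneSnd φ) := by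
  refine (quasiIso_iff _).2 fun q => ?_
  obtain ⟨q, rfl⟩ : ∃ p, q = p + 1 := ⟨q - 1, by lia⟩
  refine ⟨fun z hz h => ?_, fun (x : X.X (q + 1 + 1)) hx => ?_⟩
  · obtain ⟨h₁, h₂⟩ := cone_d_eq_zero.1 hz
    obtain ⟨x, hx'⟩ : ∃ x : X.X (q + 1), -X.d rfl x = z.2 := by
      obtain ⟨x, hx⟩ := exists_of_mem_coboundaries (rfl : q + 1 = q + 1) h
      exact ⟨x, (X.shift_d_one rfl x).symm.trans hx⟩
    have : Y.d rfl (z.1 - Hom.f φ _ x) = 0 := by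
      rw [map_sub, ← Hom.comm, sub_eq_add_neg, ← map_neg, hx']; exact h₁
    obtain ⟨y, hy⟩ := exists_of_mem_coboundaries (rfl : q + 1 = q + 1) (hY _ _ this)
    exact cone_mem_coboundaries.2 ⟨y, x, by rw [hy]; abel, hx'⟩
  · have hx' : X.d rfl x = 0 := neg_eq_zero.1 ((X.shift_d_one rfl x).symm.trans hx)
    have : Y.d rfl (Hom.f φ _ x) = 0 := by rw [← Hom.comm, hx', map_zero]
    obtain ⟨y, hy⟩ := exists_of_mem_coboundaries (rfl : q + 1 + 1 = q + 1 + 1) (hY _ _ this)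
    refine ⟨(-y, x), cone_d_eq_zero.2 ⟨?_, hx'⟩, ?_⟩
    · change Y.d rfl (-y) + Hom.f φ _ x = 0
      rw [map_neg, hy]; abel
    · change x - x ∈ _
      rw [sub_self]
      exact zero_mem _

/-- The comparison of the cone of the projection `Cone φ ⟶ Σ X` with `Σ Y`. -/
lemma quasiIso_coneDesc_coneSnd {X Y : DGMod A} (φ : X ⟶ Y) :
    quasiIso A (coneDesc (coneSnd φ) ((shiftFun A 1).map φ) (nullHomotopyConeSnd φ)) := by
  refine (quasiIso_iff _).2 fun q => ?_
  obtain ⟨q, rfl⟩ : ∃ p, q = p + 1 := ⟨q - 1, by lia⟩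
  refine ⟨fun z hz h => ?_, fun (y : Y.X (q + 1 + 1)) hy => ?_⟩
  · obtain ⟨h₁, h₂⟩ := cone_d_eq_zero.1 hz
    obtain ⟨x, y, x', rfl⟩ : ∃ (x : X.X (q + 1 + 1)) (y : Y.X (q + 1 + 1))
      (x' : X.X (q + 1 + 1 + 1)), z = (x, ((y, x') : Y.X _ × X.X _)) := ⟨z.1, z.2.1, z.2.2, rfl⟩
    obtain ⟨v, hv'⟩ : ∃ v : Y.X (q + 1), -Y.d rfl v = Hom.f φ _ x + y := by
      obtain ⟨v, hv⟩ := exists_of_mem_coboundaries (rfl : q + 1 = q + 1) h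
      exact ⟨v, (Y.shift_d_one rfl v).symm.trans hv⟩
    have h₅ : -X.d rfl x + x' = 0 :=
      (congrArg (· + x') (X.shift_d_one rfl x).symm).trans h₁
    refine cone_mem_coboundaries.2 ⟨(0 : X.X (q + 1)), ((v, x) : Y.X (q + 1) × X.X (q + 1 + 1)),
      ?_, Prod.ext ?_ ?_⟩
    · refine (congrArg (· + x) (map_zero ((X.shift 1).d (rfl : q + 1 = q + 1)))).trans ?_
      exact zero_add x
    · change -(Y.d rfl v + Hom.f φ _ x) = y
      rw [neg_add, hv']
      exact add_neg_cancel_comm _ _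
    · change - -X.d rfl x = x'
      rw [neg_neg]
      exact neg_add_eq_zero.1 h₅
  · have hy' : Y.d rfl y = 0 := neg_eq_zero.1 ((Y.shift_d_one rfl y).symm.trans hy)
    refine ⟨((0 : X.X _), ((y, 0) : Y.X _ × X.X _)), cone_d_eq_zero.2
      ⟨?_, cone_d_eq_zero.2 ⟨?_, ?_⟩⟩, ?_⟩
    · exact (add_zero _).trans (map_zero ((X.shift 1).d rfl))
    · change Y.d rfl y + Hom.f φ _ 0 = 0
      simp [hy']
    · exact map_zero _
    · change Hom.f φ _ 0 + y - y ∈ _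
      rw [map_zero, zero_add, sub_self]
      exact zero_mem _

/-- Degreewise short exact sequences of DG modules. -/
structure ShortExact {L M N : DGMod A} (i : L ⟶ M) (p : M ⟶ N) : Prop where
  injective : ∀ q, Function.Injective (Hom.f i q)
  surjective : ∀ q, Function.Surjective (Hom.f p q)
  comp_eq_zero : i ≫ p = 0
  exact : ∀ (q : ℤ) (x : M.X q), Hom.f p q x = 0 → ∃ y, Hom.f i q y = x

/-- The cone of an injection computes its cokernel: elements of `N` are lifted along `p`, and the
defect of a lift comes from `L`. This turns short exact sequences into triangles. -/
lemma ShortExact.quasiIso {L M N : DGMod A} {i : L ⟶ M} {p : M ⟶ N} (h : ShortExact i p) :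
    DGMod.quasiIso A (coneDesc i p ((NullHomotopy.zero L N).ofEq h.comp_eq_zero.symm)) := by
  -- The homotopy is the zero one transported along an equation, so it still vanishes on elements.
  have hs {q q' : ℤ} (e : q' + 1 = q) (x : L.X q) :
      ((NullHomotopy.zero L N).ofEq h.comp_eq_zero.symm).s e x = 0 := by
    have : ∀ (ψ : L ⟶ N) (w : 0 = ψ), ((NullHomotopy.zero L N).ofEq w).s e x = 0 := by
      rintro _ rfl; rfl
    exact this _ _
  refine (quasiIso_iff _).2 fun q => ?_
  obtain ⟨q, rfl⟩ : ∃ p, q = p + 1 := ⟨q - 1, by lia⟩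
  refine ⟨fun z hz hb => ?_, fun n hn => ?_⟩
  · obtain ⟨h₁, h₂⟩ := cone_d_eq_zero.1 hz
    rw [coneDesc_f, hs, add_zero] at hb
    obtain ⟨n, hn⟩ := exists_of_mem_coboundaries (rfl : q + 1 = q + 1) hb
    obtain ⟨m, rfl⟩ := h.surjective _ n
    obtain ⟨l, hl⟩ := h.exact _ (z.1 - M.d rfl m) (by rw [map_sub, Hom.comm, hn, sub_self])
    refine cone_mem_coboundaries.2 ⟨m, l, by rw [hl]; abel, h.injective _ ?_⟩
    rw [map_neg, Hom.comm, hl, map_sub, M.d_d, sub_zero]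
    exact neg_eq_of_add_eq_zero_right h₁
  · obtain ⟨m, rfl⟩ := h.surjective _ n
    obtain ⟨l, hl⟩ := h.exact _ (M.d rfl m) (by rw [Hom.comm, hn])
    refine ⟨(m, -l), cone_d_eq_zero.2 ⟨?_, h.injective _ ?_⟩, ?_⟩
    · change M.d rfl m + Hom.f i _ (-l) = 0
      rw [map_neg, hl, add_neg_cancel]
    · change Hom.f i _ (L.d rfl (-l)) = _
      rw [map_neg, map_neg, Hom.comm, hl, M.d_d, neg_zero, map_zero]
    · change Hom.f p _ m + NullHomotopy.s _ rfl (-l) - Hom.f p _ m ∈ _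
      rw [hs, add_zero, sub_self]
      exact zero_mem _

lemma shortExact_cone {X Y : DGMod A} (φ : X ⟶ Y) : ShortExact (coneInl φ) (coneSnd φ) where
  injective q x y h := congrArg Prod.fst h
  surjective q x := ⟨((0 : Y.X q), x), rfl⟩
  comp_eq_zero := by ext q x; rfl
  exact q z h := ⟨z.1, Prod.ext rfl (Eq.symm h)⟩

end DGMod

namespace DGMod

variable {A : DGAlg k}

/-! ### Ore conditions up to homotopy -/

lemma quasiIso_zero_of_acyclic {M : DGMod A} (hM : M.Acyclic) :
    quasiIso A (0 : M ⟶ zero A) :=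
  (quasiIso_iff _).2 fun _ => ⟨fun _ hx _ => hM _ _ hx, fun _ _ => ⟨0, map_zero _, zero_mem _⟩⟩

lemma Acyclic.shift {M : DGMod A} (hM : M.Acyclic) (i : ℤ) :
    ((shiftFun A i).obj M).Acyclic := fun _ _ hx =>
  (quasiIso_shiftFun i _ (quasiIso_zero_of_acyclic hM)).mem_coboundaries hx
    (show (0 : PUnit) ∈ _ from zero_mem _)

/-- `Z'` is the homotopy fibre of `g`, realised as the cone of `Σ⁻¹ g`. Its projection to `Z` is a
quasi-isomorphism because `Σ⁻¹ C` is acyclic, and the projection followed by `g` has a canonical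
contraction. -/
lemma exists_quasiIso_comp_null_of_acyclic {Z C : DGMod A} (g : Z ⟶ C) (hC : C.Acyclic) :
    ∃ (Z' : DGMod A) (t : Z' ⟶ Z), quasiIso A t ∧ Nonempty (NullHomotopy (t ≫ g)) := by
  refine ⟨_, coneSnd ((shiftFun A (-1)).map g) ≫ (unshiftIso Z).hom,
    (MorphismProperty.cancel_right_of_respectsIso _ _ _).2 (quasiIso_coneSnd (hC.shift (-1))),
    ⟨((nullHomotopyConeSnd _).compRight (unshiftIso C).hom).ofEq ?_⟩⟩
  rw [Category.assoc, Category.assoc, unshiftIso_naturality]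

/-- The composite of `f` with the inclusion into the acyclic `Cone s` becomes contractible after a
quasi-isomorphism `t`, and a contraction is what is needed to lift `t ≫ f` along `s`. -/
lemma exists_right_ore {X Y Y' : DGMod A} (f : X ⟶ Y) (s : Y' ⟶ Y) (hs : quasiIso A s) :
    ∃ (X' : DGMod A) (t : X' ⟶ X) (v : X' ⟶ Y'), quasiIso A t ∧
      Nonempty (NullHomotopy (t ≫ f - v ≫ s)) := by
  obtain ⟨X', t, ht, ⟨h⟩⟩ := exists_quasiIso_comp_null_of_acyclic (f ≫ coneInl s) (acyclic_cone hs)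
  obtain ⟨v, hv⟩ := exists_lift_of_nullHomotopy s (t ≫ f) (h.ofEq (Category.assoc _ _ _).symm)
  exact ⟨X', t, v, ht, hv⟩

/-- The contraction lifts `f` to the homotopy fibre of `t`. The fibre is acyclic, so the lift
becomes contractible after a quasi-isomorphism, and `f` with it. -/
lemma exists_right_cancel {X Y Y' : DGMod A} (f : X ⟶ Y) (t : Y ⟶ Y') (ht : quasiIso A t)
    (h : NullHomotopy (f ≫ t)) :
    ∃ (X' : DGMod A) (s : X' ⟶ X), quasiIso A s ∧ Nonempty (NullHomotopy (s ≫ f)) := by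
  have w : (f ≫ t) ≫ (unshiftIso Y').inv =
      (f ≫ (unshiftIso Y).inv) ≫ (shiftFun A 1).map ((shiftFun A (-1)).map t) := by
    rw [← cancel_mono (unshiftIso Y').hom]
    simp [unshiftIso_naturality]
  have hc := acyclic_cone (quasiIso_shiftFun (-1) t ht)
  obtain ⟨X', s, hs, ⟨h'⟩⟩ := exists_quasiIso_comp_null_of_acyclic
    (coneLift _ _ ((h.compRight (unshiftIso Y').inv).ofEq w)) hc
  refine ⟨X', s, hs, ⟨(h'.compRight (coneSnd _ ≫ (unshiftIso Y).hom)).ofEq ?_⟩⟩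
  rw [Category.assoc, ← Category.assoc (coneLift _ _ _), coneLift_coneSnd]
  simp

/-- The contraction extends `f` over the acyclic `Cone s`. The inclusion of `Y` into the cone of
this extension is a quasi-isomorphism that kills the extension, hence `f`. -/
lemma exists_left_cancel {X' X Y : DGMod A} (s : X' ⟶ X) (f : X ⟶ Y) (hs : quasiIso A s)
    (h : NullHomotopy (s ≫ f)) :
    ∃ (Y' : DGMod A) (t : Y ⟶ Y'), quasiIso A t ∧ Nonempty (NullHomotopy (f ≫ t)) := by
  refine ⟨_, coneInl (coneDesc s f h), quasiIso_coneInl (acyclic_cone hs),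
    ⟨((nullHomotopyConeInl (coneDesc s f h)).compLeft (coneInl s)).ofEq ?_⟩⟩
  rw [← Category.assoc, coneInl_coneDesc]

/-- With `c` the map from the fibre of `s` to `Y` through `f`, the target is `Cone c`,
quasi-isomorphic to `Y` because the fibre is acyclic. There the image of `f` is contractible on the
fibre, so it extends along `s` up to homotopy. -/
lemma exists_left_ore {X X' Y : DGMod A} (f : X ⟶ Y) (s : X ⟶ X') (hs : quasiIso A s) :
    ∃ (Y' : DGMod A) (t : Y ⟶ Y') (v : X' ⟶ Y'), quasiIso A t ∧
      Nonempty (NullHomotopy (f ≫ t - s ≫ v)) := by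
  have hc := acyclic_cone (quasiIso_shiftFun (-1) s hs)
  let c := coneSnd ((shiftFun A (-1)).map s) ≫ (unshiftIso X).hom ≫ f
  obtain ⟨v, ⟨hv⟩⟩ := exists_extension_of_nullHomotopy ((shiftFun A (-1)).map s)
    ((unshiftIso X).hom ≫ f ≫ coneInl c) ((nullHomotopyConeInl c).ofEq (by simp [c]))
  refine ⟨_, coneInl c, (unshiftIso X').inv ≫ v, quasiIso_coneInl hc,
    ⟨(hv.compLeft (unshiftIso X).inv).ofEq ?_⟩⟩
  have := unshiftIso_naturality s
  rw [← cancel_mono (unshiftIso X').inv, Category.assoc, Category.assoc, Iso.hom_inv_id,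
    Category.comp_id] at this
  rw [Preadditive.comp_sub, this]
  simp

/-! ### The homotopy category -/

/-- The homotopy relation on DG morphisms. -/
def homotopic (A : DGAlg k) : HomRel (DGMod A) := fun _ _ φ ψ => Nonempty (NullHomotopy (φ - ψ))

instance : Congruence (homotopic A) where
  equivalence :=
    { refl := fun φ => ⟨(NullHomotopy.zero _ _).ofEq (sub_self φ).symm⟩
      symm := fun ⟨h⟩ => ⟨h.neg.ofEq (neg_sub _ _)⟩
      trans := fun ⟨h⟩ ⟨h'⟩ => ⟨(h.add h').ofEq (sub_add_sub_cancel _ _ _)⟩ }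
  comp_left f _ _ := fun ⟨h⟩ => ⟨(h.compLeft f).ofEq (Preadditive.comp_sub _ _ _)⟩
  comp_right g := fun ⟨h⟩ => ⟨(h.compRight g).ofEq (Preadditive.sub_comp _ _ _)⟩

/-- The homotopy category of DG modules. -/
abbrev HoCat (A : DGAlg k) := CategoryTheory.Quotient (homotopic A)

/-- The functor from DG modules to the homotopy category. -/
abbrev toHoCat (A : DGAlg k) : DGMod A ⥤ HoCat A := CategoryTheory.Quotient.functor (homotopic A)

/-- The quasi-isomorphisms of the homotopy category. -/
def hoQuasiIso (A : DGAlg k) : MorphismProperty (HoCat A) := fun X Y f =>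
  ∃ φ : X.as ⟶ Y.as, quasiIso A φ ∧ (toHoCat A).map φ = f

instance : (hoQuasiIso A).IsMultiplicative where
  id_mem X := ⟨𝟙 _, MorphismProperty.id_mem _ _, (toHoCat A).map_id _⟩
  comp_mem := by
    rintro X Y Z _ _ ⟨φ, hφ, rfl⟩ ⟨ψ, hψ, rfl⟩
    exact ⟨φ ≫ ψ, MorphismProperty.comp_mem _ _ _ hφ hψ, (toHoCat A).map_comp _ _⟩

lemma toHoCat_map_eq_iff {X Y : DGMod A} (f g : X ⟶ Y) :
    (toHoCat A).map f = (toHoCat A).map g ↔ Nonempty (NullHomotopy (f - g)) :=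
  CategoryTheory.Quotient.functor_map_eq_iff _ _ _

/-- The Ore squares above commute only up to homotopy, which is why the calculus of fractions is set
up on the homotopy category. -/
instance : (hoQuasiIso A).HasLeftCalculusOfFractions where
  exists_leftFraction := by
    rintro ⟨X⟩ ⟨Y⟩ ⟨s, ⟨s, hs, rfl⟩, f⟩
    obtain ⟨f, rfl⟩ := (toHoCat A).map_surjective f
    obtain ⟨Y', t, v, ht, h⟩ := exists_left_ore f s hs
    refine ⟨⟨(toHoCat A).map v, (toHoCat A).map t, ⟨t, ht, rfl⟩⟩, ?_⟩
    exact (toHoCat_map_eq_iff (f ≫ t) (s ≫ v)).2 h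
  ext := by
    rintro ⟨X'⟩ ⟨X⟩ ⟨Y⟩ f₁ f₂ s ⟨s, hs, rfl⟩ h
    obtain ⟨f₁, rfl⟩ := (toHoCat A).map_surjective f₁
    obtain ⟨f₂, rfl⟩ := (toHoCat A).map_surjective f₂
    obtain ⟨h⟩ := (toHoCat_map_eq_iff (s ≫ f₁) (s ≫ f₂)).1 h
    obtain ⟨Y', t, ht, ⟨h'⟩⟩ := exists_left_cancel s (f₁ - f₂) hs
      (h.ofEq (Preadditive.comp_sub _ _ _).symm)
    refine ⟨⟨Y'⟩, (toHoCat A).map t, ⟨t, ht, rfl⟩, ?_⟩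
    exact (toHoCat_map_eq_iff (f₁ ≫ t) (f₂ ≫ t)).2 ⟨h'.ofEq (Preadditive.sub_comp _ _ _)⟩

instance : (hoQuasiIso A).HasRightCalculusOfFractions where
  exists_rightFraction := by
    rintro ⟨X⟩ ⟨Y⟩ ⟨f, s, ⟨s, hs, rfl⟩⟩
    obtain ⟨f, rfl⟩ := (toHoCat A).map_surjective f
    obtain ⟨X', t, v, ht, h⟩ := exists_right_ore f s hs
    refine ⟨⟨(toHoCat A).map t, ⟨t, ht, rfl⟩, (toHoCat A).map v⟩, ?_⟩
    exact (toHoCat_map_eq_iff (t ≫ f) (v ≫ s)).2 h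
  ext := by
    rintro ⟨X⟩ ⟨Y⟩ ⟨Y'⟩ f₁ f₂ s ⟨s, hs, rfl⟩ h
    obtain ⟨f₁, rfl⟩ := (toHoCat A).map_surjective f₁
    obtain ⟨f₂, rfl⟩ := (toHoCat A).map_surjective f₂
    obtain ⟨h⟩ := (toHoCat_map_eq_iff (f₁ ≫ s) (f₂ ≫ s)).1 h
    obtain ⟨X', t, ht, ⟨h'⟩⟩ := exists_right_cancel (f₁ - f₂) s hs
      (h.ofEq (Preadditive.sub_comp _ _ _).symm)
    refine ⟨⟨X'⟩, (toHoCat A).map t, ⟨t, ht, rfl⟩, ?_⟩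
    exact (toHoCat_map_eq_iff (t ≫ f₁) (t ≫ f₂)).2 ⟨h'.ofEq (Preadditive.comp_sub _ _ _)⟩

end DGMod

namespace DerivedCat

open DGMod

variable {A : DGAlg k}

lemma isIso_Q_map {M N : DGMod A} {φ : M ⟶ N} (hφ : quasiIso A φ) : IsIso ((Q A).map φ) :=
  Localization.inverts (Q A) (quasiIso A) φ hφ

lemma isZero_Q_obj {M : DGMod A} (hM : M.Acyclic) : IsZero ((Q A).obj M) := by
  have := isIso_Q_map (quasiIso_zero_of_acyclic hM)
  rw [IsZero.iff_id_eq_zero, ← cancel_mono ((Q A).map (0 : M ⟶ zero A))]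
  simp

/-- A contraction extends `φ` over the cone of the identity of `M`, which is acyclic and so becomes
a zero object. -/
lemma Q_map_eq_zero {M N : DGMod A} {φ : M ⟶ N} (s : NullHomotopy φ) : (Q A).map φ = 0 := by
  rw [← coneInl_coneDesc (𝟙 M) φ (s.ofEq (Category.id_comp φ).symm), Functor.map_comp]
  exact ((isZero_Q_obj (acyclic_cone (MorphismProperty.id_mem _ _))).eq_of_tgt _ 0 =≫ _).trans
    zero_comp

/-- The functor from the homotopy category to the derived category. -/
def Qh (A : DGAlg k) : HoCat A ⥤ DerivedCat A :=
  CategoryTheory.Quotient.lift (homotopic A) (Q A) (fun _ _ f g ⟨h⟩ => by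
    rw [← sub_eq_zero, ← Functor.map_sub]
    exact Q_map_eq_zero h)

lemma toHoCat_comp_Qh : toHoCat A ⋙ Qh A = Q A := CategoryTheory.Quotient.lift_spec _ _ _

lemma hoQuasiIso_isInvertedBy : (hoQuasiIso A).IsInvertedBy (Qh A) := by
  rintro X Y _ ⟨φ, hφ, rfl⟩
  exact isIso_Q_map hφ

/-- The derived category is the localization of the homotopy category. -/
def strictUniversalPropertyQh (E : Type*) [Category* E] :
    Localization.StrictUniversalPropertyFixedTarget (Qh A) (hoQuasiIso A) E where
  inverts := hoQuasiIso_isInvertedBy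
  lift F hF := Localization.Construction.lift (toHoCat A ⋙ F)
    (fun _ _ φ hφ => hF _ ⟨φ, hφ, rfl⟩)
  fac F hF := by
    have h : ∀ (x y : DGMod A) (f₁ f₂ : x ⟶ y), homotopic A f₁ f₂ →
        (toHoCat A ⋙ F).map f₁ = (toHoCat A ⋙ F).map f₂ := fun _ _ f₁ f₂ h =>
      congrArg F.map (CategoryTheory.Quotient.sound _ h)
    refine Eq.trans (CategoryTheory.Quotient.lift_unique (homotopic A) (toHoCat A ⋙ F) h _ ?_)
      (CategoryTheory.Quotient.lift_unique (homotopic A) (toHoCat A ⋙ F) h F rfl).symm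
    rw [← Functor.assoc, toHoCat_comp_Qh]
    exact Localization.Construction.fac _ _
  uniq F₁ F₂ h := by
    refine Localization.Construction.uniq _ _ ?_
    have := congrArg (toHoCat A ⋙ ·) h
    rwa [← Functor.assoc, ← Functor.assoc, toHoCat_comp_Qh] at this

instance : (Qh A).IsLocalization (hoQuasiIso A) :=
  Functor.IsLocalization.mk' _ _ (strictUniversalPropertyQh _) (strictUniversalPropertyQh _)

/-! ### Morphisms in the derived category as fractions -/

/-- A fraction over the homotopy category has honest DG representatives, because `toHoCat` is full
and `hoQuasiIso` consists of classes of quasi-isomorphisms. -/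
lemma exists_left_fraction {X Y : DGMod A} (f : (Q A).obj X ⟶ (Q A).obj Y) :
    ∃ (Y' : DGMod A) (g : X ⟶ Y') (s : Y ⟶ Y'), quasiIso A s ∧
      f ≫ (Q A).map s = (Q A).map g := by
  obtain ⟨⟨g, s, hs⟩, h⟩ := Localization.exists_leftFraction (Qh A) (hoQuasiIso A)
    (X := ⟨X⟩) (Y := ⟨Y⟩) f
  obtain ⟨s, hs, rfl⟩ := hs
  obtain ⟨g, rfl⟩ := (toHoCat A).map_surjective g
  refine ⟨_, g, s, hs, ?_⟩
  have := MorphismProperty.LeftFraction.map_comp_map_s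
    ⟨(toHoCat A).map g, (toHoCat A).map s, ⟨s, hs, rfl⟩⟩ (Qh A)
    (Localization.inverts (Qh A) (hoQuasiIso A))
  rw [← h] at this
  exact this

lemma exists_right_fraction {X Y : DGMod A} (f : (Q A).obj X ⟶ (Q A).obj Y) :
    ∃ (X' : DGMod A) (s : X' ⟶ X) (g : X' ⟶ Y), quasiIso A s ∧
      (Q A).map s ≫ f = (Q A).map g := by
  obtain ⟨⟨s, hs, g⟩, h⟩ := Localization.exists_rightFraction (Qh A) (hoQuasiIso A)
    (X := ⟨X⟩) (Y := ⟨Y⟩) f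
  obtain ⟨s, hs, rfl⟩ := hs
  obtain ⟨g, rfl⟩ := (toHoCat A).map_surjective g
  refine ⟨_, s, g, hs, ?_⟩
  have := MorphismProperty.RightFraction.map_s_comp_map
    ⟨(toHoCat A).map s, ⟨s, hs, rfl⟩, (toHoCat A).map g⟩ (Qh A)
    (Localization.inverts (Qh A) (hoQuasiIso A))
  rw [← h] at this
  exact this

lemma exists_postcomp_null {X Y : DGMod A} {f : X ⟶ Y} (hf : (Q A).map f = 0) :
    ∃ (Y' : DGMod A) (s : Y ⟶ Y'), quasiIso A s ∧ Nonempty (NullHomotopy (f ≫ s)) := by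
  obtain ⟨⟨Y'⟩, s, ⟨s, hs, rfl⟩, h⟩ := (MorphismProperty.map_eq_iff_postcomp (Qh A) (hoQuasiIso A)
    ((toHoCat A).map f) ((toHoCat A).map 0)).1 (hf.trans (Functor.map_zero (Q A) X Y).symm)
  obtain ⟨h⟩ := (toHoCat_map_eq_iff (f ≫ s) (0 ≫ s)).1 h
  exact ⟨Y', s, hs, ⟨h.ofEq (by simp)⟩⟩

lemma exists_precomp_null {X Y : DGMod A} {f : X ⟶ Y} (hf : (Q A).map f = 0) :
    ∃ (X' : DGMod A) (s : X' ⟶ X), quasiIso A s ∧ Nonempty (NullHomotopy (s ≫ f)) := by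
  obtain ⟨⟨X'⟩, s, ⟨s, hs, rfl⟩, h⟩ := (MorphismProperty.map_eq_iff_precomp (Qh A) (hoQuasiIso A)
    ((toHoCat A).map f) ((toHoCat A).map 0)).1 (hf.trans (Functor.map_zero (Q A) X Y).symm)
  obtain ⟨h⟩ := (toHoCat_map_eq_iff (s ≫ f) (s ≫ 0)).1 h
  exact ⟨X', s, hs, ⟨h.ofEq (by simp)⟩⟩

end DerivedCat

/-! ### Homotopy pushouts -/

namespace DGMod

variable {A : DGAlg k}

/-- The homotopy pushout of `φ : X ⟶ Y` and `α : X ⟶ Z`. -/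
def pushoutMap {X Y Z : DGMod A} (φ : X ⟶ Y) (α : X ⟶ Z) : X ⟶ (prodBicone Y Z).pt :=
  φ ≫ (prodBicone Y Z).inl - α ≫ (prodBicone Y Z).inr

lemma pushoutMap_fst {X Y Z : DGMod A} (φ : X ⟶ Y) (α : X ⟶ Z) :
    pushoutMap φ α ≫ (prodBicone Y Z).fst = φ := by
  rw [pushoutMap, Preadditive.sub_comp, Category.assoc, Category.assoc, BinaryBicone.inl_fst,
    BinaryBicone.inr_fst]
  simp

lemma pushoutMap_snd {X Y Z : DGMod A} (φ : X ⟶ Y) (α : X ⟶ Z) :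
    pushoutMap φ α ≫ (prodBicone Y Z).snd = -α := by
  rw [pushoutMap, Preadditive.sub_comp, Category.assoc, Category.assoc, BinaryBicone.inl_snd,
    BinaryBicone.inr_snd]
  simp

/-- The quotient of the homotopy pushout by `Z` is the cone of `φ`: pushing out along `α` does not
change the cofibre. -/
lemma shortExact_pushout {X Y Z : DGMod A} (φ : X ⟶ Y) (α : X ⟶ Z) :
    ShortExact ((prodBicone Y Z).inr ≫ coneInl (pushoutMap φ α))
      (coneMap (pushoutMap φ α) φ (𝟙 X) (prodBicone Y Z).fst
        ((pushoutMap_fst φ α).trans (Category.id_comp φ).symm)) where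
  injective q x y h := congrArg (fun t : (Y.X q × Z.X q) × X.X (q + 1) => t.1.2) h
  surjective q x := ⟨(((x.1, 0) : Y.X q × Z.X q), x.2), rfl⟩
  comp_eq_zero := by
    ext q x
    rfl
  exact q z h := by
    obtain ⟨⟨y, z⟩, x⟩ : (Y.X q × Z.X q) × X.X (q + 1) := z
    have h₁ : y = 0 := congrArg Prod.fst h
    have h₂ : x = 0 := congrArg Prod.snd h
    subst h₁ h₂
    exact ⟨z, rfl⟩

end DGMod

namespace DerivedCat

open DGMod

variable {A : DGAlg k}

lemma Q_obj_surjective (X : DerivedCat A) : ∃ X' : DGMod A, (Q A).obj X' = X :=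
  (Localization.Construction.objEquiv (quasiIso A)).surjective X

/-! ### Exact triangles -/

/-- The cone is a weak cokernel. Writing `x` as a left fraction, `φ ≫ g` is contractible after a
further quasi-isomorphism, and the contraction defines the map out of the cone. -/
lemma exists_cone_desc {X Y : DGMod A} (φ : X ⟶ Y) {Z : DerivedCat A} (x : (Q A).obj Y ⟶ Z)
    (hx : (Q A).map φ ≫ x = 0) : ∃ y, (Q A).map (coneInl φ) ≫ y = x := by
  obtain ⟨Z, rfl⟩ := Q_obj_surjective Z
  obtain ⟨Z', g, s, hs, h⟩ := exists_left_fraction x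
  have hg : (Q A).map (φ ≫ g) = 0 := by
    rw [Functor.map_comp, ← h, ← Category.assoc, hx, zero_comp]
  obtain ⟨Z'', t, ht, ⟨n⟩⟩ := exists_postcomp_null hg
  have := isIso_Q_map (MorphismProperty.comp_mem _ _ _ hs ht)
  refine ⟨(Q A).map (coneDesc φ (g ≫ t) (n.ofEq (Category.assoc _ _ _))) ≫
    inv ((Q A).map (s ≫ t)), ?_⟩
  rw [← Category.assoc, ← Functor.map_comp, coneInl_coneDesc, IsIso.comp_inv_eq, Functor.map_comp,
    Functor.map_comp, ← Category.assoc, h]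

/-- Dually, `φ` is a weak kernel of `coneInl φ`. The DG lift commutes only up to homotopy, which `Q`
does not see. -/
lemma exists_cone_lift {X Y : DGMod A} (φ : X ⟶ Y) {Z : DerivedCat A} (x : Z ⟶ (Q A).obj Y)
    (hx : x ≫ (Q A).map (coneInl φ) = 0) : ∃ y, y ≫ (Q A).map φ = x := by
  obtain ⟨Z, rfl⟩ := Q_obj_surjective Z
  obtain ⟨Z', s, g, hs, h⟩ := exists_right_fraction x
  have hg : (Q A).map (g ≫ coneInl φ) = 0 := by
    rw [Functor.map_comp, ← h, Category.assoc, hx, comp_zero]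
  obtain ⟨Z'', t, ht, ⟨n⟩⟩ := exists_precomp_null hg
  have := isIso_Q_map (MorphismProperty.comp_mem _ _ _ ht hs)
  obtain ⟨v, ⟨m⟩⟩ := exists_lift_of_nullHomotopy φ (t ≫ g) (n.ofEq (Category.assoc _ _ _).symm)
  refine ⟨inv ((Q A).map (t ≫ s)) ≫ (Q A).map v, ?_⟩
  rw [Category.assoc, IsIso.inv_comp_eq, ← Functor.map_comp, Functor.map_comp (Q A) t s,
    Category.assoc, h, ← Functor.map_comp, eq_comm, ← sub_eq_zero, ← Functor.map_sub]
  exact Q_map_eq_zero m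

lemma map_comp_coneInl {X Y : DGMod A} (φ : X ⟶ Y) :
    (Q A).map φ ≫ (Q A).map (coneInl φ) = 0 := by
  rw [← Functor.map_comp]
  exact Q_map_eq_zero (nullHomotopyConeInl φ)

section

variable {L M N : DerivedCat A} {f : L ⟶ M} {g : M ⟶ N} {h : N ⟶ (shift A 1).obj L}

lemma IsExactTriangle.comp_eq_zero (T : IsExactTriangle f g h) : f ≫ g = 0 := by
  obtain ⟨X, Y, φ, a, b, c, h₁, h₂, -⟩ := T
  rw [← cancel_mono c.hom, Category.assoc, h₂, ← Category.assoc, h₁, Category.assoc,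
    map_comp_coneInl, comp_zero, zero_comp]

lemma IsExactTriangle.exists_desc (T : IsExactTriangle f g h) {Z : DerivedCat A} (x : M ⟶ Z)
    (hx : f ≫ x = 0) : ∃ y, g ≫ y = x := by
  obtain ⟨X, Y, φ, a, b, c, h₁, h₂, -⟩ := T
  obtain ⟨y, hy⟩ := exists_cone_desc φ (b.inv ≫ x) (by
    rw [← cancel_epi a.hom, ← Category.assoc, ← h₁, Category.assoc, Iso.hom_inv_id_assoc, hx,
      comp_zero])
  exact ⟨c.hom ≫ y, by rw [← Category.assoc, h₂, Category.assoc, hy, Iso.hom_inv_id_assoc]⟩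

lemma IsExactTriangle.exists_lift (T : IsExactTriangle f g h) {Z : DerivedCat A} (x : Z ⟶ M)
    (hx : x ≫ g = 0) : ∃ y, y ≫ f = x := by
  obtain ⟨X, Y, φ, a, b, c, h₁, h₂, -⟩ := T
  obtain ⟨y, hy⟩ := exists_cone_lift φ (x ≫ b.hom) (by
    rw [Category.assoc, ← h₂, ← Category.assoc, hx, zero_comp])
  refine ⟨y ≫ a.inv, ?_⟩
  rw [← cancel_mono b.hom, Category.assoc, Category.assoc, h₁, Iso.inv_hom_id_assoc, hy]

/-- The connecting morphism can be transported from `coneSnd φ`, so two commuting squares suffice to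
recognise a triangle. -/
lemma exists_isExactTriangle {X Y : DGMod A} (φ : X ⟶ Y) (a : L ≅ (Q A).obj X)
    (b : M ≅ (Q A).obj Y) (c : N ≅ (Q A).obj (cone φ)) (h₁ : f ≫ b.hom = a.hom ≫ (Q A).map φ)
    (h₂ : g ≫ c.hom = b.hom ≫ (Q A).map (coneInl φ)) : ∃ h, IsExactTriangle f g h :=
  ⟨c.hom ≫ (Q A).map (coneSnd φ) ≫ (shiftIso A 1).inv.app X ≫ (shift A 1).map a.inv,
    X, Y, φ, a, b, c, h₁, h₂, by
      simp only [Category.assoc]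
      rw [← Functor.map_comp_assoc, Iso.inv_hom_id, CategoryTheory.Functor.map_id, Category.id_comp,
        Iso.inv_hom_id_app]
      exact congrArg _ (Category.comp_id _)⟩

lemma IsExactTriangle.of_iso (T : IsExactTriangle f g h) {L' M' N' : DerivedCat A}
    {f' : L' ⟶ M'} {g' : M' ⟶ N'} (a : L' ≅ L) (b : M' ≅ M) (c : N' ≅ N)
    (h₁ : f' ≫ b.hom = a.hom ≫ f) (h₂ : g' ≫ c.hom = b.hom ≫ g) :
    ∃ h', IsExactTriangle f' g' h' := by
  obtain ⟨X, Y, φ, a', b', c', h₁', h₂', -⟩ := T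
  exact exists_isExactTriangle φ (a ≪≫ a') (b ≪≫ b') (c ≪≫ c')
    (by simp [reassoc_of% h₁, h₁']) (by simp [reassoc_of% h₂, h₂'])

end

lemma exists_isExactTriangle_of_shortExact {L M N : DGMod A} {i : L ⟶ M} {p : M ⟶ N}
    (h : ShortExact i p) : ∃ t, IsExactTriangle ((Q A).map i) ((Q A).map p) t := by
  have := isIso_Q_map h.quasiIso
  refine exists_isExactTriangle i (Iso.refl _) (Iso.refl _) (asIso ((Q A).map
    (coneDesc i p ((NullHomotopy.zero L N).ofEq h.comp_eq_zero.symm)))).symm (by simp) ?_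
  rw [Iso.symm_hom, asIso_inv, IsIso.comp_inv_eq, Iso.refl_hom, Category.id_comp,
    ← Functor.map_comp, coneInl_coneDesc]

/-- Every morphism of the derived category is isomorphic to the image of a DG morphism. -/
lemma exists_arrow_iso {X Y : DerivedCat A} (f : X ⟶ Y) :
    ∃ (X' Y' : DGMod A) (φ : X' ⟶ Y') (a : X ≅ (Q A).obj X') (b : Y ≅ (Q A).obj Y'),
      f ≫ b.hom = a.hom ≫ (Q A).map φ := by
  obtain ⟨X, rfl⟩ := Q_obj_surjective X
  obtain ⟨Y, rfl⟩ := Q_obj_surjective Y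
  obtain ⟨Y', g, s, hs, h⟩ := exists_left_fraction f
  have := isIso_Q_map hs
  exact ⟨X, Y', g, Iso.refl _, asIso ((Q A).map s), by simp [h]⟩

/-- Every morphism has a fibre, and the triangle of the fibre can be rotated. -/
lemma exists_fibre {X T : DerivedCat A} (u : X ⟶ T) :
    ∃ (X' : DerivedCat A) (i : (shift A (-1)).obj T ⟶ X') (j : X' ⟶ X),
      (∃ h, IsExactTriangle i j h) ∧ ∃ h, IsExactTriangle j u h := by
  obtain ⟨X₀, T₀, φ, a, b, hu⟩ := exists_arrow_iso u
  -- The fibre is the cone of `Σ⁻¹ φ`. Its canonical short exact sequence gives the first triangle;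
  -- the comparison of the cone of `coneSnd ψ` with `Σ Σ⁻¹ T₀` gives the rotated one.
  let ψ := (shiftFun A (-1)).map φ
  have := isIso_Q_map (quasiIso_coneDesc_coneSnd ψ)
  let eX := (Q A).mapIso (unshiftIso X₀)
  let eT := (Q A).mapIso (unshiftIso T₀)
  obtain ⟨t, ht⟩ := exists_isExactTriangle_of_shortExact (shortExact_cone ψ)
  let a' : (shift A (-1)).obj T ≅ (Q A).obj ((shiftFun A (-1)).obj T₀) :=
    (shift A (-1)).mapIso b ≪≫ (shiftIso A (-1)).app T₀
  refine ⟨(Q A).obj (cone ψ), a'.hom ≫ (Q A).map (coneInl ψ),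
    (Q A).map (coneSnd ψ) ≫ eX.hom ≫ a.inv, ?_, ?_⟩
  · exact ht.of_iso a' (Iso.refl _) (a ≪≫ eX.symm) (by simp) (by simp)
  · refine exists_isExactTriangle (coneSnd ψ) (Iso.refl _) (a ≪≫ eX.symm)
      (b ≪≫ eT.symm ≪≫ (asIso ((Q A).map (coneDesc (coneSnd ψ) ((shiftFun A 1).map ψ)
        (nullHomotopyConeSnd ψ)))).symm) (by simp) ?_
    have h₁ : (Q A).map ((shiftFun A 1).map ψ) ≫ eT.hom = eX.hom ≫ (Q A).map φ := by
      simp only [eT, eX, Functor.mapIso_hom, ← Functor.map_comp, ψ, unshiftIso_naturality]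
    simp only [Iso.trans_hom, Iso.symm_hom, asIso_inv, ← Category.assoc]
    rw [IsIso.comp_inv_eq, Iso.comp_inv_eq, hu]
    simp only [Category.assoc]
    rw [← Functor.map_comp_assoc, coneInl_coneDesc, h₁, Iso.inv_hom_id_assoc]

/-- Homotopy pushouts in the derived category. -/
lemma exists_pushout {X' X T G : DerivedCat A} {j : X' ⟶ X} {u : X ⟶ T}
    {h : T ⟶ (shift A 1).obj X'} (H : IsExactTriangle j u h) (a : X' ⟶ G) :
    ∃ (P : DerivedCat A) (i₁ : X ⟶ P) (i₂ : G ⟶ P) (p : P ⟶ T),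
      (∃ t, IsExactTriangle i₂ p t) ∧ ∀ (Z : DerivedCat A) (c : X ⟶ Z) (e : G ⟶ Z),
        j ≫ c = a ≫ e → ∃ y : P ⟶ Z, i₁ ≫ y = c ∧ i₂ ≫ y = e := by
  obtain ⟨X₁, X₀, φ, α, β, γ, h₁, h₂, -⟩ := H
  obtain ⟨G, rfl⟩ := Q_obj_surjective G
  -- Replacing `G` by the isomorphic `G₁` makes the map a DG morphism, so that the homotopy pushout
  -- can be formed.
  obtain ⟨G₁, g, s, hs, hg⟩ := exists_left_fraction (α.inv ≫ a)
  have := isIso_Q_map hs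
  obtain ⟨t, ht⟩ := exists_isExactTriangle_of_shortExact (shortExact_pushout φ g)
  refine ⟨(Q A).obj (cone (pushoutMap φ g)),
    β.hom ≫ (Q A).map ((prodBicone X₀ G₁).inl ≫ coneInl _),
    (Q A).map s ≫ (Q A).map ((prodBicone X₀ G₁).inr ≫ coneInl _), (Q A).map
      (coneMap (pushoutMap φ g) φ (𝟙 X₁) (prodBicone X₀ G₁).fst
        ((pushoutMap_fst φ g).trans (Category.id_comp φ).symm)) ≫ γ.inv,
    ht.of_iso (asIso ((Q A).map s)) (Iso.refl _) γ (by simp) (by simp), fun Z c e hce => ?_⟩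
  have hφ : (Q A).map φ ≫ β.inv ≫ c = (Q A).map g ≫ inv ((Q A).map s) ≫ e := by
    rw [← cancel_epi α.hom, ← Category.assoc, ← h₁, ← hg]
    simpa using hce
  -- The maps `c` and `e` add up to a map on the direct sum. Their agreement makes it vanish along
  -- `pushoutMap`, so it extends over the cone, without any claim of uniqueness.
  obtain ⟨y, hy⟩ := exists_cone_desc (pushoutMap φ g)
    ((Q A).map (prodBicone X₀ G₁).fst ≫ β.inv ≫ c +
      (Q A).map (prodBicone X₀ G₁).snd ≫ inv ((Q A).map s) ≫ e) (by
    rw [Preadditive.comp_add, ← Functor.map_comp_assoc, ← Functor.map_comp_assoc, pushoutMap_fst,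
      pushoutMap_snd, hφ, Functor.map_neg, Preadditive.neg_comp, add_neg_cancel])
  refine ⟨y, ?_, ?_⟩
  · rw [Category.assoc, Functor.map_comp, Category.assoc, hy, Preadditive.comp_add,
      ← Functor.map_comp_assoc, ← Functor.map_comp_assoc, BinaryBicone.inl_fst,
      BinaryBicone.inl_snd]
    simp
  · rw [Category.assoc, Functor.map_comp, Category.assoc, hy, Preadditive.comp_add,
      ← Functor.map_comp_assoc, ← Functor.map_comp_assoc, BinaryBicone.inr_fst,
      BinaryBicone.inr_snd]
    simp

/-- Split monomorphisms of the derived category are inclusions of direct summands. -/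
lemma exists_bicone_of_retract {M G : DerivedCat A} (i : M ⟶ G) (r : G ⟶ M) (hi : i ≫ r = 𝟙 M) :
    ∃ (N : DerivedCat A) (b : BinaryBicone M N), Nonempty b.IsBilimit ∧ b.pt = G := by
  obtain ⟨X, Y, φ, a, b, h⟩ := exists_arrow_iso i
  have hφ : (Q A).map φ ≫ b.inv ≫ r ≫ a.hom = 𝟙 _ := by
    rw [← cancel_epi a.hom, ← Category.assoc, ← h]
    simp [reassoc_of% hi]
  -- A split monomorphism stays one under `Σ`. As `coneSnd φ` followed by `Σ φ` is zero, the
  -- connecting morphism of the triangle must vanish.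
  have hmono : Mono ((Q A).map ((shiftFun A 1).map φ)) := by
    have h₁ : Mono ((shift A 1).map ((Q A).map φ)) :=
      mono_of_mono_fac (h := 𝟙 _) ((Functor.map_comp _ _ _).symm.trans
        ((congrArg _ hφ).trans (CategoryTheory.Functor.map_id _ _)))
    have h₂ := (shiftIso A 1).hom.naturality φ
    have h₃ : (Q A).map ((shiftFun A 1).map φ) = (shiftIso A 1).inv.app X ≫
        (shift A 1).map ((Q A).map φ) ≫ (shiftIso A 1).hom.app Y := by
      rw [← cancel_epi ((shiftIso A 1).hom.app X), Iso.hom_inv_id_app_assoc]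
      exact h₂.symm
    rw [h₃]
    infer_instance
  have hsnd : (Q A).map (coneSnd φ) = 0 := by
    rw [← cancel_mono ((Q A).map ((shiftFun A 1).map φ)), zero_comp, ← Functor.map_comp]
    exact Q_map_eq_zero (nullHomotopyConeSnd φ)
  obtain ⟨t, ht⟩ := exists_isExactTriangle_of_shortExact (shortExact_cone φ)
  -- A morphism killed by `coneInl φ` factors through the connecting morphism, which is zero.
  have hepi : Epi ((Q A).map (coneInl φ)) := Preadditive.epi_of_cancel_zero _ fun x hx => by
    obtain ⟨y, rfl⟩ := ht.exists_desc x hx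
    rw [hsnd, zero_comp]
  let g := b.hom ≫ (Q A).map (coneInl φ)
  have hg : i ≫ g = 0 := by
    rw [← Category.assoc, h, Category.assoc, map_comp_coneInl, comp_zero]
  -- The idempotent complementary to `r ≫ i` vanishes on `M`, so it factors through the cone. This
  -- gives the inclusion `y` of the complement; its remaining identities follow by cancelling the
  -- epimorphism `g`.
  obtain ⟨y, hy⟩ := exists_cone_desc φ (b.inv ≫ (𝟙 G - r ≫ i)) (by
    rw [← cancel_epi a.hom, ← Category.assoc, ← h]
    simp [reassoc_of% hi])
  have hgy : g ≫ y = 𝟙 G - r ≫ i := by rw [Category.assoc, hy, Iso.hom_inv_id_assoc]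
  refine ⟨(Q A).obj (cone φ), ⟨G, r, g, i, y, hi, hg, ?_, ?_⟩,
    ⟨isBinaryBilimitOfTotal _ ?_⟩, rfl⟩
  · rw [← cancel_epi g, ← Category.assoc, hgy, Preadditive.sub_comp, Category.assoc, hi]
    simp
  · rw [← cancel_epi g, ← Category.assoc, hgy, Preadditive.sub_comp, Category.assoc, hg]
    simp
  · change r ≫ i + g ≫ y = 𝟙 G
    rw [hgy, add_sub_cancel]

end DerivedCat

namespace DGMod

variable {A : DGAlg k}

/-! ### Direct sums -/

-- Choosing solutions only on the support of `y`, and `0` elsewhere, keeps the family finitely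
-- supported. This is how componentwise arguments pass to direct sums.
open Classical in
lemma exists_dfinsupp {J : Type*} {β γ : J → Type*} [∀ j, Zero (β j)] [∀ j, Zero (γ j)]
    (R : ∀ j, γ j → β j → Prop) (h0 : ∀ j, R j 0 0) (y : Π₀ j, β j)
    (h : ∀ j, ∃ x, R j x (y j)) : ∃ x : Π₀ j, γ j, ∀ j, R j (x j) (y j) := by
  choose f hf using h
  refine ⟨DFinsupp.mk y.support (fun j => f j), fun j => ?_⟩
  rw [DFinsupp.mk_apply]
  split_ifs with hj
  · exact hf j
  · rw [DFinsupp.notMem_support_iff.1 hj]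
    exact h0 j

variable {J : Type u} (N : J → DGMod A)

/-- The direct sum of a family of DG modules. -/
def dsum : DGMod A where
  X q := Π₀ j, (N j).X q
  d h := DFinsupp.mapRange.addMonoidHom (fun j => (N j).d h)
  d_d h h' x := by ext j; simp [(N j).d_d]
  smul h := AddMonoidHom.mk' (fun a => DFinsupp.mapRange.addMonoidHom (fun j => (N j).smul h a))
    (fun a b => by ext; simp)
  one_smul h x := by ext j; simp [(N j).one_smul]
  mul_smul hs hsn hr hn a b x := by
    ext j
    simpa using (N j).mul_smul hs hsn hr hn a b (x j)
  leibniz hp hq hn h h₁ h₂ a x := by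
    ext j
    simpa [Units.smul_def] using (N j).leibniz hp hq hn h h₁ h₂ a (x j)

lemma dsum_ext {q : ℤ} {x y : (dsum N).X q} (h : ∀ j, (show Π₀ j, (N j).X q from x) j =
    (show Π₀ j, (N j).X q from y) j) : x = y :=
  DFinsupp.ext h

/-- The projections of a direct sum. -/
def dsumπ (j : J) : dsum N ⟶ N j where
  f q := (DFinsupp.evalAddMonoidHom j : (Π₀ j, (N j).X q) →+ (N j).X q)
  comm _ _ := rfl
  map_smul _ _ _ := rfl

open Classical in
/-- The inclusions of a direct sum. -/
def dsumι (j : J) : N j ⟶ dsum N where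
  f q := DFinsupp.singleAddHom (fun j => (N j).X q) j
  comm h _ := (DFinsupp.mapRange_single (f := fun j => (N j).d h)
    (hf := fun _ => map_zero _)).symm
  map_smul h a _ := (DFinsupp.mapRange_single (f := fun j => (N j).smul h a)
    (hf := fun _ => map_zero _)).symm

lemma dsumι_π_same (j : J) : dsumι N j ≫ dsumπ N j = 𝟙 _ := by
  classical
  ext q x
  exact DFinsupp.single_eq_same (β := fun j => (N j).X q)

lemma dsumι_π_ne {i j : J} (h : i ≠ j) : dsumι N i ≫ dsumπ N j = 0 := by
  classical
  ext q x
  exact DFinsupp.single_eq_of_ne (β := fun j => (N j).X q) h.symm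

open Classical in
lemma dsum_hom_ext {q : ℤ} {G : Type*} [AddCommGroup G] {f g : (dsum N).X q →+ G}
    (h : ∀ (j : J) (x : (N j).X q), f (Hom.f (dsumι N j) q x) = g (Hom.f (dsumι N j) q x)) :
    f = g :=
  DFinsupp.addHom_ext (β := fun j => (N j).X q) h

open Classical in
/-- The additive map out of a direct sum with given components. -/
def dsumLift {q : ℤ} {G : Type*} [AddCommGroup G] (f : ∀ j, (N j).X q →+ G) :
    (dsum N).X q →+ G :=
  DFinsupp.liftAddHom (β := fun j => (N j).X q) f

lemma dsumLift_ι {q : ℤ} {G : Type*} [AddCommGroup G] (f : ∀ j, (N j).X q →+ G) (j : J)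
    (x : (N j).X q) : dsumLift N f (Hom.f (dsumι N j) q x) = f j x := by
  classical
  exact DFinsupp.liftAddHom_apply_single f j x

variable {N}

/-- The morphism out of a direct sum with given components. -/
def dsumDesc {Z : DGMod A} (g : ∀ j, N j ⟶ Z) : dsum N ⟶ Z where
  f q := dsumLift N (fun j => Hom.f (g j) q)
  comm {q q'} h x := by
    refine DFunLike.congr_fun (f := (dsumLift N (fun j => Hom.f (g j) q')).comp ((dsum N).d h))
      (g := (Z.d h).comp (dsumLift N (fun j => Hom.f (g j) q))) (dsum_hom_ext N fun j x => ?_) x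
    simp only [AddMonoidHom.comp_apply, ← Hom.comm, dsumLift_ι]
  map_smul {p q n} h a x := by
    refine DFunLike.congr_fun
      (f := (dsumLift N (fun j => Hom.f (g j) n)).comp ((dsum N).smul h a))
      (g := (Z.smul h a).comp (dsumLift N (fun j => Hom.f (g j) q)))
      (dsum_hom_ext N fun j x => ?_) x
    simp only [AddMonoidHom.comp_apply, ← Hom.map_smul, dsumLift_ι]

lemma dsumι_f_desc {Z : DGMod A} (g : ∀ j, N j ⟶ Z) (j : J) (q : ℤ) (x : (N j).X q) :
    Hom.f (dsumDesc g) q (Hom.f (dsumι N j) q x) = Hom.f (g j) q x :=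
  dsumLift_ι N _ j x

lemma dsumι_desc {Z : DGMod A} (g : ∀ j, N j ⟶ Z) (j : J) : dsumι N j ≫ dsumDesc g = g j := by
  ext q x
  exact dsumι_f_desc g j q x

lemma dsum_morphism_ext {Z : DGMod A} {f g : dsum N ⟶ Z}
    (h : ∀ j, dsumι N j ≫ f = dsumι N j ≫ g) : f = g := by
  ext q x
  exact DFunLike.congr_fun (dsum_hom_ext N fun j x => congrArg (fun t => Hom.f t q x) (h j)) x

/-- A null homotopy on a direct sum from null homotopies on the summands. -/
def NullHomotopy.dsum {Z : DGMod A} {φ : dsum N ⟶ Z} (s : ∀ j, NullHomotopy (dsumι N j ≫ φ)) :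
    NullHomotopy φ where
  s h := dsumLift N (fun j => (s j).s h)
  comm {q q' q''} h h' x := by
    refine DFunLike.congr_fun (f := Hom.f φ q) (g := (Z.d h).comp (dsumLift N fun j => (s j).s h) +
      (dsumLift N fun j => (s j).s h').comp ((DGMod.dsum N).d h')) (dsum_hom_ext N fun j x => ?_) x
    simp only [AddMonoidHom.comp_apply, AddMonoidHom.add_apply, ← Hom.comm, dsumLift_ι]
    exact (s j).comm h h' x
  map_smul {p q q' n n'} hq hn h h' a x := by
    refine DFunLike.congr_fun (f := (dsumLift N fun j => (s j).s hn).comp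
      ((DGMod.dsum N).smul h a)) (g := p.negOnePow • (Z.smul h' a).comp
        (dsumLift N fun j => (s j).s hq)) (dsum_hom_ext N fun j x => ?_) x
    simp only [AddMonoidHom.comp_apply, ← Hom.map_smul, dsumLift_ι]
    refine ((s j).map_smul hq hn h h' a x).trans ?_
    change _ = p.negOnePow • (Z.smul h' a (dsumLift N _ (Hom.f (dsumι N j) q x)))
    rw [dsumLift_ι]

lemma NullHomotopy.dsum_s_ι {Z : DGMod A} {φ : DGMod.dsum N ⟶ Z}
    (s : ∀ j, NullHomotopy (dsumι N j ≫ φ)) {q q' : ℤ} (h : q' + 1 = q) (j : J)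
    (x : (N j).X q) :
    (NullHomotopy.dsum s).s h (Hom.f (dsumι N j) q x) = (s j).s h x :=
  dsumLift_ι N _ j x

lemma dsum_d_eq_zero {q : ℤ} {x : Π₀ j, (N j).X q} :
    (dsum N).d rfl x = 0 ↔ ∀ j, (N j).d rfl (x j) = 0 := by
  constructor
  · intro h j
    exact DFunLike.congr_fun (F := Π₀ j, (N j).X (q + 1)) h j
  · intro h
    exact DFinsupp.ext (fun j => h j)

lemma dsum_mem_coboundaries {q : ℤ} {x : Π₀ j, (N j).X q}
    (h : ∀ j, x j ∈ (N j).coboundaries q) : (show (dsum N).X q from x) ∈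
      (dsum N).coboundaries q := by
  obtain ⟨y, hy⟩ := exists_dfinsupp
    (fun j (y : (N j).X (q - 1)) x => (N j).d (show q - 1 + 1 = q by lia) y = x)
    (fun j => map_zero _) x (fun j => exists_of_mem_coboundaries _ (h j))
  exact mem_coboundaries.2 ⟨q - 1, by lia, y, DFinsupp.ext hy⟩

lemma dsum_coboundaries_apply {q : ℤ} {x : Π₀ j, (N j).X q}
    (h : (show (dsum N).X q from x) ∈ (dsum N).coboundaries q) (j : J) :
    x j ∈ (N j).coboundaries q := by
  obtain ⟨p, e, y, hy⟩ := mem_coboundaries.1 h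
  exact mem_coboundaries.2 ⟨p, e, (show Π₀ j, (N j).X p from y) j,
    DFunLike.congr_fun (F := Π₀ j, (N j).X q) hy j⟩

variable {M : J → DGMod A}

lemma dsumDesc_apply (s : ∀ j, M j ⟶ N j) (q : ℤ) (x : Π₀ j, (M j).X q) (j : J) :
    (show Π₀ j, (N j).X q from Hom.f (dsumDesc (fun j => s j ≫ dsumι N j)) q x) j =
      Hom.f (s j) q (x j) := by
  have : dsumDesc (fun j => s j ≫ dsumι N j) ≫ dsumπ N j = dsumπ M j ≫ s j := by
    refine dsum_morphism_ext fun i => ?_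
    rw [← Category.assoc, dsumι_desc, Category.assoc]
    by_cases h : i = j
    · subst h
      rw [dsumι_π_same, ← Category.assoc, dsumι_π_same]
      simp
    · rw [dsumι_π_ne N h, ← Category.assoc, dsumι_π_ne M h]
      simp
  exact congrArg (fun t => Hom.f t q x) this

/-- Cohomology is computed componentwise, with finite support supplied by `exists_dfinsupp`. -/
lemma quasiIso_dsum (s : ∀ j, M j ⟶ N j) (hs : ∀ j, quasiIso A (s j)) :
    quasiIso A (dsumDesc (fun j => s j ≫ dsumι N j)) := by
  refine (quasiIso_iff _).2 fun q =>
    ⟨fun (x : Π₀ j, (M j).X q) hx h => ?_, fun y hy => ?_⟩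
  · refine dsum_mem_coboundaries fun j => (hs j).mem_coboundaries (dsum_d_eq_zero.1 hx j) ?_
    rw [← dsumDesc_apply]
    exact dsum_coboundaries_apply h j
  · obtain ⟨x, hx⟩ := exists_dfinsupp
      (fun j (x : (M j).X q) (y : (N j).X q) => (M j).d rfl x = 0 ∧
        Hom.f (s j) q x - y ∈ (N j).coboundaries q)
      (fun j => ⟨map_zero _, by rw [map_zero, sub_zero]; exact zero_mem _⟩) y
      (fun j => (hs j).exists_cocycle (dsum_d_eq_zero.1 hy j))
    refine ⟨x, dsum_d_eq_zero.2 fun j => (hx j).1, dsum_mem_coboundaries fun j => ?_⟩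
    have := (hx j).2
    rw [← dsumDesc_apply] at this
    exact this

/-- Suspensions commute with direct sums. -/
def shiftDsumIso (N : J → DGMod A) (i : ℤ) :
    (shiftFun A i).obj (dsum N) ≅ dsum (fun j => (shiftFun A i).obj (N j)) :=
  isoMk (fun q => AddEquiv.refl (Π₀ j, (N j).X (q + i)))
    (fun {q q'} h x => by
      refine dsum_ext _ fun j => ?_
      rfl)
    (fun {p q n} h a x => by
      refine dsum_ext _ fun j => ?_
      rfl)

end DGMod

lemma DGAlg.d_one (A : DGAlg k) : A.d 1 = 0 := by
  have := A.leibniz (p := 0) 1 (SetLike.one_mem_graded A.gr)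
  simpa using this

namespace DGMod

variable {A : DGAlg k}

/-! ### Morphisms out of suspensions of `A` -/

/-- The generator of `Σ^i A` sits in a degree `q + i` of `A` that is zero only propositionally, so
`one_smul` does not apply to it directly. -/
lemma smul_of_eq_one (M : DGMod A) {p q n : ℤ} (hp : p = 0) (h : p + q = n) (a : A.gr p)
    (ha : a.1 = 1) (x : M.X q) : M.smul h a x = M.cast (by lia) x := by
  subst hp
  obtain rfl : q = n := by lia
  obtain rfl : a = A.oneGr := Subtype.ext ha
  exact M.one_smul h x

/-- The free DG module `Σ^i A`. -/
abbrev free (A : DGAlg k) (i : ℤ) : DGMod A := (shiftFun A i).obj (self A)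

/-- The generator of `Σ^i A`. -/
def gen (A : DGAlg k) {i q : ℤ} (h : q + i = 0) : (free A i).X q :=
  (⟨1, h ▸ SetLike.one_mem_graded A.gr⟩ : A.gr (q + i))

lemma d_gen {i q q' : ℤ} (h : q + i = 0) (h' : q + 1 = q') : (free A i).d h' (gen A h) = 0 := by
  refine (shift_d i (self A) h' _).trans ?_
  have : (self A).d (show (q + i) + 1 = q' + i by lia) (gen A h) = 0 := Subtype.ext A.d_one
  rw [this, smul_zero]
  rfl

/-- The morphism `Σ^i A ⟶ Y` given by a cocycle of degree `-i`. -/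
def freeMap {i q₀ : ℤ} (hi : q₀ + i = 0) {Y : DGMod A} (y : Y.X q₀) (hy : Y.d rfl y = 0) :
    free A i ⟶ Y where
  -- The sign is the one in `free_eq_smul_gen`, which arises when an element of `Σ^i A` is written
  -- as a multiple of the generator.
  f q := ((q + i) * i).negOnePow • (Y.smul (show (q + i) + q₀ = q by lia)).flip y
  comm {q q'} h (b : A.gr (q + i)) := by
    subst h
    change ((q + 1 + i) * i).negOnePow • Y.smul _
      (i.negOnePow • A.dGr (show q + i + 1 = q + 1 + i by lia) b) y =
      Y.d rfl (((q + i) * i).negOnePow • Y.smul _ b y)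
    have h₁ := Y.leibniz (show q + i + 1 = q + 1 + i by lia) (rfl : q₀ + 1 = q₀ + 1)
      (rfl : q + 1 = q + 1) (by lia) (by lia) (by lia) b y
    rw [hy, map_zero, smul_zero, add_zero] at h₁
    rw [map_units_smul (Y.d rfl), h₁]
    have h₂ := congrArg (fun t => t y) (map_units_smul
      (Y.smul (show q + 1 + i + q₀ = q + 1 by lia)) i.negOnePow (A.dGr (by lia) b))
    refine (congrArg _ h₂).trans ((smul_smul _ _ _).trans ?_)
    rw [← Int.negOnePow_add, show (q + 1 + i) * i + i = (q + i) * i + (i + i) by ring,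
      Int.negOnePow_add, Int.negOnePow_add, Int.units_mul_self, mul_one]
  map_smul {p q n} h a (b : A.gr (q + i)) := by
    change ((n + i) * i).negOnePow • Y.smul _
      ((p * i).negOnePow • A.mulGr (show p + (q + i) = n + i by lia) a b) y =
      Y.smul h a (((q + i) * i).negOnePow • Y.smul _ b y)
    have h₁ := Y.mul_smul (show p + (q + i) = n + i by lia) (show n + i + q₀ = n by lia)
      (show q + i + q₀ = q by lia) h a b y
    rw [map_units_smul (Y.smul h a), ← h₁]
    have h₂ := congrArg (fun t => t y) (map_units_smul
      (Y.smul (show n + i + q₀ = n by lia)) (p * i).negOnePow (A.mulGr (by lia) a b))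
    refine (congrArg _ h₂).trans ((smul_smul _ _ _).trans ?_)
    subst h
    rw [← Int.negOnePow_add, show (p + q + i) * i + p * i = (q + i) * i + (p * i + p * i) by ring,
      Int.negOnePow_add, Int.negOnePow_add (p * i), Int.units_mul_self, mul_one]

lemma freeMap_f {i q₀ : ℤ} (hi : q₀ + i = 0) {Y : DGMod A} (y : Y.X q₀) (hy : Y.d rfl y = 0)
    (q : ℤ) (b : A.gr (q + i)) : Hom.f (freeMap hi y hy) q b =
      ((q + i) * i).negOnePow • Y.smul (show (q + i) + q₀ = q by lia) b y := rfl

lemma freeMap_gen {i q₀ : ℤ} (hi : q₀ + i = 0) {Y : DGMod A} (y : Y.X q₀) (hy : Y.d rfl y = 0) :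
    Hom.f (freeMap hi y hy) q₀ (gen A hi) = y := by
  refine (freeMap_f hi y hy q₀ (gen A hi)).trans ?_
  have := Y.smul_of_eq_one hi (show q₀ + i + q₀ = q₀ by lia) (gen A hi) rfl y
  rw [cast_rfl] at this
  refine (congrArg _ this).trans ?_
  rw [hi]
  simp

/-- An element of `Σ^i A` is a multiple of the generator. -/
lemma free_eq_smul_gen {i q₀ : ℤ} (hi : q₀ + i = 0) (q : ℤ) (b : A.gr (q + i)) :
    (show (free A i).X q from b) = ((q + i) * i).negOnePow •
      (free A i).smul (show (q + i) + q₀ = q by lia) b (gen A hi) := by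
  have h₁ := shift_smul i (self A) (show (q + i) + q₀ = q by lia) b (gen A hi)
  refine Eq.trans ?_ (congrArg _ h₁).symm
  refine Eq.trans ?_ (smul_smul _ _ _).symm
  rw [Int.units_mul_self]
  refine Eq.trans ?_ (_root_.one_smul _ _).symm
  exact Subtype.ext (mul_one b.1).symm

lemma free_hom_ext {i q₀ : ℤ} (hi : q₀ + i = 0) {Y : DGMod A} {f g : free A i ⟶ Y}
    (h : Hom.f f q₀ (gen A hi) = Hom.f g q₀ (gen A hi)) : f = g := by
  ext q b
  have h₁ (f : free A i ⟶ Y) : Hom.f f q b = ((q + i) * i).negOnePow •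
      Y.smul (show (q + i) + q₀ = q by lia) (show A.gr (q + i) from b)
        (Hom.f f q₀ (gen A hi)) :=
    (congrArg _ (free_eq_smul_gen hi q b)).trans ((map_units_smul (Hom.f f q) _ _).trans
      (congrArg _ (Hom.map_smul f _ _ _)))
  rw [h₁ f, h₁ g, h]

/-- A morphism `Σ^i A ⟶ Y` that sends the generator to a coboundary is null homotopic. -/
def freeNullHomotopy {i q₀ q₁ : ℤ} (hi : q₀ + i = 0) {Y : DGMod A} {f : free A i ⟶ Y}
    (hq : q₁ + 1 = q₀) (m : Y.X q₁) (hm : Y.d hq m = Hom.f f q₀ (gen A hi)) :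
    NullHomotopy f where
  -- Compared with `freeMap` there is an extra `(-1)^(q + i)`, from moving a map of degree `-1` past
  -- an element of degree `q + i`.
  s {q q'} h := ((q + i) * (i + 1)).negOnePow • (Y.smul (show (q + i) + q₁ = q' by lia)).flip m
  comm {q q' q''} h h' (b : A.gr (q + i)) := by
    subst h h'
    have h₀ : Y.d rfl (Y.d hq m) = 0 := Y.d_d _ _ _
    obtain rfl : f = freeMap hi (Y.d hq m) h₀ :=
      free_hom_ext hi (by rw [freeMap_gen, hm])
    change ((q' + 1 + i) * i).negOnePow • Y.smul _ b (Y.d hq m) =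
      Y.d rfl (((q' + 1 + i) * (i + 1)).negOnePow • Y.smul _ b m) +
        ((q' + 1 + 1 + i) * (i + 1)).negOnePow • Y.smul _
          (i.negOnePow • A.dGr (show q' + 1 + i + 1 = q' + 1 + 1 + i by lia) b) m
    have h₁ := Y.leibniz (show q' + 1 + i + 1 = q' + 1 + 1 + i by lia) hq
      (rfl : q' + 1 = q' + 1) (by lia) (by lia) (by lia) b m
    rw [map_units_smul (Y.d rfl), h₁]
    have h₂ := congrArg (fun t => t m) (map_units_smul
      (Y.smul (show q' + 1 + 1 + i + q₁ = q' + 1 by lia)) i.negOnePow (A.dGr (by lia) b))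
    refine Eq.trans ?_ (congrArg _ (congrArg _ h₂)).symm
    refine Eq.trans ?_ (congrArg _ (smul_smul _ _ _)).symm
    rw [smul_add, smul_smul, ← Int.negOnePow_add, ← Int.negOnePow_add,
      show (q' + 1 + i) * (i + 1) + (q' + 1 + i) = (q' + 1 + i) * i + ((q' + 1 + i) + (q' + 1 + i))
        by ring,
      show (q' + 1 + 1 + i) * (i + 1) + i = (q' + 1 + i) * (i + 1) + (i + i) + 1 by ring,
      Int.negOnePow_add ((q' + 1 + i) * i), Int.negOnePow_add (q' + 1 + i), Int.units_mul_self,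
      Int.negOnePow_add _ 1, Int.negOnePow_add _ (i + i), Int.negOnePow_add i i,
      Int.units_mul_self, Int.negOnePow_one, mul_one, mul_one, mul_neg, mul_one, Units.neg_smul]
    abel
  map_smul {p q q' n n'} hq' hn h h' a (b : A.gr (q + i)) := by
    change ((n + i) * (i + 1)).negOnePow • Y.smul _
      ((p * i).negOnePow • A.mulGr (show p + (q + i) = n + i by lia) a b) m =
      p.negOnePow • Y.smul h' a (((q + i) * (i + 1)).negOnePow • Y.smul _ b m)
    have h₁ := Y.mul_smul (show p + (q + i) = n + i by lia) (show n + i + q₁ = n' by lia)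
      (show q + i + q₁ = q' by lia) h' a b m
    rw [map_units_smul (Y.smul h' a), ← h₁]
    have h₂ := congrArg (fun t => t m) (map_units_smul
      (Y.smul (show n + i + q₁ = n' by lia)) (p * i).negOnePow (A.mulGr (by lia) a b))
    refine (congrArg _ h₂).trans ((smul_smul _ _ _).trans ?_)
    subst h
    rw [smul_smul, ← Int.negOnePow_add, ← Int.negOnePow_add,
      show (p + q + i) * (i + 1) + p * i = p + (q + i) * (i + 1) + (p * i + p * i) by ring,
      Int.negOnePow_add _ (p * i + p * i), Int.negOnePow_add (p * i), Int.units_mul_self, mul_one]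

lemma freeNullHomotopy_gen {i q₀ q₁ : ℤ} (hi : q₀ + i = 0) {Y : DGMod A} {f : free A i ⟶ Y}
    (hq : q₁ + 1 = q₀) (m : Y.X q₁) (hm : Y.d hq m = Hom.f f q₀ (gen A hi)) :
    (freeNullHomotopy hi hq m hm).s hq (gen A hi) = m := by
  change ((q₀ + i) * (i + 1)).negOnePow • Y.smul _ (gen A hi) m = m
  have := Y.smul_of_eq_one hi (show q₀ + i + q₁ = q₁ by lia) (gen A hi) rfl m
  rw [cast_rfl] at this
  refine (congrArg _ this).trans ?_
  rw [hi]
  simp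

lemma nonempty_nullHomotopy_free {i q₀ : ℤ} (hi : q₀ + i = 0) {Y : DGMod A} {f : free A i ⟶ Y}
    (h : Hom.f f q₀ (gen A hi) ∈ Y.coboundaries q₀) : Nonempty (NullHomotopy f) := by
  obtain ⟨q₁, hq, m, hm⟩ := mem_coboundaries.1 h
  exact ⟨freeNullHomotopy hi hq m hm⟩

end DGMod

namespace DerivedCat

open DGMod

variable {A : DGAlg k}

/-! ### Coproducts in the derived category -/

section

variable {J : Type u} (N : J → DGMod A)

lemma exists_dsum_desc {Z : DerivedCat A} (g : ∀ j, (Q A).obj (N j) ⟶ Z) :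
    ∃ y : (Q A).obj (dsum N) ⟶ Z, ∀ j, (Q A).map (dsumι N j) ≫ y = g j := by
  obtain ⟨Z, rfl⟩ := Q_obj_surjective Z
  choose N' s f hs h using fun j => exists_right_fraction (g j)
  have := isIso_Q_map (quasiIso_dsum s hs)
  refine ⟨inv ((Q A).map (dsumDesc fun j => s j ≫ dsumι N j)) ≫ (Q A).map (dsumDesc f),
    fun j => ?_⟩
  have := isIso_Q_map (hs j)
  rw [← cancel_epi ((Q A).map (s j)), h j, ← Functor.map_comp_assoc,
    ← dsumι_desc (fun j => s j ≫ dsumι N j) j, Functor.map_comp_assoc, IsIso.hom_inv_id_assoc,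
    ← Functor.map_comp, dsumι_desc]

variable {N}

/-- Each component of a numerator of `y` is contractible after some quasi-isomorphism `t j`. The
direct sum of the `t j` is again a quasi-isomorphism, and the contractions assemble over it. -/
lemma dsum_eq_zero {Z : DerivedCat A} (y : (Q A).obj (dsum N) ⟶ Z)
    (h : ∀ j, (Q A).map (dsumι N j) ≫ y = 0) : y = 0 := by
  obtain ⟨Z, rfl⟩ := Q_obj_surjective Z
  obtain ⟨Z', g, s, hs, hg⟩ := exists_left_fraction y
  have := isIso_Q_map hs
  have h₀ (j : J) : (Q A).map (dsumι N j ≫ g) = 0 := by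
    rw [Functor.map_comp, ← hg, ← Category.assoc, h, zero_comp]
  choose N' t ht n using fun j => exists_precomp_null (h₀ j)
  have := isIso_Q_map (quasiIso_dsum t ht)
  rw [← cancel_mono ((Q A).map s), zero_comp, hg,
    ← cancel_epi ((Q A).map (dsumDesc fun j => t j ≫ dsumι N j)), comp_zero, ← Functor.map_comp]
  refine Q_map_eq_zero (NullHomotopy.dsum fun j => (n j).some.ofEq ?_)
  rw [← Category.assoc (dsumι N' j), dsumι_desc, Category.assoc]

variable (N) in
/-- Direct sums are coproducts in the derived category. -/
def isColimitDsum : IsColimit (Cofan.mk ((Q A).obj (dsum N)) (fun j => (Q A).map (dsumι N j))) :=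
  Cofan.IsColimit.mk _ (fun s => (exists_dsum_desc N s.inj).choose)
    (fun s => (exists_dsum_desc N s.inj).choose_spec)
    (fun s m hm => by
      rw [← sub_eq_zero]
      refine dsum_eq_zero _ fun j => ?_
      rw [Preadditive.comp_sub, (exists_dsum_desc N s.inj).choose_spec, sub_eq_zero]
      exact hm j)

/-! ### Small objects -/

variable (N) in
/-- The morphisms to a direct sum that are finite sums of morphisms through the summands. -/
def finiteMaps (M : DerivedCat A) : AddSubgroup (M ⟶ (Q A).obj (dsum N)) :=
  AddSubgroup.closure {f | ∃ (j : J) (g : M ⟶ (Q A).obj (N j)), f = g ≫ (Q A).map (dsumι N j)}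

lemma comp_ι_mem_finiteMaps {M : DerivedCat A} (j : J) (g : M ⟶ (Q A).obj (N j)) :
    g ≫ (Q A).map (dsumι N j) ∈ finiteMaps N M :=
  AddSubgroup.subset_closure ⟨j, g, rfl⟩

lemma comp_mem_finiteMaps {M M' : DerivedCat A} (p : M' ⟶ M) {f : M ⟶ (Q A).obj (dsum N)}
    (hf : f ∈ finiteMaps N M) : p ≫ f ∈ finiteMaps N M' := by
  induction hf using AddSubgroup.closure_induction with
  | mem f h =>
    obtain ⟨j, g, rfl⟩ := h
    rw [← Category.assoc]
    exact comp_ι_mem_finiteMaps j _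
  | zero => rw [comp_zero]; exact zero_mem _
  | add f g _ _ hf hg => rw [Preadditive.comp_add]; exact add_mem hf hg
  | neg f _ hf => rw [Preadditive.comp_neg]; exact neg_mem hf

/-- Allowing every larger index set `F'` makes the statement stable under sums, since two index sets
can be replaced by their union. -/
lemma exists_eq_sum_of_mem_finiteMaps {M : DerivedCat A} {f : M ⟶ (Q A).obj (dsum N)}
    (hf : f ∈ finiteMaps N M) : ∃ F : Finset J, ∀ F', F ⊆ F' →
      f = ∑ j ∈ F', (f ≫ (Q A).map (dsumπ N j)) ≫ (Q A).map (dsumι N j) := by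
  classical
  induction hf using AddSubgroup.closure_induction with
  | mem f h =>
    obtain ⟨j, g, rfl⟩ := h
    refine ⟨{j}, fun F' hF' => ?_⟩
    rw [Finset.sum_eq_single_of_mem j (hF' (Finset.mem_singleton_self j))]
    · rw [Category.assoc g, ← Functor.map_comp, dsumι_π_same]
      simp
    · intro i _ hi
      rw [Category.assoc g, ← Functor.map_comp, dsumι_π_ne N hi.symm]
      simp
  | zero => exact ⟨∅, fun F' _ => by simp⟩
  | add f g _ _ hf hg =>
    obtain ⟨F, hF⟩ := hf
    obtain ⟨G, hG⟩ := hg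
    refine ⟨F ∪ G, fun F' hF' => ?_⟩
    simp only [Preadditive.add_comp, Finset.sum_add_distrib]
    rw [← hF F' (Finset.union_subset_left hF'), ← hG F' (Finset.union_subset_right hF')]
  | neg f _ hf =>
    obtain ⟨F, hF⟩ := hf
    refine ⟨F, fun G hG => ?_⟩
    simp only [Preadditive.neg_comp, Finset.sum_neg_distrib]
    rw [← hF G hG]

end

/-- The objects `M` such that every morphism from `M` to a direct sum is a finite sum of morphisms
through the summands. -/
def IsSmall (M : DerivedCat A) : Prop :=
  ∀ (J : Type u) (N : J → DGMod A) (f : M ⟶ (Q A).obj (dsum N)), f ∈ finiteMaps N M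

lemma IsSmall.of_retract {M M' : DerivedCat A} (h : IsSmall M') (i : M ⟶ M') (r : M' ⟶ M)
    (hi : i ≫ r = 𝟙 M) : IsSmall M := fun J N f => by
  have := comp_mem_finiteMaps i (h J N (r ≫ f))
  rwa [← Category.assoc, hi, Category.id_comp] at this

lemma isSmall_of_isZero {M : DerivedCat A} (h : IsZero M) : IsSmall M := fun J N f => by
  rw [h.eq_of_src f 0]; exact zero_mem _

lemma IsSmall.bicone {M M' : DerivedCat A} (h : IsSmall M) (h' : IsSmall M')
    (b : BinaryBicone M M') (hb : b.IsBilimit) : IsSmall b.pt := fun J N f => by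
  rw [← Category.id_comp f, ← IsBilimit.binary_total hb, Preadditive.add_comp, Category.assoc,
    Category.assoc]
  exact add_mem (comp_mem_finiteMaps _ (h J N _)) (comp_mem_finiteMaps _ (h' J N _))

/-- On `L` the morphism `x` has finitely many components. Subtracting those components of `x` itself
leaves a morphism that vanishes on `L`, hence factors through the small object `N`. -/
lemma IsExactTriangle.isSmall {L M N : DerivedCat A} {f : L ⟶ M} {g : M ⟶ N}
    {h : N ⟶ (shift A 1).obj L} (T : IsExactTriangle f g h) (hL : IsSmall L) (hN : IsSmall N) :
    IsSmall M := fun J P x => by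
  obtain ⟨F, hF⟩ := exists_eq_sum_of_mem_finiteMaps (hL J P (f ≫ x))
  let x' := ∑ j ∈ F, (x ≫ (Q A).map (dsumπ P j)) ≫ (Q A).map (dsumι P j)
  obtain ⟨y, hy⟩ := T.exists_desc (x - x') (by
    rw [Preadditive.comp_sub, sub_eq_zero, Preadditive.comp_sum]
    simpa using hF F (Finset.Subset.refl F))
  rw [← sub_add_cancel x x', ← hy]
  exact add_mem (comp_mem_finiteMaps _ (hN J P y))
    (sum_mem fun j _ => comp_ι_mem_finiteMaps j _)

/-- Every morphism from `Σ^i A` in the derived category comes from a DG morphism. -/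
lemma exists_eq_Q_map_free {i : ℤ} {Y : DGMod A} (f : (Q A).obj (free A i) ⟶ (Q A).obj Y) :
    ∃ g : free A i ⟶ Y, f = (Q A).map g := by
  obtain ⟨Y', g, s, hs, h⟩ := exists_left_fraction f
  have hi : -i + i = 0 := by lia
  have := isIso_Q_map hs
  have hc : Y'.d rfl (Hom.f g _ (gen A hi)) = 0 := by rw [← Hom.comm, d_gen, map_zero]
  obtain ⟨y, hy, hb⟩ := hs.exists_cocycle hc
  refine ⟨freeMap hi y hy, ?_⟩
  rw [← cancel_mono ((Q A).map s), h, eq_comm, ← sub_eq_zero, ← Functor.map_comp,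
    ← Functor.map_sub]
  have hgen : Hom.f (freeMap hi y hy ≫ s - g) (-i) (gen A hi) ∈ Y'.coboundaries (-i) := by
    rw [sub_eq_add_neg, add_f, neg_f, comp_f, freeMap_gen, ← sub_eq_add_neg]
    exact hb
  exact Q_map_eq_zero (nonempty_nullHomotopy_free hi hgen).some

lemma isSmall_free (i : ℤ) : IsSmall ((Q A).obj (free A i)) := fun J N f => by
  classical
  obtain ⟨g, rfl⟩ := exists_eq_Q_map_free f
  have hi : -i + i = 0 := by lia
  let x : Π₀ j, (N j).X (-i) := Hom.f g (-i) (gen A hi)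
  -- A morphism out of `Σ^i A` is determined by the image of the generator, and that image is
  -- finitely supported.
  have hg : g = ∑ j ∈ x.support, (g ≫ dsumπ N j) ≫ dsumι N j := by
    refine free_hom_ext hi ?_
    let ev : (free A i ⟶ dsum N) →+ (dsum N).X (-i) :=
      AddMonoidHom.mk' (fun φ => Hom.f φ (-i) (gen A hi)) (fun _ _ => rfl)
    change x = ev _
    rw [map_sum]
    exact (DFinsupp.sum_single (f := x)).symm
  rw [hg, Functor.map_sum]
  refine sum_mem fun j _ => ?_
  rw [Functor.map_comp]
  exact comp_ι_mem_finiteMaps j _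

/-! ### Compact objects -/

/-- The quotient of the colimit by the subgroup generated by the images of the legs receives zero
from every leg, so the quotient map is zero. -/
lemma closure_eq_top_of_isColimit {J : Type u} {F : Discrete J ⥤ AddCommGrpCat.{u + 1}}
    (c : Cocone F) (hc : IsColimit c) :
    AddSubgroup.closure {x : c.pt | ∃ (j : Discrete J) (y : F.obj j), x = c.ι.app j y} = ⊤ := by
  let S := AddSubgroup.closure {x : c.pt | ∃ (j : Discrete J) (y : F.obj j), x = c.ι.app j y}
  have h : AddCommGrpCat.ofHom (QuotientAddGroup.mk' S) = 0 := hc.hom_ext fun j => by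
    ext y
    exact (QuotientAddGroup.eq_zero_iff _).2 (AddSubgroup.subset_closure ⟨j, y, rfl⟩)
  refine (AddSubgroup.eq_top_iff' _).2 fun x => (QuotientAddGroup.eq_zero_iff (N := S) x).1 ?_
  exact congrArg (fun f => f.hom x) h

lemma IsSmall.of_compact {M : DerivedCat A} (hM : compact A M) : IsSmall M := fun J N f => by
  have := hM J
  have h := closure_eq_top_of_isColimit _ (isColimitOfPreserves
    (preadditiveCoyoneda.obj (Opposite.op M)) (isColimitDsum N))
  have hf : f ∈ (⊤ : AddSubgroup (M ⟶ (Q A).obj (dsum N))) := trivial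
  refine AddSubgroup.closure_mono ?_ (h.symm ▸ hf)
  rintro _ ⟨⟨j⟩, y, rfl⟩
  exact ⟨j, y, rfl⟩

/-- A morphism from a small object to a direct sum has finitely many nonzero components and is their
sum. The descent map of a cocone is therefore a finite sum over components, and it is unique. -/
lemma IsSmall.compact {M : DerivedCat A} (hM : IsSmall M) : compact A M := fun J => by
  refine @preservesColimitsOfShape_of_discrete _ _ _ _ _ _ fun X => ?_
  choose N hN using fun j => Q_obj_surjective (X j)
  obtain rfl : (fun j => (Q A).obj (N j)) = X := funext hN
  refine preservesColimit_of_preserves_colimit_cocone (isColimitDsum N) ?_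
  have hfin (f : M ⟶ (Q A).obj (dsum N)) : ∃ F : Finset J, ∀ j ∉ F,
      f ≫ (Q A).map (dsumπ N j) = 0 := by
    obtain ⟨F, hF⟩ := exists_eq_sum_of_mem_finiteMaps (hM J N f)
    refine ⟨F, fun j hj => ?_⟩
    rw [hF F (Finset.Subset.refl F), Preadditive.sum_comp]
    refine Finset.sum_eq_zero fun i hi => ?_
    have hij : i ≠ j := fun h => hj (h ▸ hi)
    rw [Category.assoc _ ((Q A).map (dsumι N i)), ← Functor.map_comp, dsumι_π_ne N hij]
    simp
  let e (s : Cocone (Discrete.functor (fun j => (Q A).obj (N j)) ⋙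
      preadditiveCoyoneda.obj (Opposite.op M))) (j : J) : (M ⟶ (Q A).obj (N j)) →+ s.pt :=
    (s.ι.app ⟨j⟩).hom
  have hsupp (s) (f : M ⟶ (Q A).obj (dsum N)) :
      (Function.support fun j => e s j (f ≫ (Q A).map (dsumπ N j))).Finite := by
    obtain ⟨F, hF⟩ := hfin f
    refine F.finite_toSet.subset fun j hj => ?_
    by_contra h
    exact hj ((congrArg (e s j) (hF j h)).trans (map_zero _))
  let d (s : Cocone (Discrete.functor (fun j => (Q A).obj (N j)) ⋙
      preadditiveCoyoneda.obj (Opposite.op M))) : (M ⟶ (Q A).obj (dsum N)) →+ s.pt :=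
    AddMonoidHom.mk' (fun f => ∑ᶠ j, e s j (f ≫ (Q A).map (dsumπ N j))) (fun f g => by
      rw [← finsum_add_distrib (hsupp s f) (hsupp s g)]
      simp only [Preadditive.add_comp, map_add])
  have hd (s) (j : J) (g : M ⟶ (Q A).obj (N j)) :
      d s (g ≫ (Q A).map (dsumι N j)) = e s j g := by
    change ∑ᶠ i, e s i ((g ≫ (Q A).map (dsumι N j)) ≫ (Q A).map (dsumπ N i)) = _
    rw [finsum_eq_single _ j]
    · rw [Category.assoc, ← Functor.map_comp, dsumι_π_same]
      simp
    · intro i hi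
      rw [Category.assoc, ← Functor.map_comp, dsumι_π_ne N hi.symm]
      simp
  exact
    { desc := fun s => AddCommGrpCat.ofHom (d s)
      fac := fun s ⟨j⟩ => by
        ext g
        exact hd s j g
      uniq := fun s m hm => by
        ext f
        change m.hom f = d s f
        induction hM J N f using AddSubgroup.closure_induction with
        | mem f h =>
          obtain ⟨j, g, rfl⟩ := h
          rw [hd]
          exact congrArg (fun t => t.hom g) (hm ⟨j⟩)
        | zero => exact (map_zero m.hom).trans (map_zero (d s)).symm
        | add f g _ _ hf hg =>
          exact (map_add m.hom f g).trans ((congrArg₂ _ hf hg).trans (map_add (d s) f g).symm)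
        | neg f _ hf =>
          exact (map_neg m.hom f).trans ((congrArg _ hf).trans (map_neg (d s) f).symm) }

end DerivedCat

/-! ### Semifree DG modules -/

namespace DGMod

variable {A : DGAlg k}

instance (i : ℤ) : (shiftFun A i).Additive where
  map_add := rfl

/-- The DG modules built from zero by taking `n` times the cone of a morphism out of a direct sum
of suspensions of `A`. -/
inductive IsSemifree : ℕ → DGMod A → Prop
  | zero : IsSemifree 0 (zero A)
  | cone {n : ℕ} {F : DGMod A} {J : Type u} (i : J → ℤ)
      (ψ : dsum (fun j => free A (i j)) ⟶ F) : IsSemifree n F → IsSemifree (n + 1) (cone ψ)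

/-! ### Killing the cohomology of a cone -/

section killing

variable {F M : DGMod A} (p : F ⟶ M)

/-- The cocycles of the cone of `p`, up to sign. -/
def ConeCocycle : Type u :=
  Σ q : ℤ, {w : F.X (q + 1) × M.X q // F.d rfl w.1 = 0 ∧ M.d rfl w.2 = Hom.f p (q + 1) w.1}

/-- The morphism from a free DG module to `F` given by the cocycles of the cone of `p`. -/
def killMap : dsum (fun e : ConeCocycle p => free A (-(e.1 + 1))) ⟶ F :=
  dsumDesc (fun e => freeMap (add_neg_cancel (e.1 + 1)) e.2.1.1 e.2.2.1)

/-- The null homotopy of `killMap p ≫ p`. -/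
def killNullHomotopy : NullHomotopy (killMap p ≫ p) :=
  NullHomotopy.dsum fun e => (freeNullHomotopy (f := freeMap (add_neg_cancel (e.1 + 1)) e.2.1.1
    e.2.2.1 ≫ p) (add_neg_cancel (e.1 + 1)) rfl e.2.1.2
    (by rw [comp_f, freeMap_gen, e.2.2.2])).ofEq
      (by rw [killMap, ← Category.assoc, dsumι_desc])

lemma killNullHomotopy_gen (e : ConeCocycle p) :
    (killNullHomotopy p).s (rfl : e.1 + 1 = e.1 + 1) (Hom.f (dsumι _ e) (e.1 + 1)
      (gen A (add_neg_cancel (e.1 + 1)))) = e.2.1.2 := by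
  rw [killNullHomotopy, NullHomotopy.dsum_s_ι]
  have : ∀ {X Y : DGMod A} {f g : X ⟶ Y} (s : NullHomotopy f) (h : f = g) {q q' : ℤ}
      (e : q' + 1 = q) (x : X.X q), (s.ofEq h).s e x = s.s e x := by
    rintro X Y f _ s rfl q q' e x; rfl
  rw [this, freeNullHomotopy_gen]

/-- The extension of `p` to the cone of `killMap p`. -/
def killExt : cone (killMap p) ⟶ M := coneDesc (killMap p) p (killNullHomotopy p)

/-- The map from the cone of `p` to the cone of its extension. -/
def killCone : cone p ⟶ cone (killExt p) :=
  coneMap p (killExt p) (coneInl _) (𝟙 M) (by rw [killExt, coneInl_coneDesc, Category.comp_id])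

lemma coneInl_killCone : coneInl p ≫ killCone p = coneInl (killExt p) := by
  rw [killCone, coneInl_coneMap, Category.id_comp]

/-- Every cocycle of `Cone p` indexes a cell of `killMap p`, and the generator of that cell bounds
its image. -/
lemma cohomology_killCone (q : ℤ) : (cohomology A q).map (killCone p) = 0 := by
  refine (HMap_eq_zero_iff _ _).2 fun z hz => ?_
  obtain ⟨q, rfl⟩ : ∃ r, q = r + 1 := ⟨q - 1, by lia⟩
  obtain ⟨h₁, h₂⟩ := cone_d_eq_zero.1 hz
  -- A cocycle of the cone satisfies `d z.1 + p z.2 = 0`, whereas `ConeCocycle` asks for `d w.2 = p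
  -- w.1`; hence the sign.
  let e : ConeCocycle p := ⟨q + 1, (-z.2, z.1), by rw [map_neg, h₂, neg_zero], by
    rw [map_neg]; exact eq_neg_of_add_eq_zero_left h₁⟩
  let g : (dsum (fun e : ConeCocycle p => free A (-(e.1 + 1)))).X (q + 1 + 1) :=
    Hom.f (dsumι _ e) (q + 1 + 1) (gen A (add_neg_cancel (q + 1 + 1)))
  refine cone_mem_coboundaries.2 ⟨0, ((0, g) : F.X (q + 1) × _), ?_, ?_⟩
  · change M.d rfl 0 + (Hom.f p _ 0 + (killNullHomotopy p).s rfl g) = z.1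
    rw [map_zero, map_zero, zero_add, zero_add]
    exact killNullHomotopy_gen p e
  · have h₃ : Hom.f (killMap p) _ g = -z.2 := by
      refine (dsumι_f_desc _ e _ _).trans (freeMap_gen _ _ _)
    have h₄ : DGMod.d _ (rfl : q + 1 + 1 + 1 = _) g = 0 := by
      rw [← Hom.comm, d_gen, map_zero]
    refine Prod.ext ?_ ?_
    · change -(F.d rfl 0 + Hom.f (killMap p) _ g) = z.2
      rw [h₃, map_zero, zero_add, neg_neg]
    · change - -DGMod.d _ rfl g = 0
      rw [h₄, neg_zero, neg_zero]

end killing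

end DGMod

namespace DerivedCat

open DGMod

variable {A : DGAlg k}

/-! ### Suspensions -/

/-- Two parallel morphisms are DG morphisms precomposed with a common `s`, which reduces additivity
to that of `shiftFun`. -/
instance (i : ℤ) : (shift A i).Additive where
  map_add {X Y f g} := by
    obtain ⟨Y, rfl⟩ := Q_obj_surjective Y
    obtain ⟨L, s, u, v, rfl, rfl⟩ := exists_rep₂ f g
    have h (w : L ⟶ Y) : (shift A i).map ((Q A).map w) = (shiftIso A i).hom.app L ≫
        (Q A).map ((shiftFun A i).map w) ≫ (shiftIso A i).inv.app Y := by
      rw [← cancel_mono ((shiftIso A i).hom.app Y), Category.assoc, Category.assoc,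
        Iso.inv_hom_id_app]
      exact ((shiftIso A i).hom.naturality w).trans
        (congrArg (_ ≫ ·) (Category.comp_id _).symm)
    rw [← Preadditive.comp_add, ← Functor.map_add, Functor.map_comp, Functor.map_comp,
      Functor.map_comp, h, h, h, Functor.map_add, Functor.map_add]
    simp only [Preadditive.add_comp, Preadditive.comp_add]

/-- An additive functor preserves binary biproducts. -/
def isBilimitMap {C D : Type*} [Category* C] [Category* D] [Preadditive C] [Preadditive D]
    (F : C ⥤ D) [F.Additive] {M N : C} (b : BinaryBicone M N)
    (hb : b.fst ≫ b.inl + b.snd ≫ b.inr = 𝟙 b.pt) : (F.mapBinaryBicone b).IsBilimit :=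
  isBinaryBilimitOfTotal _ (by
    change F.map b.fst ≫ F.map b.inl + F.map b.snd ≫ F.map b.inr = 𝟙 (F.obj b.pt)
    rw [← Functor.map_comp, ← Functor.map_comp, ← Functor.map_add, hb,
      CategoryTheory.Functor.map_id])

/-- The class whose only member is `A`. -/
abbrev selfProp (A : DGAlg k) : ObjectProperty (DerivedCat A) :=
  fun M => M = (Q A).obj (DGMod.self A)

/-- A class of objects closed under isomorphisms and finite direct sums that contains the
suspensions of `A` contains the closure of `A` under these operations. -/
lemma addCl_induction {P : ObjectProperty (DerivedCat A)}
    (hiso : ∀ M N : DerivedCat A, (M ≅ N) → P M → P N) (hzero : ∀ M, IsZero M → P M)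
    (hsum : ∀ (M N : DerivedCat A) (b : BinaryBicone M N), b.IsBilimit → P M → P N → P b.pt)
    (hfree : ∀ i, P ((Q A).obj (free A i))) {M : DerivedCat A} (hM : addCl (selfProp A) M) :
    P M := by
  -- Stability of `P` under suspension is not assumed, so the induction carries all suspensions at
  -- once; `i = 0` gives `M` back.
  have key : ∀ i, P ((shift A i).obj M) := by
    induction hM with
    | of M h =>
      subst h
      exact fun i => hiso _ _ ((shiftIso A i).app _).symm (hfree i)
    | iso M N e _ ih => exact fun i => hiso _ _ ((shift A i).mapIso e) (ih i)
    | zero M h => exact fun i => hzero _ ((shift A i).map_isZero h)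
    | sum M N b hb _ _ ih ih' =>
      exact fun i => hsum _ _ _ (isBilimitMap (shift A i) b (IsBilimit.binary_total hb))
        (ih i) (ih' i)
    | shift M j _ ih =>
      intro i
      obtain ⟨M, rfl⟩ := Q_obj_surjective M
      refine hiso _ _ ?_ (ih (i + j))
      exact (shiftIso A (i + j)).app M ≪≫ (Q A).mapIso (shiftShiftIso M j i _ rfl).symm ≪≫
        ((shiftIso A i).app _).symm ≪≫ (shift A i).mapIso ((shiftIso A j).app M).symm
  obtain ⟨M, rfl⟩ := Q_obj_surjective M
  exact hiso _ _ ((shiftIso A 0).app M ≪≫ (Q A).mapIso (shiftZeroIso M)) (key 0)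

/-! ### Properties of the classes `⟨A⟩_n` -/

lemma addCl_free (i : ℤ) : addCl (selfProp A) ((Q A).obj (free A i)) :=
  addCl.iso _ _ ((shiftIso A i).app (self A)) (addCl.shift _ i (addCl.of _ rfl))

/-- The closure `smd` is phrased with biproducts; complements of split monomorphisms make it closed
under arbitrary retracts. -/
lemma smd_of_retract {S : ObjectProperty (DerivedCat A)} {M G : DerivedCat A} (hG : smd S G)
    (i : M ⟶ G) (r : G ⟶ M) (hi : i ≫ r = 𝟙 M) : smd S M := by
  obtain ⟨N, b, ⟨hb⟩, rfl⟩ := exists_bicone_of_retract i r hi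
  exact smd.summand M N b hb hG

lemma thickSelf_of_retract {n : ℕ} {M G : DerivedCat A} (hG : thickSelf A n G) (i : M ⟶ G)
    (r : G ⟶ M) (hi : i ≫ r = 𝟙 M) : thickSelf A n M := by
  match n, hG with
  | 0, hG =>
    refine (IsZero.iff_id_eq_zero M).2 ?_
    rw [← hi, IsZero.eq_of_tgt hG i 0, zero_comp]
  | 1, hG => exact smd_of_retract hG i r hi
  | _ + 2, hG => exact smd_of_retract hG i r hi

/-- Only `n = 0` needs an argument, as `⟨A⟩_1` is not defined through triangles: with `L` zero, `M`
is a retract of `N`. -/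
lemma IsExactTriangle.thickSelf {n : ℕ} {L M N : DerivedCat A} {f : L ⟶ M} {g : M ⟶ N}
    {h : N ⟶ (shift A 1).obj L} (T : IsExactTriangle f g h) (hL : thickSelf A n L)
    (hN : thickSelf A 1 N) : thickSelf A (n + 1) M := by
  match n, hL with
  | 0, hL =>
    obtain ⟨r, hr⟩ := T.exists_desc (𝟙 M) (IsZero.eq_of_src hL _ _)
    exact thickSelf_of_retract hN g r hr
  | _ + 1, hL => exact smd.of _ ⟨L, N, f, g, h, hL, hN, T⟩

lemma thickSelf_one_of_isZero {M : DerivedCat A} (hM : IsZero M) : thickSelf A 1 M :=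
  smd.of _ (addCl.zero _ hM)

lemma thickSelf_succ {n : ℕ} {M : DerivedCat A} (hM : thickSelf A n M) :
    thickSelf A (n + 1) M := by
  obtain ⟨X, rfl⟩ := Q_obj_surjective M
  obtain ⟨h, T⟩ := exists_isExactTriangle (A := A) (f := (Q A).map (𝟙 X)) (𝟙 X) (Iso.refl _)
    (Iso.refl _) (Iso.refl _) (by simp) (g := (Q A).map (coneInl (𝟙 X))) (by simp)
  exact T.thickSelf hM (thickSelf_one_of_isZero
    (isZero_Q_obj (acyclic_cone (MorphismProperty.id_mem _ _))))

lemma thickSelf_mono {m n : ℕ} (h : m ≤ n) {M : DerivedCat A} (hM : thickSelf A m M) :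
    thickSelf A n M := by
  induction h with
  | refl => exact hM
  | step _ ih => exact thickSelf_succ ih

/-- Isomorphisms and direct summands are both retracts, so stability under retracts is all that has
to be checked. -/
lemma smd_induction {S P : ObjectProperty (DerivedCat A)} (hS : ∀ M, S M → P M)
    (hP : ∀ (M G : DerivedCat A) (i : M ⟶ G) (r : G ⟶ M), i ≫ r = 𝟙 M → P G → P M)
    {M : DerivedCat A} (hM : smd S M) : P M := by
  induction hM with
  | of M h => exact hS M h
  | iso M N e _ ih => exact hP _ _ e.inv e.hom e.inv_hom_id ih
  | summand M N b hb _ ih => exact hP _ _ b.inl b.fst b.inl_fst ih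

lemma isSmall_of_addCl {M : DerivedCat A} (hM : addCl (selfProp A) M) : IsSmall M :=
  addCl_induction (fun _ _ e h => h.of_retract e.inv e.hom e.inv_hom_id)
    (fun _ => isSmall_of_isZero) (fun _ _ b hb h h' => h.bicone h' b hb) isSmall_free hM

lemma isSmall_of_thickSelf {n : ℕ} {M : DerivedCat A} (hM : thickSelf A n M) : IsSmall M := by
  have hr (M G : DerivedCat A) (i : M ⟶ G) (r : G ⟶ M) (hi : i ≫ r = 𝟙 M) (h : IsSmall G) :
      IsSmall M := h.of_retract i r hi
  have h₁ (M : DerivedCat A) (hM : thickSelf A 1 M) : IsSmall M :=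
    smd_induction (fun _ => isSmall_of_addCl) hr hM
  induction n generalizing M with
  | zero => exact isSmall_of_isZero hM
  | succ n ih =>
    cases n with
    | zero => exact h₁ M hM
    | succ n =>
      refine smd_induction ?_ hr hM
      rintro M ⟨L, N, f, g, h, hL, hN, T⟩
      exact T.isSmall (ih hL) (h₁ N hN)

/-! ### The ghost lemma -/

lemma IsGhost.comp {L M N : DerivedCat A} (f : L ⟶ M) {g : M ⟶ N} (hg : IsGhost g) :
    IsGhost (f ≫ g) := fun q => by
  rw [Functor.map_comp, hg q, comp_zero]

lemma isGhost_Q_map_iff {M N : DGMod A} (φ : M ⟶ N) :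
    IsGhost ((Q A).map φ) ↔ ∀ q, (DGMod.cohomology A q).map φ = 0 := by
  refine forall_congr' fun q => ?_
  let e : Q A ⋙ cohomology A q ≅ DGMod.cohomology A q := Localization.fac _ _ _
  have h := e.hom.naturality φ
  constructor
  · intro h₀
    rw [← cancel_epi (e.hom.app M), ← h, Functor.comp_map, h₀, zero_comp, comp_zero]
  · intro h₀
    rw [← cancel_mono (e.hom.app N), zero_comp]
    refine Eq.trans h ?_
    rw [h₀, comp_zero]

/-- The composites of `n` ghosts out of `M` vanish. -/
def KillsGhosts (n : ℕ) (M : DerivedCat A) : Prop :=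
  ∀ (N : DerivedCat A) (f : M ⟶ N), IsGhostComposite n f → f = 0

lemma isGhostComposite_one_iff {M N : DerivedCat A} {f : M ⟶ N} :
    IsGhostComposite 1 f ↔ IsGhost f := by
  constructor
  · intro h
    cases h with
    | comp f g hf hg => exact hg.comp f
  · intro h
    have := IsGhostComposite.comp _ f (IsGhostComposite.id M) h
    rwa [Category.id_comp] at this

lemma IsGhostComposite.comp_left {n : ℕ} {L M N : DerivedCat A} (f : L ⟶ M) {g : M ⟶ N}
    (hg : IsGhostComposite (n + 1) g) : IsGhostComposite (n + 1) (f ≫ g) := by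
  induction n generalizing N with
  | zero => exact isGhostComposite_one_iff.2 ((isGhostComposite_one_iff.1 hg).comp f)
  | succ n ih =>
    cases hg with
    | comp g h hg hh =>
      rw [← Category.assoc]
      exact .comp _ _ (ih hg) hh

lemma KillsGhosts.of_retract {n : ℕ} {M G : DerivedCat A} (hG : KillsGhosts (n + 1) G)
    (i : M ⟶ G) (r : G ⟶ M) (hi : i ≫ r = 𝟙 M) : KillsGhosts (n + 1) M := fun N f hf => by
  rw [← Category.id_comp f, ← hi, Category.assoc, hG _ _ (hf.comp_left r), comp_zero]

lemma killsGhosts_of_addCl {M : DerivedCat A} (hM : addCl (selfProp A) M) : KillsGhosts 1 M := by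
  refine addCl_induction (fun _ _ e h => h.of_retract e.inv e.hom e.inv_hom_id)
    (fun M hM N f _ => hM.eq_of_src _ _) (fun M N b hb h h' P f hf => ?_) (fun i N f hf => ?_) hM
  · rw [← Category.id_comp f, ← IsBilimit.binary_total hb, Preadditive.add_comp, Category.assoc,
      Category.assoc, h _ _ (hf.comp_left b.inl), h' _ _ (hf.comp_left b.inr), comp_zero,
      comp_zero, add_zero]
  · obtain ⟨N, rfl⟩ := Q_obj_surjective N
    obtain ⟨g, rfl⟩ := exists_eq_Q_map_free f
    have h := (isGhost_Q_map_iff g).1 (isGhostComposite_one_iff.1 hf) (-i)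
    exact Q_map_eq_zero (nonempty_nullHomotopy_free (neg_add_cancel i)
      ((HMap_eq_zero_iff g _).1 h _ (d_gen _ _))).some

/-- All but the last ghost compose to a morphism that vanishes on `L`, hence factors through `N`,
where the last ghost kills it. -/
lemma IsExactTriangle.killsGhosts {n : ℕ} {L M N : DerivedCat A} {f : L ⟶ M} {g : M ⟶ N}
    {h : N ⟶ (shift A 1).obj L} (T : IsExactTriangle f g h) (hL : KillsGhosts (n + 1) L)
    (hN : KillsGhosts 1 N) : KillsGhosts (n + 2) M := fun P x hx => by
  cases hx with
  | comp x y hx hy =>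
    obtain ⟨z, rfl⟩ := T.exists_desc x (hL _ _ (hx.comp_left f))
    rw [Category.assoc, hN _ _ (isGhostComposite_one_iff.2 (hy.comp z)), comp_zero]

/-- The ghost lemma. -/
lemma killsGhosts_of_thickSelf {n : ℕ} {M : DerivedCat A} (hM : thickSelf A n M) :
    KillsGhosts n M := by
  have h₁ (M : DerivedCat A) (hM : thickSelf A 1 M) : KillsGhosts 1 M :=
    smd_induction (fun _ => killsGhosts_of_addCl) (fun _ _ i r hi h => h.of_retract i r hi) hM
  induction n generalizing M with
  | zero => exact fun N f _ => IsZero.eq_of_src hM _ _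
  | succ n ih =>
    cases n with
    | zero => exact h₁ M hM
    | succ n =>
      refine smd_induction ?_ (fun _ _ i r hi h => h.of_retract i r hi) hM
      rintro M ⟨L, N, f, g, h, hL, hN, T⟩
      exact T.killsGhosts (ih hL) (h₁ N hN)

/-! ### The converse of the ghost lemma for compact objects -/

/-- By `coneInl_killCone`, each attachment of cells prolongs `M ⟶ Cone p` by one ghost. The case `n
= 0` is excluded because `M ⟶ Cone 0` is only an isomorphism, while an empty composite has to be an
identity. -/
lemma exists_semifree (M : DGMod A) (n : ℕ) : ∃ (F : DGMod A) (p : F ⟶ M), IsSemifree n F ∧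
    (n ≠ 0 → IsGhostComposite n ((Q A).map (coneInl p))) := by
  induction n with
  | zero => exact ⟨_, 0, .zero, fun h => (h rfl).elim⟩
  | succ n ih =>
    obtain ⟨F, p, hF, hp⟩ := ih
    refine ⟨_, killExt p, hF.cone _ (killMap p), fun _ => ?_⟩
    have hg : IsGhost ((Q A).map (killCone p)) :=
      (isGhost_Q_map_iff _).2 (cohomology_killCone p)
    rw [← coneInl_killCone, Functor.map_comp]
    match n, hp with
    | 0, _ => exact isGhostComposite_one_iff.2 (hg.comp _)
    | n + 1, hp => exact .comp _ _ (hp (by simp)) hg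

lemma exists_factor_of_mem_finiteMaps {J : Type u} {N : J → DGMod A}
    (hN : ∀ j, addCl (selfProp A) ((Q A).obj (N j))) {X : DerivedCat A}
    {f : X ⟶ (Q A).obj (dsum N)} (hf : f ∈ finiteMaps N X) :
    ∃ (T : DerivedCat A) (u : X ⟶ T) (v : T ⟶ (Q A).obj (dsum N)),
      addCl (selfProp A) T ∧ u ≫ v = f := by
  induction hf using AddSubgroup.closure_induction with
  | mem f h =>
    obtain ⟨j, g, rfl⟩ := h
    exact ⟨_, g, (Q A).map (dsumι N j), hN j, rfl⟩
  | zero =>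
    exact ⟨(Q A).obj (DGMod.zero A), 0, 0, addCl.zero _ ((Q A).map_isZero (isZero_zero A)),
      by simp⟩
  | add f g _ _ hf hg =>
    obtain ⟨T, u, v, hT, rfl⟩ := hf
    obtain ⟨T', u', v', hT', rfl⟩ := hg
    obtain ⟨T, rfl⟩ := Q_obj_surjective T
    obtain ⟨T', rfl⟩ := Q_obj_surjective T'
    let b := (Q A).mapBinaryBicone (prodBicone T T')
    have hb : b.IsBilimit := isBilimitMap (Q A) (prodBicone T T') (by
      ext q x
      exact Prod.fst_add_snd x)
    refine ⟨b.pt, u ≫ b.inl + u' ≫ b.inr, b.fst ≫ v + b.snd ≫ v', addCl.sum _ _ b hb hT hT', ?_⟩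
    simp only [Preadditive.add_comp, Preadditive.comp_add, Category.assoc,
      BinaryBicone.inl_fst_assoc, BinaryBicone.inl_snd_assoc, BinaryBicone.inr_fst_assoc,
      BinaryBicone.inr_snd_assoc, zero_comp, comp_zero, add_zero, zero_add]
  | neg f _ hf =>
    obtain ⟨T, u, v, hT, rfl⟩ := hf
    exact ⟨T, u, -v, hT, by simp⟩

/-- A morphism from a small object to a semifree DG module of length `n` factors through an object
of `⟨A⟩_n`. -/
lemma exists_factor_of_isSemifree {n : ℕ} {Y : DGMod A} (hY : IsSemifree n Y) {X : DerivedCat A}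
    (hX : IsSmall X) (f : X ⟶ (Q A).obj Y) :
    ∃ (G : DerivedCat A) (a : X ⟶ G) (b : G ⟶ (Q A).obj Y), thickSelf A n G ∧ a ≫ b = f := by
  induction hY generalizing X with
  | zero => exact ⟨_, f, 𝟙 _, (Q A).map_isZero (isZero_zero A), by simp⟩
  | @cone n F J i ψ _ ih =>
    let e := (Q A).mapIso (shiftDsumIso (fun j => free A (i j)) 1)
    -- Smallness of `X` confines the map to the top layer of cells to a finite direct sum `T` of
    -- suspensions of `A`. The fibre `X'` of `X ⟶ T` is small again, and on it `f` lifts to the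
    -- lower layers `F`.
    obtain ⟨T, u, v, hT, huv⟩ := exists_factor_of_mem_finiteMaps
      (fun j => addCl.iso _ _ ((shiftIso A 1).app _) (addCl.shift _ 1 (addCl_free (i j))))
      (hX _ _ ((f ≫ (Q A).map (coneSnd ψ)) ≫ e.hom))
    obtain ⟨X', i', j, ⟨h₁, T₁⟩, ⟨h₂, T₂⟩⟩ := exists_fibre u
    have hX' : IsSmall X' := T₁.isSmall (isSmall_of_addCl (addCl.shift _ _ hT)) hX
    obtain ⟨t, T₃⟩ := exists_isExactTriangle_of_shortExact (shortExact_cone ψ)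
    obtain ⟨y, hy⟩ := T₃.exists_lift (j ≫ f) (by
      rw [← cancel_mono e.hom, Category.assoc, Category.assoc, ← Category.assoc f, ← huv,
        ← Category.assoc, T₂.comp_eq_zero, zero_comp, zero_comp])
    obtain ⟨G, a, b, hG, rfl⟩ := ih hX' y
    -- Pushing the triangle `X' ⟶ X ⟶ T` out along `a` gives `G ⟶ P ⟶ T`, so `P` needs one step more
    -- than `G`. Both `f` and the map from `G` extend to `P`, as they agree on `X'`.
    obtain ⟨P, i₁, i₂, p, ⟨t', T₄⟩, hP⟩ := exists_pushout T₂ a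
    obtain ⟨w, hw, -⟩ := hP _ f (b ≫ (Q A).map (coneInl ψ)) (by rw [← hy, Category.assoc])
    exact ⟨P, i₁, w, T₄.thickSelf hG (smd.of _ hT), hw⟩

/-- The converse of the ghost lemma for small objects. -/
lemma thickSelf_of_killsGhosts {n : ℕ} {M : DerivedCat A} (hM : IsSmall M)
    (h : KillsGhosts n M) : thickSelf A n M := by
  obtain ⟨M, rfl⟩ := Q_obj_surjective M
  obtain rfl | hn := eq_or_ne n 0
  -- The empty composite of ghosts is the identity.
  · exact (IsZero.iff_id_eq_zero _).2 (h _ _ (.id _))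
  obtain ⟨F, p, hF, hp⟩ := exists_semifree M n
  -- The inclusion into `Cone p` is a composite of `n` ghosts, hence zero, so the identity of `M`
  -- lifts to `F`.
  obtain ⟨s, hs⟩ := exists_cone_lift p (𝟙 _) ((Category.id_comp _).trans (h _ _ (hp hn)))
  obtain ⟨G, a, b, hG, rfl⟩ := exists_factor_of_isSemifree hF hM s
  exact thickSelf_of_retract hG a (b ≫ (Q A).map p) (by rw [← Category.assoc, hs])

lemma thickSelf_iff_killsGhosts {n : ℕ} {M : DerivedCat A} (hM : compact A M) :
    thickSelf A n M ↔ KillsGhosts n M :=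
  ⟨killsGhosts_of_thickSelf, thickSelf_of_killsGhosts (.of_compact hM)⟩

end DerivedCat

/-! ### Ghost length and level -/

lemma EReal.coe_toENNReal_natCast (n : ℕ) : (((n : ℕ∞) : ENNReal) : EReal) = n := by
  rw [ENat.toENNReal_coe, ← ENNReal.coe_natCast, EReal.coe_nnreal_eq_coe_real,
    NNReal.coe_natCast, EReal.coe_natCast]

namespace DerivedCat

variable {A : DGAlg k}

lemma hasGhostLength_iff {n : ℕ} {M : DerivedCat A} (hM : compact A M) :
    HasGhostLength M n ↔ thickSelf A (n + 1) M ∧ ¬ thickSelf A n M := by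
  rw [thickSelf_iff_killsGhosts hM, thickSelf_iff_killsGhosts hM]
  simp only [HasGhostLength, KillsGhosts]
  push Not
  exact Iff.rfl

/-- An infimum below `n + 1` is witnessed by some `m ≤ n`, and the classes `⟨A⟩_m` increase. -/
lemma level_le_iff {n : ℕ} {M : DerivedCat A} : level M ≤ n ↔ thickSelf A n M := by
  refine ⟨fun h => ?_, fun h => iInf₂_le n h⟩
  have h' : level M < ((n + 1 : ℕ) : ℕ∞) := lt_of_le_of_lt h (by exact_mod_cast n.lt_succ_self)
  simp only [level, iInf_lt_iff, Nat.cast_lt] at h'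
  obtain ⟨m, hm, hmn⟩ := h'
  exact thickSelf_mono (Nat.le_of_lt_succ hmn) hm

lemma level_eq_succ_iff {n : ℕ} {M : DerivedCat A} :
    level M = ((n + 1 : ℕ) : ℕ∞) ↔ thickSelf A (n + 1) M ∧ ¬ thickSelf A n M := by
  rw [← level_le_iff, ← level_le_iff, not_le, le_antisymm_iff, Nat.cast_add, Nat.cast_one,
    ENat.add_one_le_iff (ENat.natCast_ne_top n)]

lemma ghostLength_eq {M : DerivedCat A} (hM : compact A M) :
    ghostLength M = ((level M : ENNReal) : EReal) - 1 := by
  unfold ghostLength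
  split_ifs with h
  · have h₀ : level M = 0 := nonpos_iff_eq_zero.1 (level_le_iff (n := 0).2 h)
    simp [h₀]
  · simp only [hasGhostLength_iff hM, ← level_eq_succ_iff]
    obtain h' | h' := eq_or_ne (level M) ⊤
    · rw [h', ENat.toENNReal_top, EReal.coe_ennreal_top, ← EReal.coe_one, EReal.top_sub_coe]
      -- No `n` is a ghost length here, so the infimum is empty.
      exact iInf₂_eq_top.2 fun n hn => (ENat.natCast_ne_top _ hn.symm).elim
    · obtain ⟨m, hm⟩ := ENat.ne_top_iff_exists.1 h'
      obtain _ | m := m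
      · exact (h (level_le_iff (n := 0).1 hm.ge)).elim
      · have hm' : (((level M : ENNReal)) : EReal) - 1 = m := by
          rw [← hm, EReal.coe_toENNReal_natCast, ← EReal.coe_natCast, Nat.cast_add, Nat.cast_one,
            EReal.coe_add, ← EReal.coe_one, EReal.add_sub_cancel_right, EReal.coe_natCast]
        rw [hm']
        refine le_antisymm (iInf₂_le m hm.symm) (le_iInf₂ fun n hn => ?_)
        have h := hm.trans hn
        rw [Nat.cast_inj, Nat.add_right_cancel_iff] at h
        rw [h]

end DerivedCat

/-! ### Rouquier dimension and ghost dimension -/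

namespace DGAlg

variable {A : DGAlg k}

/-- Objects of `⟨A⟩_n` are always compact, so only one inclusion is a condition. -/
lemma thickSelf_eq_compact_iff {n : ℕ} : DerivedCat.thickSelf A n = DerivedCat.compact A ↔
    ∀ M, DerivedCat.compact A M → DerivedCat.thickSelf A n M :=
  ⟨fun h _ hM => h ▸ hM, fun h => funext fun _ =>
    propext ⟨fun hM => (DerivedCat.isSmall_of_thickSelf hM).compact, h _⟩⟩

lemma rouquierDim_le_iff {n : ℕ} :
    A.rouquierDim ≤ n ↔ ∀ M, DerivedCat.compact A M → DerivedCat.level M ≤ n := by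
  simp only [DerivedCat.level_le_iff]
  refine ⟨fun h M hM => ?_, fun h => iInf₂_le n (thickSelf_eq_compact_iff.2 h)⟩
  have h' : A.rouquierDim < ((n + 1 : ℕ) : ℕ∞) :=
    lt_of_le_of_lt h (by exact_mod_cast n.lt_succ_self)
  simp only [rouquierDim, iInf_lt_iff, Nat.cast_lt] at h'
  obtain ⟨m, hm, hmn⟩ := h'
  exact DerivedCat.thickSelf_mono (Nat.le_of_lt_succ hmn) (thickSelf_eq_compact_iff.1 hm M hM)

lemma level_le_rouquierDim {M : DerivedCat A} (hM : DerivedCat.compact A M) :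
    DerivedCat.level M ≤ A.rouquierDim := by
  obtain h | h := eq_or_ne A.rouquierDim ⊤
  · rw [h]
    exact le_top
  · obtain ⟨n, hn⟩ := ENat.ne_top_iff_exists.1 h
    rw [← hn]
    exact rouquierDim_le_iff.1 hn.ge M hM

lemma exists_compact_le_level {n : ℕ} (h : n ≤ A.rouquierDim) :
    ∃ M, DerivedCat.compact A M ∧ n ≤ DerivedCat.level M := by
  obtain _ | n := n
  · exact ⟨_, (DerivedCat.isSmall_of_isZero ((DerivedCat.Q A).map_isZero
      (DGMod.isZero_zero A))).compact, by simp⟩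
  · have h' : ¬ A.rouquierDim ≤ n := fun h' =>
      absurd (Nat.cast_le.1 (h.trans h')) n.lt_succ_self.not_ge
    rw [rouquierDim_le_iff] at h'
    push Not at h'
    obtain ⟨M, hM, hn⟩ := h'
    refine ⟨M, hM, ?_⟩
    rw [Nat.cast_add, Nat.cast_one]
    exact (ENat.add_one_le_iff (ENat.natCast_ne_top n)).2 hn

/-- The Rouquier dimension is the supremum of the levels of compact objects, and each ghost length
is a level minus one. -/
lemma rouquierDim_eq : ((A.rouquierDim : ENNReal) : EReal) = A.leftGhostDim + 1 := by
  refine le_antisymm ?_ ?_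
  -- Testing against natural numbers below the Rouquier dimension also covers the infinite case,
  -- where no single compact object need attain the supremum.
  · have key (n : ℕ) (hn : n ≤ A.rouquierDim) : (n : EReal) ≤ A.leftGhostDim + 1 := by
      obtain ⟨M, hM, h⟩ := exists_compact_le_level hn
      have h₁ : ((DerivedCat.level M : ENNReal) : EReal) - 1 ≤ A.leftGhostDim := by
        rw [← DerivedCat.ghostLength_eq hM]
        exact le_iSup₂_of_le M hM le_rfl
      refine le_trans ?_ ((EReal.sub_le_iff_le_add (.inl (EReal.coe_ne_bot 1))
        (.inl (EReal.coe_ne_top 1))).1 h₁)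
      rw [← EReal.coe_toENNReal_natCast, EReal.coe_ennreal_le_coe_ennreal_iff]
      exact_mod_cast h
    obtain h | h := eq_or_ne A.rouquierDim ⊤
    · rw [EReal.eq_top_iff_forall_lt (A.leftGhostDim + 1) |>.2 fun y => ?_]
      · exact le_top
      · obtain ⟨n, hn⟩ := exists_nat_gt y
        refine lt_of_lt_of_le ?_ (key n (h ▸ le_top))
        exact_mod_cast hn
    · obtain ⟨n, hn⟩ := ENat.ne_top_iff_exists.1 h
      rw [← hn]
      rw [EReal.coe_toENNReal_natCast]
      exact key n hn.le
  · refine (EReal.le_sub_iff_add_le (.inl (EReal.coe_ne_bot 1))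
      (.inl (EReal.coe_ne_top 1))).1 (iSup₂_le fun M hM => ?_)
    rw [DerivedCat.ghostLength_eq hM]
    refine EReal.sub_le_sub ?_ le_rfl
    rw [EReal.coe_ennreal_le_coe_ennreal_iff]
    exact_mod_cast level_le_rouquierDim hM

end DGAlg

end

theorem lemma5p6 {k : Type u} [Field k] (A : DGAlg k) (hA : A.IsConnectedCochain) :
    (∀ M : DerivedCat A, DerivedCat.compact A M →
      DerivedCat.ghostLength M = ((DerivedCat.level M : ENNReal) : EReal) - 1) ∧
    ((A.rouquierDim : ENNReal) : EReal) = A.leftGhostDim + 1 := by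
  exact ⟨fun _ hM => DerivedCat.ghostLength_eq hM, DGAlg.rouquierDim_eq⟩
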